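/- **Theorem (higher descent equations).** Let $\mathfrak v=(\mathfrak v_0,\mathfrak v_1)$ be a balanced 2-term $L_\infty$ algebra: finite-dimensional real vector spaces with $\dim\mathfrak v_0=\dim\mathfrak v_1$, a linear map $\alpha:\mathfrak v_1\to\mathfrak v_0$, an alternating bilinear bracket $[x,y]\in\mathfrak v_0$, a bilinear action $[x,X]\in\mathfrak v_1$ and an alternating trilinear bracket $[x,y,z]\in\mathfrak v_1$ such that for all $x,y,z,t\in\mathfrak v_0$, $X,Y\in\mathfrak v_1$ $$\alpha([x,X])=[x,\alpha(X)],\qquad [\alpha(X),Y]+[\alpha(Y),X]=0,$$ $$[x,[y,z]]+[y,[z,x]]+[z,[x,y]]=\alpha([x,y,z]),\qquad [x,[y,X]]-[y,[x,X]]-[[x,y],X]=[x,y,\alpha(X)],$$ $$[x,y,[z,t]]+[x,z,[t,y]]+[x,t,[y,z]]-[y,z,[t,x]]-[z,t,[y,x]]-[t,y,[z,x]]-[x,[y,z,t]]+[y,[z,t,x]]-[z,[t,x,y]]+[t,[x,y,z]]=0.$$ Let $\langle x_1,\dots,x_r;X\rangle\in\mathbb R$ be a symmetric invariant form of degree $r$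 on $\mathfrak v$, i.e. multilinear in $x_1,\dots,x_r\in\mathfrak v_0$ and $X\in\mathfrak v_1$, symmetric in $x_1,\dots,x_r$, and such that $$\langle x_1,\dots,x_r;[x,X]\rangle=-\sum_{i=1}^r\langle x_1,\dots,[x,x_i],\dots,x_r;X\rangle,\qquad \langle x_1,\dots,\alpha(X),\dots,x_r;Y\rangle=\langle x_1,\dots,\alpha(Y),\dots,x_r;X\rangle,$$ $$\langle x_1,\dots,x_r;[x,y,z]\rangle=-\sum_{i=1}^r\langle x_1,\dots,x_{i-1},z,x_{i+1},\dots,x_r;[x,y,x_i]\rangle .$$ The brackets, $\alpha$ and the form are extended to $\mathfrak v_i$-valued differential forms by wedging the scalar coefficients in the order in which they are written. Let $M$ be a smooth manifold. A connection doublet on $M$ is a pair of smooth forms $A\in\Omega^1(M,\mathfrak v_0)$, $B\in\Omega^2(M,\mathfrak v_1)$; its curvatures are $$\mathcal F=dA+\tfrac12[A,A]-\alpha(B),\qquad \mathcal H=dB+[A,B]-\tfrac16[A,A,A].$$ For $0\le k\le r$ and connection doublets $(A_0,B_0),\dots,(A_k,B_k)$ put $\eta^{i,0}=A_i-A_0$,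 $\phi^{i,0}=B_i-B_0$, and let $\mathcal F_t,\mathcal H_t$ be the curvatures of the doublet $\big(A_0+\sum_{i=1}^k t_i\eta^{i,0},\;B_0+\sum_{i=1}^k t_i\phi^{i,0}\big)$ for $t$ in the simplex $\Delta_k=\{t\in[0,1]^k:\ t_1+\dots+t_k\le1\}$. Define the $(2r-k+3)$-form $$\mathcal Q_r^{(k)}\big((A_0,B_0),\dots,(A_k,B_k);\Delta_k\big)=\frac{r!}{(r-k)!}\int_{\Delta_k}dt_1\cdots dt_k\,\big\langle\eta^{1,0},\dots,\eta^{k,0},\mathcal F_t^{\,r-k};\mathcal H_t\big\rangle$$ $$\qquad+\frac{r!}{(r-k+1)!}(-1)^k\int_{\Delta_k}dt_1\cdots dt_k\sum_{i=1}^k(-1)^i\big\langle\eta^{1,0},\dots,\widehat{\eta^{i,0}},\dots,\eta^{k,0},\mathcal F_t^{\,r-k+1};\phi^{i,0}\big\rangle ,$$ where $\mathcal F_t^{\,j}$ stands for $j$ arguments equal to $\mathcal F_t$ and a hat marks an omitted argument. Then for all $1\le k\le r$ and all connection doublets $(A_0,B_0),\dots,(A_k,B_k)$ on $M$ the form $\mathcal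 Q_r^{(k)}$ is smooth and $$d\,\mathcal Q_r^{(k)}\big((A_0,B_0),\dots,(A_k,B_k);\Delta_k\big)=\sum_{i=0}^k(-1)^i\,\mathcal Q_r^{(k-1)}\big((A_0,B_0),\dots,\widehat{(A_i,B_i)},\dots,(A_k,B_k);\Delta_{k-1}\big).$$ For $k=1$ this is the higher Chern–Weil theorem $\langle\mathcal F_1^{\,r};\mathcal H_1\rangle-\langle\mathcal F_0^{\,r};\mathcal H_0\rangle=d\mathcal Q_r^{(1)}$ (with $\mathcal F_i,\mathcal H_i$ the curvatures of $(A_i,B_i)$), and for $k=2$ the higher triangle equation. -/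

import Mathlib

open scoped Manifold ContDiff
open MeasureTheory

noncomputable section

namespace HigherCS

/-! ### 2-term `L∞` algebras and invariant forms -/

/-- A 2-term `L∞` algebra on the real vector spaces `V₀` (degree `0`) and `V₁` (degree `1`). -/
structure TwoTermLInfty (V₀ V₁ : Type*) [AddCommGroup V₀] [Module ℝ V₀]
    [AddCommGroup V₁] [Module ℝ V₁] where
  /-- the differential `α : V₁ → V₀` -/
  α : V₁ →ₗ[ℝ] V₀
  /-- the bracket `[x, y]` of `V₀` -/
  br : V₀ →ₗ[ℝ] V₀ →ₗ[ℝ] V₀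
  /-- the action `[x, X]` of `V₀` on `V₁` -/
  act : V₀ →ₗ[ℝ] V₁ →ₗ[ℝ] V₁
  /-- the trilinear bracket `[x, y, z]` -/
  jac : V₀ →ₗ[ℝ] V₀ →ₗ[ℝ] V₀ →ₗ[ℝ] V₁
  br_self : ∀ x, br x x = 0
  jac_self_left : ∀ x y, jac x x y = 0
  jac_self_right : ∀ x y, jac x y y = 0
  α_act : ∀ x X, α (act x X) - br x (α X) = 0
  act_α : ∀ X Y, act (α X) Y + act (α Y) X = 0
  jacobi₀ : ∀ x y z, br x (br y z) + br y (br z x) + br z (br x y) - α (jac x y z) = 0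
  jacobi₁ : ∀ x y X, act x (act y X) - act y (act x X) - act (br x y) X - jac x y (α X) = 0
  coherence : ∀ x y z t,
    jac x y (br z t) + jac x z (br t y) + jac x t (br y z)
      - jac y z (br t x) - jac z t (br y x) - jac t y (br z x)
      - act x (jac y z t) + act y (jac z t x) - act z (jac t x y) + act t (jac x y z) = 0

/-- A symmetric invariant form `⟨x₁, …, x_r; X⟩` of degree `r` on a 2-term `L∞` algebra. -/
structure InvariantForm {V₀ V₁ : Type*} [AddCommGroup V₀] [Module ℝ V₀]
    [AddCommGroup V₁] [Module ℝ V₁] (L : TwoTermLInfty V₀ V₁) (r : ℕ) where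
  /-- the underlying multilinear map `(x₁, …, x_r) ↦ (X ↦ ⟨x₁, …, x_r; X⟩)` -/
  form : MultilinearMap ℝ (fun _ : Fin r => V₀) (V₁ →ₗ[ℝ] ℝ)
  form_act : ∀ (v : Fin r → V₀) (x : V₀) (X : V₁),
    form v (L.act x X) = - ∑ i, form (Function.update v i (L.br x (v i))) X
  form_α : ∀ (v : Fin r → V₀) (i : Fin r) (X Y : V₁),
    form (Function.update v i (L.α X)) Y = form (Function.update v i (L.α Y)) X
  form_jac : ∀ (v : Fin r → V₀) (x y z : V₀),
    form v (L.jac x y z) = - ∑ i, form (Function.update v i z) (L.jac x y (v i))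
  form_symm : ∀ (v : Fin r → V₀) (i j : Fin r) (X : V₁),
    form (v ∘ Equiv.swap i j) X = form v X

/-! ### Products of alternating forms on one vector space -/

section Algebra

variable {T : Type*} [NormedAddCommGroup T] [NormedSpace ℝ T] [FiniteDimensional ℝ T]
  {F G H : Type*} [AddCommGroup F] [Module ℝ F] [AddCommGroup G] [Module ℝ G]
  [AddCommGroup H] [Module ℝ H]

/-- Multilinear maps on a finite-dimensional space are continuous. -/
theorem multilinear_continuous {ι : Type*} [Fintype ι]
    [TopologicalSpace H] [IsTopologicalAddGroup H] [ContinuousSMul ℝ H]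
    (f : MultilinearMap ℝ (fun _ : ι => T) H) : Continuous f := by
  classical
  let b := Module.finBasis ℝ T
  have h : (f : (ι → T) → H) = fun v => ∑ s : ι → Fin (Module.finrank ℝ T),
      (∏ i, b.coord (s i) (v i)) • f (fun i => b (s i)) := by
    funext v
    conv_lhs => rw [show v = fun i => ∑ j, b.coord j (v i) • b j from
      funext fun i => by simp [b.sum_repr]]
    rw [f.map_sum]
    exact Finset.sum_congr rfl fun s _ => f.map_smul_univ _ _
  rw [h]
  refine continuous_finsetSum _ fun s _ => Continuous.smul ?_ continuous_const
  refine continuous_finsetProd _ fun i _ => ?_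
  exact (LinearMap.continuous_of_finiteDimensional _).comp (continuous_apply i)

/-- The alternating `n`-form `(1/N) ∑_σ sign(σ) m ∘ σ` attached to a multilinear map `m`, where
`e` lists the arguments of `m` in order. -/
def alternate {ι : Type*} [TopologicalSpace H] [IsTopologicalAddGroup H] [ContinuousSMul ℝ H]
    {n : ℕ} (N : ℕ) (e : ι ≃ Fin n) (m : MultilinearMap ℝ (fun _ : ι => T) H) :
    T [⋀^Fin n]→L[ℝ] H :=
  (N : ℝ)⁻¹ •
    ContinuousMultilinearMap.alternatization
      ⟨m.domDomCongr e, multilinear_continuous (m.domDomCongr e)⟩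

/-- The multilinear map `(u, v) ↦ μ (a u) (b v)`. -/
def tensorMul {ι₁ ι₂ : Type*} (μ : F →ₗ[ℝ] G →ₗ[ℝ] H)
    (a : MultilinearMap ℝ (fun _ : ι₁ => T) F) (b : MultilinearMap ℝ (fun _ : ι₂ => T) G) :
    MultilinearMap ℝ (fun _ : ι₁ ⊕ ι₂ => T) H :=
  (TensorProduct.lift μ).compMultilinearMap (a.domCoprod b)

variable [TopologicalSpace F] [TopologicalSpace G]
  [TopologicalSpace H] [IsTopologicalAddGroup H] [ContinuousSMul ℝ H]

/-- The wedge product `∑ ψᵃ ∧ θᵇ μ(x_a, y_b)` of a `p`-form `ψ = ∑ ψᵃ x_a` and a `q`-form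
`θ = ∑ θᵇ y_b` along a bilinear map `μ`. -/
def wedge₂ (μ : F →ₗ[ℝ] G →ₗ[ℝ] H) {p q : ℕ}
    (ψ : T [⋀^Fin p]→L[ℝ] F) (θ : T [⋀^Fin q]→L[ℝ] G) : T [⋀^Fin (p + q)]→L[ℝ] H :=
  alternate (p.factorial * q.factorial) finSumFinEquiv
    (tensorMul μ ψ.toMultilinearMap θ.toMultilinearMap)

/-- The wedge product `∑ ψ₁ᵃ ∧ ψ₂ᵇ ∧ ψ₃ᶜ μ(x_a, x_b, x_c)` of three forms along a trilinear
map `μ`. -/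
def wedge₃ (μ : F →ₗ[ℝ] F →ₗ[ℝ] F →ₗ[ℝ] H) {p q s : ℕ} (ψ₁ : T [⋀^Fin p]→L[ℝ] F)
    (ψ₂ : T [⋀^Fin q]→L[ℝ] F) (ψ₃ : T [⋀^Fin s]→L[ℝ] F) : T [⋀^Fin (p + q + s)]→L[ℝ] H :=
  alternate (p.factorial * q.factorial * s.factorial)
    ((finSumFinEquiv.sumCongr (Equiv.refl _)).trans finSumFinEquiv)
    (tensorMul LinearMap.id (tensorMul μ ψ₁.toMultilinearMap ψ₂.toMultilinearMap)
      ψ₃.toMultilinearMap)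

/-- The extension `∑ ψ₁^{a₁} ∧ ⋯ ∧ ψ_r^{a_r} ∧ θᵇ P(x_{a₁}, …, x_{a_r}; y_b)` of a multilinear map
`P` to forms `ψ_i` (each given together with its degree) and `θ`, of total degree `n`. -/
def wedgePair {r : ℕ} (P : MultilinearMap ℝ (fun _ : Fin r => F) (G →ₗ[ℝ] ℝ))
    (ψ : Fin r → Σ d : ℕ, T [⋀^Fin d]→L[ℝ] F) {q : ℕ} (θ : T [⋀^Fin q]→L[ℝ] G)
    {n : ℕ} (h : ∑ i, (ψ i).1 + q = n) : T [⋀^Fin n]→L[ℝ] ℝ :=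
  alternate ((∏ i, (ψ i).1.factorial) * q.factorial)
    (((finSigmaFinEquiv.sumCongr (Equiv.refl _)).trans finSumFinEquiv).trans (finCongr h))
    (tensorMul LinearMap.id (P.compMultilinearMap fun i => (ψ i).2.toMultilinearMap)
      θ.toMultilinearMap)

end Algebra

/-- The `r` arguments `a₁, …, a_m, f, …, f`, with `m` one-forms `a_i` and a two-form `f`. -/
def slots {T F : Type*} [NormedAddCommGroup T] [NormedSpace ℝ T]
    [AddCommGroup F] [Module ℝ F] [TopologicalSpace F] (r : ℕ) {m : ℕ}
    (a : Fin m → T [⋀^Fin 1]→L[ℝ] F) (f : T [⋀^Fin 2]→L[ℝ] F) :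
    Fin r → Σ d : ℕ, T [⋀^Fin d]→L[ℝ] F :=
  fun j => if h : (j : ℕ) < m then ⟨1, a ⟨j, h⟩⟩ else ⟨2, f⟩

theorem slots_degree {T F : Type*} [NormedAddCommGroup T] [NormedSpace ℝ T]
    [AddCommGroup F] [Module ℝ F] [TopologicalSpace F] (r : ℕ) {m : ℕ}
    (a : Fin m → T [⋀^Fin 1]→L[ℝ] F) (f : T [⋀^Fin 2]→L[ℝ] F) (hm : m ≤ r) :
    ∑ j, (slots r a f j).1 + m = 2 * r := by
  obtain ⟨l, rfl⟩ := Nat.exists_eq_add_of_le hm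
  rw [Fin.sum_univ_add]
  have h1 : ∀ i : Fin m, (slots (m + l) a f (Fin.castAdd l i)).1 = 1 := fun i => by
    simp [slots]
  have h2 : ∀ i : Fin l, (slots (m + l) a f (Fin.natAdd m i)).1 = 2 := fun i => by
    simp [slots]
  simp only [h1, h2, Finset.sum_const, Finset.card_univ, Fintype.card_fin, smul_eq_mul]
  ring

/-- The list `a₁, …, âᵢ, …, a_k` with its `i`-th entry deleted. -/
def omitAt {X : Type*} {k : ℕ} (a : Fin k → X) (i : Fin k) : Fin (k - 1) → X :=
  fun j => a ⟨if (j : ℕ) < i then j else j + 1, by split_ifs <;> omega⟩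

/-! ### Differential forms on a manifold -/

section Manifold

variable {m : ℕ} {M : Type*} [TopologicalSpace M] [ChartedSpace (EuclideanSpace ℝ (Fin m)) M]
  {V : Type*} [NormedAddCommGroup V] [NormedSpace ℝ V]

variable (m M V) in
/-- `V`-valued differential `n`-forms on the `m`-dimensional manifold `M` (not necessarily
continuous): an alternating form on the tangent space at `x` for every point `x`. The tangent space
`TangentSpace (𝓡 m) x` is by definition the model space `EuclideanSpace ℝ (Fin m)`, with the chart
at `x` as the preferred chart; in the definitions below forms are pulled back along the derivatives
`mfderiv` of charts. -/
abbrev DForm (n : ℕ) : Type _ := M → EuclideanSpace ℝ (Fin m) [⋀^Fin n]→L[ℝ] V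

/-- The derivative at `y` of the inverse of the chart at `x₀`, a map from the model space to the
tangent space. -/
def chartSymmDeriv (x₀ : M) (y : EuclideanSpace ℝ (Fin m)) :
    EuclideanSpace ℝ (Fin m) →L[ℝ] EuclideanSpace ℝ (Fin m) :=
  mfderiv 𝓘(ℝ, EuclideanSpace ℝ (Fin m)) (𝓡 m) (extChartAt (𝓡 m) x₀).symm y

/-- The derivative at `x` of the chart at `x₀`, a map from the tangent space to the model space. -/
def chartDeriv (x₀ x : M) : EuclideanSpace ℝ (Fin m) →L[ℝ] EuclideanSpace ℝ (Fin m) :=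
  mfderiv (𝓡 m) 𝓘(ℝ, EuclideanSpace ℝ (Fin m)) (extChartAt (𝓡 m) x₀) x

/-- The expression of a differential form in the chart at `x₀`: the pull-back of the form along the
inverse of the chart. -/
def DForm.local {n : ℕ} (ψ : DForm m M V n) (x₀ : M) :
    EuclideanSpace ℝ (Fin m) → EuclideanSpace ℝ (Fin m) [⋀^Fin n]→L[ℝ] V :=
  fun y => (ψ ((extChartAt (𝓡 m) x₀).symm y)).compContinuousLinearMap (chartSymmDeriv x₀ y)

/-- A differential form is smooth if its expressions in charts are. -/
def DForm.IsSmooth {n : ℕ} (ψ : DForm m M V n) : Prop :=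
  ∀ x₀ : M, ContDiffOn ℝ ∞ (ψ.local x₀) (extChartAt (𝓡 m) x₀).target

/-- The exterior derivative: at `x` it is the pull-back along the chart at `x` of the exterior
derivative of the expression of the form in this chart. -/
def DForm.d {n : ℕ} (ψ : DForm m M V n) : DForm m M V (n + 1) :=
  fun x => (extDeriv (ψ.local x) (extChartAt (𝓡 m) x x)).compContinuousLinearMap (chartDeriv x x)

/-- The set `Δ_k` of all `t` with `0 ≤ t_i ≤ 1` and `t_1 + ⋯ + t_k ≤ 1`. -/
def simplex (k : ℕ) : Set (Fin k → ℝ) :=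
  {t | (∀ i, 0 ≤ t i ∧ t i ≤ 1) ∧ ∑ i, t i ≤ 1}

/-- `∫_{Δ_k} dt₁ ∧ ⋯ ∧ dt_k ψ_t` for a family of forms `ψ_t`, taken pointwise on `M`. -/
def simplexIntegral {k n : ℕ} (ψ : (Fin k → ℝ) → DForm m M V n) : DForm m M V n :=
  fun x => ∫ t in simplex k, ψ t x

variable {V₀ V₁ : Type*} [NormedAddCommGroup V₀] [NormedSpace ℝ V₀]
  [NormedAddCommGroup V₁] [NormedSpace ℝ V₁]

/-- The curvature `𝓕 = dA + ½ [A, A] - α(B)` of a doublet `(A, B)`. -/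
def curvF [FiniteDimensional ℝ V₁] (L : TwoTermLInfty V₀ V₁)
    (A : DForm m M V₀ 1) (B : DForm m M V₁ 2) : DForm m M V₀ 2 :=
  fun x => A.d x + (1 / 2 : ℝ) • wedge₂ L.br (A x) (A x)
    - (LinearMap.toContinuousLinearMap L.α).compContinuousAlternatingMap (B x)

/-- The curvature `𝓗 = dB + [A, B] - ⅙ [A, A, A]` of a doublet `(A, B)`. -/
def curvH (L : TwoTermLInfty V₀ V₁)
    (A : DForm m M V₀ 1) (B : DForm m M V₁ 2) : DForm m M V₁ 3 :=
  fun x => B.d x + wedge₂ L.act (A x) (B x) - (1 / 6 : ℝ) • wedge₃ L.jac (A x) (A x) (A x)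

variable (m M V₀ V₁) in
/-- A connection doublet: a smooth `V₀`-valued one-form and a smooth `V₁`-valued two-form. -/
structure Connection where
  A : DForm m M V₀ 1
  B : DForm m M V₁ 2
  smooth_A : A.IsSmooth
  smooth_B : B.IsSmooth

variable {k : ℕ} (c : Fin (k + 1) → Connection m M V₀ V₁)

/-- `η^{i,0} = A_i - A_0`; the index `i : Fin k` stands for the connection number `i + 1`. -/
def η (i : Fin k) : DForm m M V₀ 1 := fun x => (c i.succ).A x - (c 0).A x

/-- `φ^{i,0} = B_i - B_0`; the index `i : Fin k` stands for the connection number `i + 1`. -/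
def φ (i : Fin k) : DForm m M V₁ 2 := fun x => (c i.succ).B x - (c 0).B x

/-- `A_{0,t₁⋯t_k} = A_0 + ∑ t_i η^{i,0}`. -/
def interpA (t : Fin k → ℝ) : DForm m M V₀ 1 := fun x => (c 0).A x + ∑ i, t i • η c i x

/-- `B_{0,t₁⋯t_k} = B_0 + ∑ t_i φ^{i,0}`. -/
def interpB (t : Fin k → ℝ) : DForm m M V₁ 2 := fun x => (c 0).B x + ∑ i, t i • φ c i x

variable [FiniteDimensional ℝ V₁] {L : TwoTermLInfty V₀ V₁}

/-- `𝓕_{0,t₁⋯t_k}`, the curvature of the interpolated doublet. -/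
def interpF (L : TwoTermLInfty V₀ V₁) (t : Fin k → ℝ) : DForm m M V₀ 2 :=
  curvF L (interpA c t) (interpB c t)

/-- `𝓗_{0,t₁⋯t_k}`, the curvature of the interpolated doublet. -/
def interpH (L : TwoTermLInfty V₀ V₁) (t : Fin k → ℝ) : DForm m M V₁ 3 :=
  curvH L (interpA c t) (interpB c t)

variable {r : ℕ} (P : InvariantForm L r) (hk : k ≤ r) {n : ℕ} (hn : n + k = 2 * r + 3)

/-- `⟨η^{1,0}, …, η^{k,0}, 𝓕_t^{r-k}; 𝓗_t⟩`. -/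
def integrandH (t : Fin k → ℝ) : DForm m M ℝ n := fun x =>
  wedgePair P.form (slots r (fun j => η c j x) (interpF c L t x)) (interpH c L t x) (by
    have := slots_degree r (fun j => η c j x) (interpF c L t x) hk
    omega)

/-- `⟨η^{1,0}, …, η̂^{i,0}, …, η^{k,0}, 𝓕_t^{r-k+1}; φ^{i,0}⟩`. -/
def integrandφ (i : Fin k) (t : Fin k → ℝ) : DForm m M ℝ n := fun x =>
  wedgePair P.form (slots r (omitAt (fun j => η c j x) i) (interpF c L t x)) (φ c i x) (by
    have := slots_degree r (omitAt (fun j => η c j x) i) (interpF c L t x) (by omega)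
    have := i.isLt
    omega)

/-- The higher Chern–Simons type characteristic class `𝓠_r^{(k)}((A_0,B_0), …, (A_k,B_k); Δ_k)`, a
form of degree `n = 2r - k + 3`. The sign `(-1)^i` of the `i`-th summand appears as `(-1)^(i+1)`,
since `i : Fin k` is counted from `0`. -/
def chernSimons : DForm m M ℝ n := fun x =>
  ((r.factorial : ℝ) / ((r - k).factorial : ℝ)) • simplexIntegral (integrandH c P hk hn) x
  + ((r.factorial : ℝ) / ((r - k + 1).factorial : ℝ) * (-1) ^ k) •
    simplexIntegral (fun t x => ∑ i : Fin k, (-1 : ℝ) ^ ((i : ℕ) + 1) •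
      integrandφ c P hk hn i t x) x

end Manifold

end HigherCS

end

/-! The equations are Chern–Weil theory over the simplex. Let `K` be the dimension of the simplex.
For a single doublet the form ⟨𝓕^r; 𝓗⟩ is closed: the Bianchi identities d𝓕 = -[A,𝓕] - α(𝓗) and d𝓗 =
-[A,𝓗] + [𝓕,B] - ½[A,A,𝓕] (`hat_extDeriv_locF`, `hat_extDeriv_locH`) turn its differential into an
expression that the invariance axioms annihilate (`invariant_closed`, `extDeriv_invariant`).

In a chart domain of the model space `E`, this is applied on `E × ℝᴷ` to the universal doublet
`univForm`, which at `(y, t)` is the interpolated doublet and has no `dt` components. Its curvatures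
are 𝓕_t + ∑ dtᵢ ηⁱ and 𝓗_t + ∑ dtᵢ φⁱ. Contracting ⟨𝓕^r; 𝓗⟩ with vertical vectors therefore produces
the integrand of the Chern–Simons form together with its factorials, up to the sign `contrSign`
(`contrIter_extP`, `csForm_eq_univInv`).

Closedness of the universal form, evaluated on `K` vertical and otherwise horizontal vectors, splits
into the differential of the integrand along `E` and the partial derivatives in `t` of the
contractions with `K - 1` vertical vectors (`extDeriv_csIntegrand`). Integration over the simplex
moves the latter to its faces (`setIntegral_simplex_fderiv`). On the face where one coordinate
vanishes, the integrand is that of the family with the corresponding connection omitted. On the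
slanted face the contributions of all coordinates combine, by the expansion of (v₁ - v₀) ∧ ⋯ ∧ (v_k
- v₀) in `contrIter_sub`, into the integrand of the family without the connection number 0. This is
`extDeriv_csLocal`. Since wedge products, curvatures and `d` commute with pull-back, the local
statement gives the global one.

All sign computations take place in Λ(T*) ⊗ F, into which forms embed by `hat` (`hat_injective`).
There wedge products are products of coefficients, `d` is ∑ eʲ ∂ⱼ, two-forms have central
coefficients, and contraction is an antiderivation. -/

open scoped TensorProduct

noncomputable section

namespace HigherCS

/-! ### Vector-valued forms as elements of an exterior algebra -/

section Hat

/-- The exterior algebra of the dual space of `T`. -/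
abbrev ExtDual (T : Type*) [AddCommGroup T] [Module ℝ T] : Type _ :=
  ExteriorAlgebra ℝ (Module.Dual ℝ T)

/-! ### Extension of multilinear maps to coefficients in an algebra -/

section Extension

variable (A : Type*) [Ring A] [Algebra ℝ A]
variable {F G H K : Type*} [AddCommGroup F] [Module ℝ F] [AddCommGroup G] [Module ℝ G]
  [AddCommGroup H] [Module ℝ H] [AddCommGroup K] [Module ℝ K]

/-- The extension `(a ⊗ x, b ⊗ y) ↦ a b ⊗ μ(x, y)` of a bilinear map. -/
def ext₂ (μ : F →ₗ[ℝ] G →ₗ[ℝ] H) : A ⊗[ℝ] F →ₗ[ℝ] A ⊗[ℝ] G →ₗ[ℝ] A ⊗[ℝ] H :=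
  TensorProduct.map₂ (LinearMap.mul ℝ A) μ

variable {A} in
@[simp]
theorem ext₂_tmul (μ : F →ₗ[ℝ] G →ₗ[ℝ] H) (a b : A) (x : F) (y : G) :
    ext₂ A μ (a ⊗ₜ x) (b ⊗ₜ y) = (a * b) ⊗ₜ μ x y := by
  simp [ext₂, TensorProduct.map₂_apply_tmul]

/-- The coefficient functional `a ⊗ x ↦ c i x • a` attached to a basis `c`. -/
def coeff [FiniteDimensional ℝ F] (i : Fin (Module.finrank ℝ F)) : A ⊗[ℝ] F →ₗ[ℝ] A :=
  (TensorProduct.rid ℝ A).toLinearMap ∘ₗ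
    ((Module.finBasis ℝ F).coord i).lTensor A

variable {A} in
@[simp]
theorem coeff_tmul [FiniteDimensional ℝ F] (i : Fin (Module.finrank ℝ F)) (a : A) (x : F) :
    coeff A i (a ⊗ₜ x) = (Module.finBasis ℝ F).coord i x • a := by
  simp [coeff]

/-- The extension `(a₁ ⊗ x₁, …, a_r ⊗ x_r) ↦ a₁ ⋯ a_r ⊗ P(x₁, …, x_r)` of a multilinear map. -/
def extM [FiniteDimensional ℝ F] {r : ℕ} (P : MultilinearMap ℝ (fun _ : Fin r => F) K) :
    MultilinearMap ℝ (fun _ : Fin r => A ⊗[ℝ] F) (A ⊗[ℝ] K) :=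
  ∑ s : Fin r → Fin (Module.finrank ℝ F),
    ((TensorProduct.mk ℝ A K).flip (P fun i => Module.finBasis ℝ F (s i))).compMultilinearMap
      ((MultilinearMap.mkPiAlgebraFin ℝ r A).compLinearMap fun i => coeff A (s i))

variable {A} in
theorem extM_apply [FiniteDimensional ℝ F] {r : ℕ}
    (P : MultilinearMap ℝ (fun _ : Fin r => F) K) (f : Fin r → A ⊗[ℝ] F) :
    extM A P f = ∑ s : Fin r → Fin (Module.finrank ℝ F),
      (List.ofFn fun i => coeff A (s i) (f i)).prod ⊗ₜ[ℝ] P fun i => Module.finBasis ℝ F (s i) := by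
  simp [extM]

variable {A} in
theorem multilinear_basis_expansion [FiniteDimensional ℝ F] {r : ℕ}
    (P : MultilinearMap ℝ (fun _ : Fin r => F) K) (x : Fin r → F) :
    P x = ∑ s : Fin r → Fin (Module.finrank ℝ F),
      (∏ i, (Module.finBasis ℝ F).coord (s i) (x i)) • P fun i => Module.finBasis ℝ F (s i) := by
  conv_lhs => rw [show x = fun i => ∑ j, (Module.finBasis ℝ F).coord j (x i) •
    Module.finBasis ℝ F j from funext fun i => by simp [(Module.finBasis ℝ F).sum_repr]]
  rw [P.map_sum]
  exact Finset.sum_congr rfl fun s _ => P.map_smul_univ _ _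

variable {A} in
-- Scalars are central, so the coordinates of the vectors come out of the ordered product of
-- coefficients, and what remains is the basis expansion of `P`. In particular `extM` does not
-- depend on the basis used to define it.
theorem extM_tmul [FiniteDimensional ℝ F] {r : ℕ}
    (P : MultilinearMap ℝ (fun _ : Fin r => F) K) (a : Fin r → A) (x : Fin r → F) :
    extM A P (fun i => a i ⊗ₜ x i) = (List.ofFn a).prod ⊗ₜ P x := by
  rw [extM_apply, multilinear_basis_expansion P x, TensorProduct.tmul_sum]
  refine Finset.sum_congr rfl fun s _ => ?_
  have h := (MultilinearMap.mkPiAlgebraFin ℝ r A).map_smul_univ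
    (fun i => (Module.finBasis ℝ F).coord (s i) (x i)) a
  simp only [MultilinearMap.mkPiAlgebraFin_apply] at h
  simp only [coeff_tmul]
  rw [h, TensorProduct.smul_tmul]

end Extension

/-! ### Multilinear maps as exterior-algebra elements -/

variable {T : Type*} [NormedAddCommGroup T] [NormedSpace ℝ T] [FiniteDimensional ℝ T]
  {F G H K : Type*} [AddCommGroup F] [Module ℝ F] [AddCommGroup G] [Module ℝ G]
  [AddCommGroup H] [Module ℝ H] [AddCommGroup K] [Module ℝ K]

/-- The `i`-th generator of the exterior algebra of the dual space. -/
def gen (T : Type*) [NormedAddCommGroup T] [NormedSpace ℝ T] [FiniteDimensional ℝ T]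
    (i : Fin (Module.finrank ℝ T)) : ExtDual T :=
  ExteriorAlgebra.ι ℝ ((Module.finBasis ℝ T).coord i)

/-- The element `∑ e^{s₁} ⋯ e^{sₙ} ⊗ m(b_{s₁}, …, b_{sₙ})` attached to a multilinear map. -/
def grass (n : ℕ) : MultilinearMap ℝ (fun _ : Fin n => T) H →ₗ[ℝ] ExtDual T ⊗[ℝ] H :=
  ∑ s : Fin n → Fin (Module.finrank ℝ T),
    (TensorProduct.mk ℝ (ExtDual T) H
      (ExteriorAlgebra.ιMulti ℝ n fun i => (Module.finBasis ℝ T).coord (s i))) ∘ₗ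
    { toFun := fun m => m fun i => Module.finBasis ℝ T (s i)
      map_add' := fun _ _ => rfl
      map_smul' := fun _ _ => rfl }

theorem grass_apply {n : ℕ} (m : MultilinearMap ℝ (fun _ : Fin n => T) H) :
    grass n m = ∑ s : Fin n → Fin (Module.finrank ℝ T),
      (ExteriorAlgebra.ιMulti ℝ n fun i => (Module.finBasis ℝ T).coord (s i)) ⊗ₜ[ℝ]
        m fun i => Module.finBasis ℝ T (s i) := by
  simp [grass]

theorem grass_eq_list {n : ℕ} (m : MultilinearMap ℝ (fun _ : Fin n => T) H) :
    grass n m = ∑ s : Fin n → Fin (Module.finrank ℝ T),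
      (List.ofFn fun i => gen T (s i)).prod ⊗ₜ[ℝ] m fun i => Module.finBasis ℝ T (s i) := by
  simp [grass_apply, ExteriorAlgebra.ιMulti_apply, gen]

/-- Reindexing the sum by the permutation moves it from the arguments of `m` to the monomial of
generators, which is alternating. -/
theorem grass_perm {n : ℕ} (σ : Equiv.Perm (Fin n))
    (m : MultilinearMap ℝ (fun _ : Fin n => T) H) :
    grass n (m.domDomCongr σ) = (Equiv.Perm.sign σ : ℤ) • grass n m := by
  rw [grass_apply, grass_apply, Finset.smul_sum]
  refine Fintype.sum_equiv (σ.arrowCongr (Equiv.refl _)).symm _ _ fun s => ?_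
  have h := (ExteriorAlgebra.ιMulti ℝ n).map_perm
    (fun i => (Module.finBasis ℝ T).coord (s i)) σ
  simp only [MultilinearMap.domDomCongr_apply]
  have h2 : (ExteriorAlgebra.ιMulti ℝ n fun i => (Module.finBasis ℝ T).coord
      ((σ.arrowCongr (Equiv.refl _)).symm s i)) = (ExteriorAlgebra.ιMulti ℝ n)
      ((fun i => (Module.finBasis ℝ T).coord (s i)) ∘ σ) := rfl
  have h3 : (m fun i => Module.finBasis ℝ T ((σ.arrowCongr (Equiv.refl _)).symm s i)) =
      m fun i => Module.finBasis ℝ T (s (σ i)) := rfl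
  rw [h2, h, h3]
  obtain h4 | h4 := Int.units_eq_one_or (Equiv.Perm.sign σ) <;>
    simp [h4, TensorProduct.neg_tmul]

/-- Each of the `n!` permuted terms contributes the same element, because the sign of the
permutation occurs twice. -/
theorem grass_alternate [TopologicalSpace H] [IsTopologicalAddGroup H] [ContinuousSMul ℝ H]
    {ι : Type*} {n : ℕ} (N : ℕ) (e : ι ≃ Fin n) (m : MultilinearMap ℝ (fun _ : ι => T) H) :
    grass n (alternate N e m).toMultilinearMap =
      ((n.factorial : ℝ) * (N : ℝ)⁻¹) • grass n (m.domDomCongr e) := by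
  have h : (alternate N e m).toMultilinearMap = (N : ℝ)⁻¹ •
      ∑ σ : Equiv.Perm (Fin n), (Equiv.Perm.sign σ : ℤ) • (m.domDomCongr e).domDomCongr σ := by
    ext v
    simp [alternate, ContinuousMultilinearMap.alternatization_apply_apply, Units.smul_def,
      Function.comp_def]
    rfl
  rw [h, map_smul, map_sum]
  simp only [map_zsmul, grass_perm, smul_smul]
  simp only [← Units.val_mul, Int.units_mul_self, Units.val_one, one_smul, Finset.sum_const,
    Finset.card_univ, Fintype.card_perm, Fintype.card_fin]
  rw [← Nat.cast_smul_eq_nsmul ℝ, smul_smul, mul_comm]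

/-- The product of two ordered monomials is the monomial of the concatenated index families. -/
theorem grass_tensorMul (μ : F →ₗ[ℝ] G →ₗ[ℝ] H) {ι₁ ι₂ : Type*} {p q : ℕ}
    (e₁ : ι₁ ≃ Fin p) (e₂ : ι₂ ≃ Fin q)
    (a : MultilinearMap ℝ (fun _ : ι₁ => T) F) (b : MultilinearMap ℝ (fun _ : ι₂ => T) G) :
    grass (p + q) ((tensorMul μ a b).domDomCongr ((e₁.sumCongr e₂).trans finSumFinEquiv)) =
      ext₂ _ μ (grass p (a.domDomCongr e₁)) (grass q (b.domDomCongr e₂)) := by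
  simp only [grass_apply, map_sum, LinearMap.sum_apply, ext₂_tmul,
    ExteriorAlgebra.ιMulti_mul_ιMulti]
  rw [Finset.sum_comm, ← Fintype.sum_prod_type']
  refine Fintype.sum_equiv (Fin.appendEquiv p q).symm _ _ fun s => ?_
  obtain ⟨⟨s₁, s₂⟩, rfl⟩ := (Fin.appendEquiv p q).surjective s
  simp only [Equiv.symm_apply_apply]
  congr 1
  · congr 1
    funext i
    refine Fin.addCases (fun i => ?_) (fun i => ?_) i <;> simp [Fin.appendEquiv]
  · simp [tensorMul, Fin.appendEquiv, MultilinearMap.domCoprod, MultilinearMap.domCoprodDep]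

end Hat

/-! ### The embedding of forms and its compatibility with wedge products and contraction -/

section Hat

/-- The factors are a function on `ℕ`, so that the recursion on `r` can rewrite the length `∑ i, d
i` without transporting a function between `Fin` types. -/
theorem prod_ofFn_sigma {A : Type*} [Monoid A] {r : ℕ} (d : Fin r → ℕ) (g : ℕ → A) :
    (List.ofFn fun i : Fin (∑ i, d i) => g i).prod =
      (List.ofFn fun i => (List.ofFn fun j : Fin (d i) =>
        g (finSigmaFinEquiv (⟨i, j⟩ : (i : Fin r) × Fin (d i)))).prod).prod := by
  induction r with
  | zero =>
    have key : ∀ n, n = 0 → (List.ofFn fun i : Fin n => g i).prod = 1 := by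
      rintro n rfl
      simp
    simpa using key _ (Fin.sum_univ_zero d)
  | succ r ih =>
    have key : ∀ n, n = ∑ i : Fin r, d i.castSucc + d (Fin.last r) →
        (List.ofFn fun i : Fin n => g i).prod =
          (List.ofFn fun i : Fin (∑ i : Fin r, d i.castSucc) => g i).prod *
          (List.ofFn fun j : Fin (d (Fin.last r)) =>
            g (∑ i : Fin r, d i.castSucc + j)).prod := by
      rintro n rfl
      rw [List.ofFn_add, List.prod_append]
      simp
    rw [key _ (Fin.sum_univ_castSucc d), ih fun i => d i.castSucc, List.ofFn_succ',
      List.concat_eq_append, List.prod_append]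
    simp only [finSigmaFinEquiv_apply, List.prod_singleton]
    rfl

variable {T : Type*} [NormedAddCommGroup T] [NormedSpace ℝ T] [FiniteDimensional ℝ T]
  {F G H K : Type*} [AddCommGroup F] [Module ℝ F] [AddCommGroup G] [Module ℝ G]
  [AddCommGroup H] [Module ℝ H] [AddCommGroup K] [Module ℝ K]

theorem grass_compMultilinearMap [FiniteDimensional ℝ F] {r : ℕ} (d : Fin r → ℕ)
    (P : MultilinearMap ℝ (fun _ : Fin r => F) K)
    (ψ : ∀ i, MultilinearMap ℝ (fun _ : Fin (d i) => T) F) :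
    grass (∑ i, d i) ((P.compMultilinearMap ψ).domDomCongr finSigmaFinEquiv) =
      extM _ P fun i => grass (d i) (ψ i) := by
  rw [grass_eq_list]
  simp only [grass_eq_list, MultilinearMap.map_sum, extM_tmul]
  refine Fintype.sum_equiv ((finSigmaFinEquiv.arrowCongr (Equiv.refl _)).symm.trans
    (Equiv.piCurry fun _ _ => Fin (Module.finrank ℝ T))) _ _ fun s => ?_
  congr 1
  have h := prod_ofFn_sigma d fun n => if h : n < ∑ i, d i then gen T (s ⟨n, h⟩) else 1
  simp only [Fin.is_lt, dite_true, Fin.eta] at h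
  exact h

variable [TopologicalSpace F] [TopologicalSpace G]
  [TopologicalSpace H] [IsTopologicalAddGroup H] [ContinuousSMul ℝ H]

/-- The element `∑ (1 / n!) e^{s₁} ⋯ e^{sₙ} ⊗ ψ(b_{s₁}, …, b_{sₙ})` corresponding to a form `ψ`. -/
def hat {n : ℕ} (ψ : T [⋀^Fin n]→L[ℝ] F) : ExtDual T ⊗[ℝ] F :=
  (n.factorial : ℝ)⁻¹ • grass n ψ.toMultilinearMap

/-- The factor `(p + q)!` produced by antisymmetrization cancels the normalization of `hat` in
degree `p + q`; the factor `1 / (p! q!)` of the wedge product becomes the normalizations of the two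
arguments. -/
theorem hat_wedge₂ (μ : F →ₗ[ℝ] G →ₗ[ℝ] H) {p q : ℕ}
    (ψ : T [⋀^Fin p]→L[ℝ] F) (θ : T [⋀^Fin q]→L[ℝ] G) :
    hat (wedge₂ μ ψ θ) = ext₂ _ μ (hat ψ) (hat θ) := by
  have h := grass_tensorMul μ (Equiv.refl (Fin p)) (Equiv.refl (Fin q)) ψ.toMultilinearMap
    θ.toMultilinearMap
  rw [Equiv.sumCongr_refl, Equiv.refl_trans] at h
  rw [hat, wedge₂, grass_alternate, h]
  simp only [hat, map_smul, LinearMap.smul_apply, smul_smul]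
  congr 1
  have := Nat.factorial_ne_zero (p + q)
  field_simp
  push_cast
  field_simp

theorem hat_wedge₃ (μ : F →ₗ[ℝ] F →ₗ[ℝ] F →ₗ[ℝ] H) {p q s : ℕ} (ψ₁ : T [⋀^Fin p]→L[ℝ] F)
    (ψ₂ : T [⋀^Fin q]→L[ℝ] F) (ψ₃ : T [⋀^Fin s]→L[ℝ] F) :
    hat (wedge₃ μ ψ₁ ψ₂ ψ₃) =
      ext₂ _ LinearMap.id (ext₂ _ μ (hat ψ₁) (hat ψ₂)) (hat ψ₃) := by
  have h := grass_tensorMul LinearMap.id finSumFinEquiv (Equiv.refl (Fin s))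
    (tensorMul μ ψ₁.toMultilinearMap ψ₂.toMultilinearMap) ψ₃.toMultilinearMap
  have h' := grass_tensorMul μ (Equiv.refl (Fin p)) (Equiv.refl (Fin q)) ψ₁.toMultilinearMap
    ψ₂.toMultilinearMap
  rw [Equiv.sumCongr_refl, Equiv.refl_trans] at h'
  rw [hat, wedge₃, grass_alternate, h, h', hat, hat, hat]
  simp only [map_smul, LinearMap.smul_apply, smul_smul]
  congr 1
  have := Nat.factorial_ne_zero (p + q + s)
  field_simp
  push_cast
  field_simp

theorem hat_wedgePair [FiniteDimensional ℝ F] {r : ℕ}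
    (P : MultilinearMap ℝ (fun _ : Fin r => F) (G →ₗ[ℝ] ℝ))
    (ψ : Fin r → Σ d : ℕ, T [⋀^Fin d]→L[ℝ] F) {q : ℕ} (θ : T [⋀^Fin q]→L[ℝ] G)
    {n : ℕ} (h : ∑ i, (ψ i).1 + q = n) :
    hat (wedgePair P ψ θ h) =
      ext₂ _ LinearMap.id (extM _ P fun i => hat (ψ i).2) (hat θ) := by
  subst h
  have h := grass_tensorMul LinearMap.id finSigmaFinEquiv (Equiv.refl (Fin q))
    (P.compMultilinearMap fun i => (ψ i).2.toMultilinearMap) θ.toMultilinearMap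
  have h' := grass_compMultilinearMap (fun i => (ψ i).1) P fun i => (ψ i).2.toMultilinearMap
  have h3 := (extM (ExtDual T) P).map_smul_univ (fun i => (((ψ i).1.factorial : ℝ))⁻¹)
    fun i => grass _ (ψ i).2.toMultilinearMap
  simp only [hat]
  rw [h3, ← h', wedgePair, grass_alternate, finCongr_refl, Equiv.trans_refl, h]
  simp only [map_smul, LinearMap.smul_apply, smul_smul]
  congr 1
  · have := Nat.factorial_ne_zero (∑ i, (ψ i).1 + q)
    have h4 : (((∏ i, (ψ i).1.factorial : ℕ)) : ℝ) ≠ 0 := by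
      exact_mod_cast Finset.prod_ne_zero_iff.2 fun i _ => Nat.factorial_ne_zero _
    rw [Finset.prod_inv_distrib, ← Nat.cast_prod]
    push_cast at h4 ⊢
    field_simp

/-- Contraction of an exterior-algebra valued vector with a tangent vector. -/
def contr (v : T) : ExtDual T ⊗[ℝ] F →ₗ[ℝ] ExtDual T ⊗[ℝ] F :=
  (CliffordAlgebra.contractLeft (Module.Dual.eval ℝ T v)).rTensor F

omit [TopologicalSpace F] in
theorem grass_succ {n : ℕ} (m : MultilinearMap ℝ (fun _ : Fin (n + 1) => T) F) :
    grass (n + 1) m = ∑ j, gen T j • grass n (m.curryLeft (Module.finBasis ℝ T j)) := by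
  simp only [grass_eq_list, Finset.smul_sum]
  rw [← Fintype.sum_prod_type']
  refine Fintype.sum_equiv (Fin.consEquiv _).symm _ _ fun s => ?_
  obtain ⟨⟨j, s⟩, rfl⟩ := (Fin.consEquiv fun _ => Fin (Module.finrank ℝ T)).surjective s
  simp only [Equiv.symm_apply_apply, List.ofFn_succ, List.prod_cons, TensorProduct.smul_tmul',
    smul_eq_mul, MultilinearMap.curryLeft_apply]
  congr 2
  funext i
  refine Fin.cases ?_ (fun i => ?_) i <;> simp [Fin.consEquiv]

omit [TopologicalSpace F] in
theorem contr_gen_smul (v : T) (j : Fin (Module.finrank ℝ T)) (x : ExtDual T ⊗[ℝ] F) :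
    contr v (gen T j • x) =
      (Module.finBasis ℝ T).coord j v • x - gen T j • contr v x := by
  induction x with
  | zero => simp
  | add x y hx hy => simp only [smul_add, map_add, hx, hy]; abel
  | tmul a x =>
    simp only [contr, TensorProduct.smul_tmul', LinearMap.rTensor_tmul, smul_eq_mul]
    erw [CliffordAlgebra.contractLeft_ι_mul]
    rw [TensorProduct.sub_tmul]
    rfl

omit [TopologicalSpace F] in
-- Peel off the first generator and use that contraction is an antiderivation.
theorem contr_grass_eq_sub {n : ℕ} (v : T) (ψ : T [⋀^Fin (n + 1)]→ₗ[ℝ] F) :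
    contr v (grass (n + 1) ψ.toMultilinearMap) = grass n (ψ.curryLeft v).toMultilinearMap -
      ∑ j, gen T j • contr v (grass n (ψ.curryLeft (Module.finBasis ℝ T j)).toMultilinearMap) := by
  rw [grass_succ, map_sum]
  simp only [contr_gen_smul, Finset.sum_sub_distrib]
  congr 1
  have h2 : (ψ.curryLeft (∑ i, (Module.finBasis ℝ T).repr v i • Module.finBasis ℝ T i)
      ).toMultilinearMap = ∑ i, (Module.finBasis ℝ T).repr v i •
        (ψ.curryLeft (Module.finBasis ℝ T i)).toMultilinearMap := by
    ext u
    have h := map_sum ψ.toMultilinearMap.curryLeft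
      (fun i => (Module.finBasis ℝ T).repr v i • Module.finBasis ℝ T i) Finset.univ
    have h' := congrArg (fun m => m u) h
    simpa using h'
  conv_rhs => rw [← (Module.finBasis ℝ T).sum_repr v, h2, map_sum]
  simp only [map_smul]
  rfl

omit [TopologicalSpace F] in
-- All `n + 1` positions of the contracted generator contribute equally: the sign of the
-- antiderivation is undone by the sign of exchanging two arguments of an alternating map.
theorem contr_grass {n : ℕ} (v : T) (ψ : T [⋀^Fin (n + 1)]→ₗ[ℝ] F) :
    contr v (grass (n + 1) ψ.toMultilinearMap) =
      ((n : ℝ) + 1) • grass n (ψ.curryLeft v).toMultilinearMap := by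
  induction n generalizing v with
  | zero =>
    have h2 : ∀ m : MultilinearMap ℝ (fun _ : Fin 0 => T) F, contr v (grass 0 m) = 0 := fun m => by
      simp only [grass_eq_list, map_sum, contr, LinearMap.rTensor_tmul, List.ofFn_zero,
        List.prod_nil]
      erw [CliffordAlgebra.contractLeft_one]
      simp
    rw [contr_grass_eq_sub]
    simp [h2]
  | succ n ih =>
    have h2 : ∀ w, contr v (grass (n + 1) (ψ.curryLeft w).toMultilinearMap) =
        -(((n : ℝ) + 1) • grass n ((ψ.curryLeft v).curryLeft w).toMultilinearMap) := fun w => by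
      suffices h : ((ψ.curryLeft w).curryLeft v).toMultilinearMap =
          -((ψ.curryLeft v).curryLeft w).toMultilinearMap by
        rw [ih v (ψ.curryLeft w), h, map_neg]
        exact smul_neg _ _
      ext u
      have := ψ.map_swap (Matrix.vecCons w (Matrix.vecCons v u)) (i := 0) (j := 1) (by simp)
      simp only [AlternatingMap.coe_multilinearMap, AlternatingMap.curryLeft_apply_apply,
        neg_apply]
      rw [← neg_eq_iff_eq_neg, ← this]
      congr 1
      funext i
      refine Fin.cases ?_ (fun i => Fin.cases ?_ (fun i => ?_) i) i
      · simp
      · simp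
      · rw [Function.comp_apply, Equiv.swap_apply_of_ne_of_ne (Fin.succ_ne_zero _)
          (by simp [Fin.ext_iff])]
        rfl
    have h3 : ∑ j, gen T j • grass n ((ψ.curryLeft v).curryLeft
        (Module.finBasis ℝ T j)).toMultilinearMap =
        grass (n + 1) (ψ.curryLeft v).toMultilinearMap := (grass_succ _).symm
    rw [contr_grass_eq_sub]
    simp only [h2, smul_neg, Finset.sum_neg_distrib, sub_neg_eq_add]
    simp only [smul_comm (gen T _) ((n : ℝ) + 1), ← Finset.smul_sum]
    rw [h3]
    push_cast
    module

/-- The value of an exterior-algebra valued vector on `n` tangent vectors. -/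
def evalExt : (n : ℕ) → (ℕ → T) → ExtDual T ⊗[ℝ] F →ₗ[ℝ] F
  | 0, _ => (TensorProduct.lid ℝ F).toLinearMap ∘ₗ
      (ExteriorAlgebra.algebraMapInv (R := ℝ) (M := Module.Dual ℝ T)).toLinearMap.rTensor F
  | n + 1, f => evalExt n (fun i => f (i + 1)) ∘ₗ contr (f 0)

/-- The factor `n + 1` of `contr_grass` turns `1 / (n + 1)!` into `1 / n!`. The interior product is
given by its values, so no continuous version of it has to be built. -/
theorem contr_hat {n : ℕ} (v : T) (ψ : T [⋀^Fin (n + 1)]→L[ℝ] F) (θ : T [⋀^Fin n]→L[ℝ] F)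
    (h : ∀ u, θ u = ψ (Matrix.vecCons v u)) : contr v (hat ψ) = hat θ := by
  have h1 := contr_grass v ψ.toAlternatingMap
  have h2 : (ψ.toAlternatingMap.curryLeft v).toMultilinearMap = θ.toMultilinearMap := by
    ext u
    exact (h u).symm
  rw [hat, hat, map_smul, ← h2]
  erw [h1]
  rw [smul_smul, Nat.factorial_succ]
  congr 1
  have := Nat.factorial_ne_zero n
  push_cast
  field_simp

theorem evalExt_hat {n : ℕ} (f : ℕ → T) (ψ : T [⋀^Fin n]→L[ℝ] F) :
    evalExt n f (hat ψ) = ψ fun i => f i := by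
  have key : ∀ (n : ℕ) (f : ℕ → T) (ψ : T [⋀^Fin n]→ₗ[ℝ] F),
      evalExt n f (grass n ψ.toMultilinearMap) = (n.factorial : ℝ) • ψ fun i => f i := by
    intro n
    induction n with
    | zero =>
      intro f ψ
      rw [grass_eq_list]
      simp only [List.ofFn_zero, List.prod_nil, evalExt]
      simp
      congr 1
      exact Subsingleton.elim _ _
    | succ n ih =>
      intro f ψ
      rw [evalExt, LinearMap.comp_apply, contr_grass, map_smul, ih, smul_smul,
        Nat.factorial_succ]
      push_cast
      congr 1
      simp only [AlternatingMap.curryLeft_apply_apply]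
      congr 1
      funext i
      refine Fin.cases ?_ (fun i => ?_) i <;> simp
  have h := key n f ψ.toAlternatingMap
  rw [hat, map_smul]
  erw [h]
  rw [smul_smul, inv_mul_cancel₀ (by exact_mod_cast Nat.factorial_ne_zero n), one_smul]
  rfl

/-- Iterated contraction recovers the values of a form. Hence identities of forms may be checked in
the exterior algebra, where products are associative. -/
theorem hat_injective {n : ℕ} {ψ θ : T [⋀^Fin n]→L[ℝ] F} (h : hat ψ = hat θ) : ψ = θ := by
  ext v
  have h1 := evalExt_hat (fun i => if h : i < n then v ⟨i, h⟩ else 0) ψ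
  have h2 := evalExt_hat (fun i => if h : i < n then v ⟨i, h⟩ else 0) θ
  rw [h, h2] at h1
  simpa using h1.symm

end Hat

/-! ### Reordering of indices in antisymmetrized sums -/

section AntiSum

variable {T : Type*} [NormedAddCommGroup T] [NormedSpace ℝ T] [FiniteDimensional ℝ T]
  {F G H K : Type*} [AddCommGroup F] [Module ℝ F] [AddCommGroup G] [Module ℝ G]
  [AddCommGroup H] [Module ℝ H] [AddCommGroup K] [Module ℝ K]

/-- The sum `∑ e^{s₁} ⋯ e^{sₙ} ⊗ m(s₁, …, sₙ)` attached to a family `m` of vectors. -/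
def antiSum (n : ℕ) (m : (Fin n → Fin (Module.finrank ℝ T)) → H) : ExtDual T ⊗[ℝ] H :=
  ∑ s, (ExteriorAlgebra.ιMulti ℝ n fun i => (Module.finBasis ℝ T).coord (s i)) ⊗ₜ[ℝ] m s

theorem antiSum_comp_perm {n : ℕ} (σ : Equiv.Perm (Fin n))
    (m : (Fin n → Fin (Module.finrank ℝ T)) → H) :
    antiSum n (fun s => m (s ∘ σ)) = (Equiv.Perm.sign σ : ℤ) • antiSum n m := by
  rw [antiSum, antiSum, Finset.smul_sum]
  refine Fintype.sum_equiv (σ.arrowCongr (Equiv.refl _)).symm _ _ fun s => ?_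
  have h := (ExteriorAlgebra.ιMulti ℝ n).map_perm
    (fun i => (Module.finBasis ℝ T).coord (s i)) σ
  have h2 : (ExteriorAlgebra.ιMulti ℝ n fun i => (Module.finBasis ℝ T).coord
      ((σ.arrowCongr (Equiv.refl _)).symm s i)) = (ExteriorAlgebra.ιMulti ℝ n)
      ((fun i => (Module.finBasis ℝ T).coord (s i)) ∘ σ) := rfl
  have h3 : (m ((σ.arrowCongr (Equiv.refl _)).symm s)) = m (s ∘ σ) := rfl
  rw [h2, h, h3]
  obtain h4 | h4 := Int.units_eq_one_or (Equiv.Perm.sign σ) <;>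
    simp [h4, TensorProduct.neg_tmul]

theorem antiSum_eq_of_perm {n : ℕ} (σ : Equiv.Perm (Fin n))
    (m : (Fin n → Fin (Module.finrank ℝ T)) → H) (h : Equiv.Perm.sign σ = 1) :
    antiSum n (fun s => m (s ∘ σ)) = antiSum n m := by
  rw [antiSum_comp_perm, h]
  simp

theorem antiSum_eq_neg_of_perm {n : ℕ} (σ : Equiv.Perm (Fin n))
    (m : (Fin n → Fin (Module.finrank ℝ T)) → H) (h : Equiv.Perm.sign σ = -1) :
    antiSum n (fun s => m (s ∘ σ)) = -antiSum n m := by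
  rw [antiSum_comp_perm, h]
  simp

theorem antiSum_add {n : ℕ} (m m' : (Fin n → Fin (Module.finrank ℝ T)) → H) :
    antiSum n (fun s => m s + m' s) = antiSum n m + antiSum n m' := by
  simp [antiSum, TensorProduct.tmul_add, Finset.sum_add_distrib]

theorem antiSum_neg {n : ℕ} (m : (Fin n → Fin (Module.finrank ℝ T)) → H) :
    antiSum n (fun s => -m s) = -antiSum n m := by
  simp [antiSum, TensorProduct.tmul_neg]

theorem antiSum_sub {n : ℕ} (m m' : (Fin n → Fin (Module.finrank ℝ T)) → H) :
    antiSum n (fun s => m s - m' s) = antiSum n m - antiSum n m' := by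
  simp [antiSum, TensorProduct.tmul_sub]

theorem antiSum_zero {n : ℕ} :
    antiSum n (fun _ : Fin n → Fin (Module.finrank ℝ T) => (0 : H)) = 0 := by
  simp [antiSum]

/-- Iterating this flattens any nested bracket of forms into one antisymmetrized sum, so that an
identity of brackets can be applied summand by summand after permuting indices. -/
theorem ext₂_antiSum (μ : F →ₗ[ℝ] G →ₗ[ℝ] H) {p q : ℕ}
    (a : (Fin p → Fin (Module.finrank ℝ T)) → F) (b : (Fin q → Fin (Module.finrank ℝ T)) → G) :
    ext₂ _ μ (antiSum p a) (antiSum q b) =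
      antiSum (p + q) fun s => μ (a fun i => s (Fin.castAdd q i)) (b fun i => s (Fin.natAdd p i)) := by
  simp only [antiSum, map_sum, LinearMap.sum_apply, ext₂_tmul,
    ExteriorAlgebra.ιMulti_mul_ιMulti]
  rw [Finset.sum_comm, ← Fintype.sum_prod_type']
  refine (Fintype.sum_equiv (Fin.appendEquiv p q).symm _ _ fun s => ?_).symm
  obtain ⟨⟨s₁, s₂⟩, rfl⟩ := (Fin.appendEquiv p q).surjective s
  simp only [Equiv.symm_apply_apply]
  congr 1
  · congr 1
    funext i
    refine Fin.addCases (fun i => ?_) (fun i => ?_) i <;> simp [Fin.appendEquiv]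
  · simp [Fin.appendEquiv]

theorem lTensor_antiSum (α : F →ₗ[ℝ] G) {p : ℕ}
    (a : (Fin p → Fin (Module.finrank ℝ T)) → F) :
    α.lTensor _ (antiSum p a) = antiSum p fun s => α (a s) := by
  simp [antiSum]

theorem smul_antiSum (c : ℝ) {p : ℕ} (a : (Fin p → Fin (Module.finrank ℝ T)) → F) :
    c • antiSum p a = antiSum p fun s => c • a s := by
  simp [antiSum, Finset.smul_sum]

theorem hat_eq_antiSum [TopologicalSpace F] {n : ℕ} (ψ : T [⋀^Fin n]→L[ℝ] F) :
    hat ψ = antiSum n fun s => (n.factorial : ℝ)⁻¹ • ψ fun i => Module.finBasis ℝ T (s i) := by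
  rw [hat, grass_apply, ← smul_antiSum]
  rfl

end AntiSum

/-! ### The axioms of the 2-term L∞ algebra evaluated on forms -/

section BianchiAlgebra

variable {T : Type*} [NormedAddCommGroup T] [NormedSpace ℝ T] [FiniteDimensional ℝ T]
  {V₀ V₁ : Type*} [AddCommGroup V₀] [Module ℝ V₀] [AddCommGroup V₁] [Module ℝ V₁]

/-- The extension of the bracket. -/
abbrev eBr (L : TwoTermLInfty V₀ V₁) (a b : ExtDual T ⊗[ℝ] V₀) : ExtDual T ⊗[ℝ] V₀ :=
  ext₂ _ L.br a b

/-- The extension of the action. -/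
abbrev eAct (L : TwoTermLInfty V₀ V₁) (a : ExtDual T ⊗[ℝ] V₀) (b : ExtDual T ⊗[ℝ] V₁) :
    ExtDual T ⊗[ℝ] V₁ :=
  ext₂ _ L.act a b

/-- The extension of the trilinear bracket. -/
abbrev eJac (L : TwoTermLInfty V₀ V₁) (a b c : ExtDual T ⊗[ℝ] V₀) : ExtDual T ⊗[ℝ] V₁ :=
  ext₂ _ LinearMap.id (ext₂ _ L.jac a b) c

/-- The extension of the differential. -/
abbrev eα (L : TwoTermLInfty V₀ V₁) (b : ExtDual T ⊗[ℝ] V₁) : ExtDual T ⊗[ℝ] V₀ :=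
  L.α.lTensor _ b

namespace TwoTermLInfty

variable (L : TwoTermLInfty V₀ V₁)

theorem br_swap (x y : V₀) : L.br x y = -L.br y x := by
  have h := L.br_self (x + y)
  simp only [map_add, LinearMap.add_apply, L.br_self, zero_add, add_zero] at h
  exact eq_neg_of_add_eq_zero_left ((add_comm _ _).trans h)

theorem jac_swap_left (x y z : V₀) : L.jac x y z = -L.jac y x z := by
  have h := L.jac_self_left (x + y) z
  simp only [map_add, LinearMap.add_apply, L.jac_self_left, zero_add, add_zero] at h
  exact eq_neg_of_add_eq_zero_left ((add_comm _ _).trans h)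

theorem jac_swap_right (x y z : V₀) : L.jac x y z = -L.jac x z y := by
  have h := L.jac_self_right x (y + z)
  simp only [map_add, LinearMap.add_apply, L.jac_self_right, zero_add, add_zero] at h
  exact eq_neg_of_add_eq_zero_left ((add_comm _ _).trans h)

theorem jac_cycle (x y z : V₀) : L.jac z x y = L.jac x y z := by
  rw [L.jac_swap_left, L.jac_swap_right x z y, neg_neg]

end TwoTermLInfty

variable (L : TwoTermLInfty V₀ V₁) (a : Fin (Module.finrank ℝ T) → V₀)
  (c : Fin (Module.finrank ℝ T) → Fin (Module.finrank ℝ T) → V₀)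
  (b : Fin (Module.finrank ℝ T) → Fin (Module.finrank ℝ T) → V₁)

local notation "𝐚" => antiSum (T := T) 1 fun s => a (s 0)
local notation "𝐜" => antiSum (T := T) 2 fun s => c (s 0) (s 1)
local notation "𝐛" => antiSum (T := T) 2 fun s => b (s 0) (s 1)

/-- Moving a one-form past a two-form is a cyclic permutation of three indices, which is even; the
sign is that of the bracket alone. -/
theorem eBr_two_one : eBr L 𝐜 𝐚 = -eBr L 𝐚 𝐜 := by
  have h1 : eBr L 𝐜 𝐚 = antiSum 3 fun s => L.br (c (s 0) (s 1)) (a (s 2)) := ext₂_antiSum _ _ _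
  have h2 : eBr L 𝐚 𝐜 = antiSum 3 fun s => L.br (a (s 0)) (c (s 1) (s 2)) := ext₂_antiSum _ _ _
  rw [h1, h2, ← antiSum_neg, ← antiSum_eq_of_perm (finRotate 3) _ (by decide)]
  exact congrArg _ (funext fun s => L.br_swap _ _)

omit [FiniteDimensional ℝ T] in
theorem eα_eAct (x : ExtDual T ⊗[ℝ] V₀) (y : ExtDual T ⊗[ℝ] V₁) :
    eα L (eAct L x y) = eBr L x (eα L y) := by
  induction x with
  | zero => simp [eα, eAct, eBr]
  | add x x' hx hx' => simp only [eα, eAct, eBr, map_add, LinearMap.add_apply] at *; rw [hx, hx']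
  | tmul p x =>
    induction y with
    | zero => simp [eα, eAct, eBr]
    | add y y' hy hy' => simp only [eα, eAct, eBr, map_add] at *; rw [hy, hy']
    | tmul q y => simp [eα, eAct, eBr, sub_eq_zero.1 (L.α_act x y)]

/-- The three terms of the Jacobi identity differ by cyclic permutations of three indices, which are
even, so they all contribute the same. -/
theorem eBr_eBr : (3 : ℝ) • eBr L 𝐚 (eBr L 𝐚 𝐚) = eα L (eJac L 𝐚 𝐚 𝐚) := by
  have h1 : eBr L 𝐚 (eBr L 𝐚 𝐚) = antiSum 3 fun s => L.br (a (s 0)) (L.br (a (s 1)) (a (s 2))) := by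
    simp only [eBr, ext₂_antiSum]; rfl
  have h2 : eα L (eJac L 𝐚 𝐚 𝐚) = antiSum 3 fun s => L.α (L.jac (a (s 0)) (a (s 1)) (a (s 2))) := by
    simp only [eα, eJac, ext₂_antiSum, lTensor_antiSum]; rfl
  have h3 := antiSum_eq_of_perm (T := T) (finRotate 3) (fun s => L.br (a (s 0))
    (L.br (a (s 1)) (a (s 2)))) (by decide)
  have h4 := antiSum_eq_of_perm (T := T) (finRotate 3 * finRotate 3) (fun s => L.br (a (s 0))
    (L.br (a (s 1)) (a (s 2)))) (by decide)
  rw [h1, h2, show (3 : ℝ) = 1 + 1 + 1 by norm_num, add_smul, add_smul, one_smul]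
  nth_rewrite 2 [← h3]
  nth_rewrite 2 [← h4]
  rw [← antiSum_add, ← antiSum_add]
  exact congrArg _ (funext fun s => sub_eq_zero.1 (L.jacobi₀ _ _ _))

/-- Exchanging the two two-forms is an even permutation, so the antisymmetry `act_α` makes the
element equal to its own negative. -/
theorem eAct_eα : eAct L (eα L 𝐛) 𝐛 = 0 := by
  have h1 : eAct L (eα L 𝐛) 𝐛 = antiSum 4 fun s => L.act (L.α (b (s 0) (s 1))) (b (s 2) (s 3)) := by
    simp only [eα, eAct, ext₂_antiSum, lTensor_antiSum]; rfl
  have h2 := antiSum_eq_of_perm (T := T) (finRotate 4 * finRotate 4)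
    (fun s => L.act (L.α (b (s 0) (s 1))) (b (s 2) (s 3))) (by decide)
  have h3 : antiSum (T := T) 4 (fun s => L.act (L.α (b (s 0) (s 1))) (b (s 2) (s 3))) =
      -antiSum 4 fun s => L.act (L.α (b (s 0) (s 1))) (b (s 2) (s 3)) := by
    nth_rewrite 1 [← h2]
    rw [← antiSum_neg]
    exact congrArg _ (funext fun s => eq_neg_of_add_eq_zero_left (L.act_α _ _))
  rw [h1]
  have h4 : (2 : ℝ) • antiSum (T := T) 4
      (fun s => L.act (L.α (b (s 0) (s 1))) (b (s 2) (s 3))) = 0 := by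
    rw [two_smul]
    nth_rewrite 1 [h3]
    exact neg_add_cancel _
  exact (smul_eq_zero.1 h4).resolve_left two_ne_zero

/-- Antisymmetrization in the two one-forms turns the commutator of two actions into twice the
iterated action. -/
theorem eAct_eAct : (2 : ℝ) • eAct L 𝐚 (eAct L 𝐚 𝐛) =
    eAct L (eBr L 𝐚 𝐚) 𝐛 + eJac L 𝐚 𝐚 (eα L 𝐛) := by
  have h1 : eAct L 𝐚 (eAct L 𝐚 𝐛) =
      antiSum 4 fun s => L.act (a (s 0)) (L.act (a (s 1)) (b (s 2) (s 3))) := by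
    simp only [eAct, ext₂_antiSum]; rfl
  have h2 : eAct L (eBr L 𝐚 𝐚) 𝐛 =
      antiSum 4 fun s => L.act (L.br (a (s 0)) (a (s 1))) (b (s 2) (s 3)) := by
    simp only [eAct, eBr, ext₂_antiSum]; rfl
  have h3 : eJac L 𝐚 𝐚 (eα L 𝐛) =
      antiSum 4 fun s => L.jac (a (s 0)) (a (s 1)) (L.α (b (s 2) (s 3))) := by
    simp only [eα, eJac, ext₂_antiSum, lTensor_antiSum]; rfl
  have h4 := antiSum_eq_neg_of_perm (T := T) (Equiv.swap (0 : Fin 4) 1)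
    (fun s => L.act (a (s 0)) (L.act (a (s 1)) (b (s 2) (s 3)))) (by decide)
  rw [h1, h2, h3, show (2 : ℝ) = 1 + 1 by norm_num, add_smul, one_smul]
  nth_rewrite 2 [← neg_neg (antiSum 4 fun s => L.act (a (s 0)) (L.act (a (s 1)) (b (s 2) (s 3))))]
  rw [← h4, ← sub_eq_add_neg, ← antiSum_sub, ← antiSum_add]
  refine congrArg _ (funext fun s => ?_)
  have h := L.jacobi₁ (a (s 0)) (a (s 1)) (b (s 2) (s 3))
  rw [sub_eq_zero, sub_eq_iff_eq_add] at h
  exact h.trans (add_comm _ _)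

theorem eJac_two_one_one : eJac L 𝐜 𝐚 𝐚 = eJac L 𝐚 𝐚 𝐜 := by
  have h1 : eJac L 𝐜 𝐚 𝐚 = antiSum 4 fun s => L.jac (c (s 0) (s 1)) (a (s 2)) (a (s 3)) := by
    simp only [eJac, ext₂_antiSum]; rfl
  have h2 : eJac L 𝐚 𝐚 𝐜 = antiSum 4 fun s => L.jac (a (s 0)) (a (s 1)) (c (s 2) (s 3)) := by
    simp only [eJac, ext₂_antiSum]; rfl
  rw [h1, h2, ← antiSum_eq_of_perm (finRotate 4 * finRotate 4) _ (by decide)]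
  refine congrArg _ (funext fun s => ?_)
  exact L.jac_cycle _ _ _

/-- The two-form moves past a one-form without a sign from the coefficients, so only the sign of the
alternating bracket remains. -/
theorem eJac_one_two_one : eJac L 𝐚 𝐜 𝐚 = -eJac L 𝐚 𝐚 𝐜 := by
  have h1 : eJac L 𝐚 𝐜 𝐚 = antiSum 4 fun s => L.jac (a (s 0)) (c (s 1) (s 2)) (a (s 3)) := by
    simp only [eJac, ext₂_antiSum]; rfl
  have h2 : eJac L 𝐚 𝐚 𝐜 = antiSum 4 fun s => L.jac (a (s 0)) (a (s 1)) (c (s 2) (s 3)) := by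
    simp only [eJac, ext₂_antiSum]; rfl
  rw [h1, h2, ← antiSum_neg,
    ← antiSum_eq_of_perm (Equiv.swap 1 2 * Equiv.swap 2 3) _ (by decide)]
  refine congrArg _ (funext fun s => ?_)
  rw [L.jac_swap_right]
  rfl

theorem eJac_eBr : (3 : ℝ) • eJac L 𝐚 𝐚 (eBr L 𝐚 𝐚) = (2 : ℝ) • eAct L 𝐚 (eJac L 𝐚 𝐚 𝐚) := by
  set J : (Fin 4 → Fin (Module.finrank ℝ T)) → V₁ :=
    fun s => L.jac (a (s 0)) (a (s 1)) (L.br (a (s 2)) (a (s 3))) with hJ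
  set K : (Fin 4 → Fin (Module.finrank ℝ T)) → V₁ :=
    fun s => L.act (a (s 0)) (L.jac (a (s 1)) (a (s 2)) (a (s 3))) with hK
  have h1 : eJac L 𝐚 𝐚 (eBr L 𝐚 𝐚) = antiSum 4 J := by
    simp only [eJac, eBr, ext₂_antiSum]; rfl
  have h2 : eAct L 𝐚 (eJac L 𝐚 𝐚 𝐚) = antiSum 4 K := by
    simp only [eJac, eAct, ext₂_antiSum]; rfl
  -- The vectors list the orders in which the arguments occur in `coherence`.
  have h : antiSum (T := T) 4 (fun s : Fin 4 → Fin (Module.finrank ℝ T) =>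
      J s + J (s ∘ (![0, 2, 3, 1] : Fin 4 → Fin 4)) + J (s ∘ (![0, 3, 1, 2] : Fin 4 → Fin 4))
      - J (s ∘ (![1, 2, 3, 0] : Fin 4 → Fin 4)) - J (s ∘ (![2, 3, 1, 0] : Fin 4 → Fin 4))
      - J (s ∘ (![3, 1, 2, 0] : Fin 4 → Fin 4))
      - K s + K (s ∘ (![1, 2, 3, 0] : Fin 4 → Fin 4)) - K (s ∘ (![2, 3, 0, 1] : Fin 4 → Fin 4))
      + K (s ∘ (![3, 0, 1, 2] : Fin 4 → Fin 4))) = 0 := by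
    rw [← antiSum_zero (T := T) (n := 4)]
    exact congrArg _ (funext fun s => L.coherence (a (s 0)) (a (s 1)) (a (s 2)) (a (s 3)))
  have even : ∀ (m : (Fin 4 → Fin (Module.finrank ℝ T)) → V₁) (f : Fin 4 → Fin 4)
      (σ : Equiv.Perm (Fin 4)), (σ : Fin 4 → Fin 4) = f → Equiv.Perm.sign σ = 1 →
      antiSum 4 (fun s => m (s ∘ f)) = antiSum 4 m := by
    rintro m f σ rfl h
    exact antiSum_eq_of_perm σ m h
  have odd : ∀ (m : (Fin 4 → Fin (Module.finrank ℝ T)) → V₁) (f : Fin 4 → Fin 4)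
      (σ : Equiv.Perm (Fin 4)), (σ : Fin 4 → Fin 4) = f → Equiv.Perm.sign σ = -1 →
      antiSum 4 (fun s => m (s ∘ f)) = -antiSum 4 m := by
    rintro m f σ rfl h
    exact antiSum_eq_neg_of_perm σ m h
  rw [antiSum_add, antiSum_sub, antiSum_add, antiSum_sub, antiSum_sub, antiSum_sub, antiSum_sub,
    antiSum_add, antiSum_add,
    even J ![0, 2, 3, 1] (Equiv.swap 1 2 * Equiv.swap 2 3) (by decide) (by decide),
    even J ![0, 3, 1, 2] (Equiv.swap 2 3 * Equiv.swap 1 2) (by decide) (by decide),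
    odd J ![1, 2, 3, 0] (finRotate 4) (by decide) (by decide),
    odd J ![2, 3, 1, 0] (finRotate 4 * Equiv.swap 0 1 * Equiv.swap 1 2) (by decide) (by decide),
    odd J ![3, 1, 2, 0] (Equiv.swap 0 3) (by decide) (by decide),
    odd K ![1, 2, 3, 0] (finRotate 4) (by decide) (by decide),
    even K ![2, 3, 0, 1] (finRotate 4 * finRotate 4) (by decide) (by decide),
    odd K ![3, 0, 1, 2] (finRotate 4 * finRotate 4 * finRotate 4) (by decide) (by decide)] at h
  rw [h1, h2]
  -- With the signs of the permutations, all six terms of type `J` count positively and all four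
  -- terms of type `K` negatively, so `coherence` reads 6J - 4K = 0.
  have h' : (2 : ℝ) • ((3 : ℝ) • antiSum 4 J - (2 : ℝ) • antiSum 4 K) = 0 := by
    rw [← h]
    module
  have := (smul_eq_zero.1 h').resolve_left two_ne_zero
  exact sub_eq_zero.1 this

end BianchiAlgebra

/-! ### Extended multilinear maps with central arguments -/

section Invariance

variable {A : Type*} [Ring A] [Algebra ℝ A]
variable {F G H K : Type*} [AddCommGroup F] [Module ℝ F] [AddCommGroup G] [Module ℝ G]
  [AddCommGroup H] [Module ℝ H] [AddCommGroup K] [Module ℝ K]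

/-- A vector with coefficients in an algebra is central if its coefficients are. -/
def IsCentralVec [FiniteDimensional ℝ F] (f : A ⊗[ℝ] F) : Prop :=
  ∀ i b, Commute (coeff A i f) b

theorem sum_coeff_tmul [FiniteDimensional ℝ F] (f : A ⊗[ℝ] F) :
    ∑ i, coeff A i f ⊗ₜ[ℝ] Module.finBasis ℝ F i = f := by
  induction f with
  | zero => simp
  | add f g hf hg => simp only [map_add, TensorProduct.add_tmul, Finset.sum_add_distrib, hf, hg]
  | tmul a x =>
    simp only [coeff_tmul, TensorProduct.smul_tmul, ← TensorProduct.tmul_sum]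
    simp [(Module.finBasis ℝ F).sum_repr]

theorem coeff_smul [FiniteDimensional ℝ F] (i : Fin (Module.finrank ℝ F)) (a : A)
    (f : A ⊗[ℝ] F) : coeff A i (a • f) = a * coeff A i f := by
  induction f with
  | zero => simp
  | add f g hf hg => simp only [smul_add, map_add, hf, hg, mul_add]
  | tmul b x => simp [TensorProduct.smul_tmul']

omit [Algebra ℝ A] in
-- The one factor that need not be central moves to the front past the central ones.
theorem prod_ofFn_update {r : ℕ} (c : Fin r → A) (hc : ∀ i b, Commute (c i) b) (i : Fin r)
    (g : A) : (List.ofFn (Function.update c i g)).prod =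
      g * (List.ofFn (Function.update c i 1)).prod := by
  induction r with
  | zero => exact i.elim0
  | succ r ih =>
    refine Fin.cases ?_ (fun i => ?_) i
    · simp [List.ofFn_succ, Function.update]
    · have h1 : ∀ g : A, (fun j : Fin r => Function.update c i.succ g j.succ) =
          Function.update (fun j : Fin r => c j.succ) i g := fun g =>
        Function.update_comp_eq_of_injective c (Fin.succ_injective r) i g
      have h2 : ∀ g : A, Function.update c i.succ g 0 = c 0 := fun g =>
        Function.update_of_ne (Fin.succ_ne_zero i).symm _ _
      rw [List.ofFn_succ, List.ofFn_succ, List.prod_cons, List.prod_cons, h1, h1, h2, h2,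
        ih _ fun j b => hc _ b]
      rw [← mul_assoc, (hc 0 g).eq, mul_assoc]

omit [Algebra ℝ A] in
theorem prod_ofFn_update_mul {r : ℕ} (c : Fin r → A) (hc : ∀ i b, Commute (c i) b) (i : Fin r)
    (g : A) : (List.ofFn (Function.update c i (g * c i))).prod = g * (List.ofFn c).prod := by
  rw [prod_ofFn_update c hc, mul_assoc, ← prod_ofFn_update c hc, Function.update_eq_self]

omit [Algebra ℝ A] in
theorem commute_prod_ofFn {r : ℕ} (c : Fin r → A) (hc : ∀ i b, Commute (c i) b) (b : A) :
    Commute (List.ofFn c).prod b := by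
  refine Commute.list_prod_left _ _ fun x hx => ?_
  obtain ⟨i, rfl⟩ := (List.mem_ofFn' _ _).1 hx
  exact hc i b

/-- The extension of a multilinear map with values in the dual of `G`. -/
def extP (A : Type*) [Ring A] [Algebra ℝ A] [FiniteDimensional ℝ F] {r : ℕ}
    (P : MultilinearMap ℝ (fun _ : Fin r => F) (G →ₗ[ℝ] ℝ)) (f : Fin r → A ⊗[ℝ] F) :
    A ⊗[ℝ] G →ₗ[ℝ] A ⊗[ℝ] ℝ :=
  ext₂ A LinearMap.id (extM A P f)

variable [FiniteDimensional ℝ F] {r : ℕ}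

theorem extP_update_add (P : MultilinearMap ℝ (fun _ : Fin r => F) (G →ₗ[ℝ] ℝ))
    (f : Fin r → A ⊗[ℝ] F) (i : Fin r) (x y : A ⊗[ℝ] F) :
    extP A P (Function.update f i (x + y)) =
      extP A P (Function.update f i x) + extP A P (Function.update f i y) := by
  simp [extP]

theorem extP_update_neg (P : MultilinearMap ℝ (fun _ : Fin r => F) (G →ₗ[ℝ] ℝ))
    (f : Fin r → A ⊗[ℝ] F) (i : Fin r) (x : A ⊗[ℝ] F) :
    extP A P (Function.update f i (-x)) = -extP A P (Function.update f i x) := by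
  simp [extP]

theorem extP_update_zero (P : MultilinearMap ℝ (fun _ : Fin r => F) (G →ₗ[ℝ] ℝ))
    (f : Fin r → A ⊗[ℝ] F) (i : Fin r) :
    extP A P (Function.update f i 0) = 0 := by
  rw [extP, (extM A P).map_coord_zero i (by simp), map_zero]

theorem extP_update_sum (P : MultilinearMap ℝ (fun _ : Fin r => F) (G →ₗ[ℝ] ℝ))
    (f : Fin r → A ⊗[ℝ] F) (i : Fin r) {ι : Type*} (s : Finset ι) (x : ι → A ⊗[ℝ] F) :
    extP A P (Function.update f i (∑ j ∈ s, x j)) =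
      ∑ j ∈ s, extP A P (Function.update f i (x j)) := by
  simp [extP, MultilinearMap.map_update_sum]

theorem extP_tmul (P : MultilinearMap ℝ (fun _ : Fin r => F) (G →ₗ[ℝ] ℝ))
    (f : Fin r → A ⊗[ℝ] F) (a : A) (X : G) :
    extP A P f (a ⊗ₜ X) = ∑ s : Fin r → Fin (Module.finrank ℝ F),
      ((List.ofFn fun i => coeff A (s i) (f i)).prod * a) ⊗ₜ[ℝ]
        P (fun i => Module.finBasis ℝ F (s i)) X := by
  simp [extP, extM_apply, LinearMap.sum_apply]

/-- The exceptional slot carries its own coefficients and vectors, so vectors such as `[x, b_j]` can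
be inserted without expanding them in the basis again. -/
theorem extP_update_tmul (P : MultilinearMap ℝ (fun _ : Fin r => F) (G →ₗ[ℝ] ℝ))
    (f : A ⊗[ℝ] F) (i : Fin r) (γ : Fin (Module.finrank ℝ F) → A)
    (y : Fin (Module.finrank ℝ F) → F) (a : A) (X : G) :
    extP A P (Function.update (fun _ => f) i (∑ j, γ j ⊗ₜ y j)) (a ⊗ₜ X) =
      ∑ s : Fin r → Fin (Module.finrank ℝ F),
        ((List.ofFn (Function.update (fun l => coeff A (s l) f) i (γ (s i)))).prod * a) ⊗ₜ[ℝ]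
          P (Function.update (fun l => Module.finBasis ℝ F (s l)) i (y (s i))) X := by
  have h : Function.update (fun _ => f) i (∑ j, γ j ⊗ₜ y j) = fun l : Fin r =>
      ∑ j, (Function.update (fun _ j => coeff A j f) i γ l j) ⊗ₜ[ℝ]
        (Function.update (fun _ => (Module.finBasis ℝ F : _ → F)) i y l j) := by
    funext l
    by_cases hl : l = i
    · subst hl
      simp
    · simp [hl, sum_coeff_tmul]
  rw [h, extP, MultilinearMap.map_sum, map_sum, LinearMap.sum_apply]
  refine Finset.sum_congr rfl fun s _ => ?_
  rw [extM_tmul, ext₂_tmul, LinearMap.id_apply]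
  congr! 3
  · congr 2
    funext l
    by_cases hl : l = i
    · subst hl; simp
    · simp [hl]
  · funext l
    by_cases hl : l = i
    · subst hl; simp
    · simp [hl]

/-- Only slot `i` can have non-central coefficients, so they may be brought to the front, where the
scalar reaches them. With `smul_extP`, this moves the generators in ∑ eʲ ∂ⱼ next to the
differentiated argument. -/
theorem smul_extP_update (P : MultilinearMap ℝ (fun _ : Fin r => F) (G →ₗ[ℝ] ℝ))
    {f : A ⊗[ℝ] F} (hf : IsCentralVec f) (i : Fin r) (a : A) (g : A ⊗[ℝ] F) (X : A ⊗[ℝ] G) :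
    a • extP A P (Function.update (fun _ => f) i g) X =
      extP A P (Function.update (fun _ => f) i (a • g)) X := by
  induction X with
  | zero => simp
  | add x y hx hy => simp only [map_add, smul_add, hx, hy]
  | tmul b X =>
    rw [extP_tmul, extP_tmul, Finset.smul_sum]
    refine Finset.sum_congr rfl fun s _ => ?_
    have h : ∀ g : A ⊗[ℝ] F, (fun l => coeff A (s l) (Function.update (fun _ => f) i g l)) =
        Function.update (fun l => coeff A (s l) f) i (coeff A (s i) g) := fun g => by
      funext l
      by_cases hl : l = i
      · subst hl; simp
      · simp [hl]
    rw [h, h, prod_ofFn_update _ (fun l b => hf _ b), prod_ofFn_update _ (fun l b => hf _ b)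
      i (coeff A (s i) (a • g)), coeff_smul, TensorProduct.smul_tmul', smul_eq_mul]
    simp only [mul_assoc]

theorem smul_extP (P : MultilinearMap ℝ (fun _ : Fin r => F) (G →ₗ[ℝ] ℝ))
    {f : A ⊗[ℝ] F} (hf : IsCentralVec f) (a : A) (X : A ⊗[ℝ] G) :
    a • extP A P (fun _ => f) X = extP A P (fun _ => f) (a • X) := by
  induction X with
  | zero => simp
  | add x y hx hy => simp only [map_add, smul_add, hx, hy]
  | tmul b X =>
    rw [extP_tmul, TensorProduct.smul_tmul', extP_tmul, Finset.smul_sum]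
    refine Finset.sum_congr rfl fun s _ => ?_
    rw [TensorProduct.smul_tmul', smul_eq_mul, smul_eq_mul, ← mul_assoc, ← mul_assoc,
      (commute_prod_ofFn _ (fun l b => hf _ b) a).eq]

end Invariance

/-! ### The invariance axioms over a coefficient algebra -/

section InvariantForm

variable {A : Type*} [Ring A] [Algebra ℝ A]
  {V₀ V₁ : Type*} [AddCommGroup V₀] [Module ℝ V₀] [AddCommGroup V₁] [Module ℝ V₁]
  [FiniteDimensional ℝ V₀] {L : TwoTermLInfty V₀ V₁} {r : ℕ} (P : InvariantForm L r)
  {f : A ⊗[ℝ] V₀} (hf : IsCentralVec f)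

include hf

/-- For pure tensors, centrality of `f` brings the coefficient of `a` to the front in every summand;
the axiom `form_act` then applies to each tuple of basis vectors. -/
theorem extP_act (a : A ⊗[ℝ] V₀) (X : A ⊗[ℝ] V₁) :
    extP A P.form (fun _ => f) (ext₂ A L.act a X) =
      -∑ i, extP A P.form (Function.update (fun _ => f) i (ext₂ A L.br a f)) X := by
  induction a with
  | zero => simp [extP_update_zero]
  | add a a' h h' =>
    simp only [map_add, LinearMap.add_apply, h, h', extP_update_add, Finset.sum_add_distrib]
    abel
  | tmul a x =>
    induction X with
    | zero => simp
    | add y y' h h' => simp only [map_add, h, h', Finset.sum_add_distrib]; abel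
    | tmul b X =>
      have h : ext₂ A L.br (a ⊗ₜ x) f =
          ∑ j, (a * coeff A j f) ⊗ₜ L.br x (Module.finBasis ℝ V₀ j) := by
        conv_lhs => rw [← sum_coeff_tmul f]
        simp
      have h1 : ∀ i, extP A P.form (Function.update (fun _ => f) i (ext₂ A L.br (a ⊗ₜ x) f))
          (b ⊗ₜ X) = _ := fun i => by rw [h, extP_update_tmul]
      rw [Finset.sum_congr rfl fun i _ => h1 i, ext₂_tmul, extP_tmul]
      rw [Finset.sum_comm, ← Finset.sum_neg_distrib]
      refine Finset.sum_congr rfl fun s _ => ?_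
      have h2 : ∀ i : Fin r, (List.ofFn (Function.update (fun l => coeff A (s l) f) i
          (a * coeff A (s i) f))).prod = a * (List.ofFn fun l => coeff A (s l) f).prod :=
        fun i => prod_ofFn_update_mul _ (fun l b => hf _ b) i a
      simp only [h2]
      rw [← TensorProduct.tmul_sum, ← TensorProduct.tmul_neg, ← mul_assoc,
        (commute_prod_ofFn _ (fun l b => hf _ b) a).eq, P.form_act]

/-- The axiom `form_α` exchanges `X` and `X'` without a sign; the sign comes from the anticommuting
coefficients. -/
theorem extP_α_swap (i : Fin r) (e e' : A) (he : e * e' = -(e' * e)) (X X' : V₁) :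
    extP A P.form (Function.update (fun _ => f) i (e ⊗ₜ L.α X)) (e' ⊗ₜ X') =
      -extP A P.form (Function.update (fun _ => f) i (e' ⊗ₜ L.α X')) (e ⊗ₜ X) := by
  by_cases hJ : IsEmpty (Fin (Module.finrank ℝ V₀))
  · have h0 : ∀ g : A ⊗[ℝ] V₀, g = 0 := fun g => by
      rw [← sum_coeff_tmul g]
      exact Fintype.sum_empty _
    rw [h0 (e ⊗ₜ L.α X), h0 (e' ⊗ₜ L.α X'), extP_update_zero]
    simp
  -- `extP_update_tmul` expects a family indexed by the basis, so the single tensor is placed at an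
  -- arbitrary index and the other coefficients are zero.
  · obtain ⟨j₀⟩ := not_isEmpty_iff.1 hJ
    have h : ∀ (e : A) (y : V₀), e ⊗ₜ[ℝ] y = ∑ j, (if j = j₀ then e else 0) ⊗ₜ y := fun e y => by
      simp [← TensorProduct.sum_tmul]
    rw [h e, h e', extP_update_tmul, extP_update_tmul, ← Finset.sum_neg_distrib]
    refine Finset.sum_congr rfl fun s _ => ?_
    rw [P.form_α, ← TensorProduct.neg_tmul]
    congr 1
    rw [prod_ofFn_update _ (fun l b => hf _ b),
      prod_ofFn_update _ (fun l b => hf _ b) i (if s i = j₀ then e' else 0)]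
    have hc : ∀ b, Commute (List.ofFn (Function.update (fun l => coeff A (s l) f) i 1)).prod b :=
      commute_prod_ofFn _ fun l b => by
        by_cases hl : l = i
        · subst hl; simp
        · simpa [hl] using hf _ b
    split_ifs
    · rw [mul_assoc, (hc e').eq, ← mul_assoc, he, mul_assoc e', (hc e).eq, ← mul_assoc, neg_mul]
    · simp

/-- All slots and the last bracket argument contain the same `f`, so exchanging the latter with any
slot changes nothing. The axiom `form_jac` then says that the value `Y` equals `-r Y`, and `r + 1`
is not zero. -/
theorem extP_jac (a a' : A ⊗[ℝ] V₀) :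
    extP A P.form (fun _ => f) (ext₂ A LinearMap.id (ext₂ A L.jac a a') f) = 0 := by
  induction a with
  | zero => simp
  | add a b h h' => simp only [map_add, LinearMap.add_apply, h, h', add_zero]
  | tmul a x =>
    induction a' with
    | zero => simp
    | add y y' h h' => simp only [map_add, LinearMap.add_apply, h, h', add_zero]
    | tmul a' x' =>
      set Y : A ⊗[ℝ] ℝ := extP A P.form (fun _ => f)
        (ext₂ A LinearMap.id (ext₂ A L.jac (a ⊗ₜ x) (a' ⊗ₜ x')) f) with hY
      let J := Fin (Module.finrank ℝ V₀)
      let w : (Fin r → J) × J → A := fun p =>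
        (List.ofFn fun l => coeff A (p.1 l) f).prod * coeff A p.2 f
      have hw : ∀ (i : Fin r) (p : (Fin r → J) × J), w (Function.update p.1 i p.2, p.1 i) = w p := by
        rintro i ⟨s, b⟩
        simp only [w]
        have h1 : (fun l => coeff A (Function.update s i b l) f) =
            Function.update (fun l => coeff A (s l) f) i (coeff A b f) := by
          funext l
          by_cases hl : l = i
          · subst hl; simp
          · simp [hl]
        rw [h1, prod_ofFn_update _ (fun l b => hf _ b), (hf b _).eq, mul_assoc, (hf b _).eq,
          ← mul_assoc]
        congr 1
        rw [← (hf (s i) _).eq, ← prod_ofFn_update _ (fun l b => hf _ b)]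
        simp
      have h1 : Y = ∑ p : (Fin r → J) × J, (w p * (a * a')) ⊗ₜ[ℝ]
          P.form (fun i => Module.finBasis ℝ V₀ (p.1 i))
            (L.jac x x' (Module.finBasis ℝ V₀ p.2)) := by
        have h2 : ext₂ A LinearMap.id (ext₂ A L.jac (a ⊗ₜ x) (a' ⊗ₜ x')) f =
            ∑ b, (a * a' * coeff A b f) ⊗ₜ L.jac x x' (Module.finBasis ℝ V₀ b) := by
          conv_lhs => rw [← sum_coeff_tmul f]
          simp
        rw [hY, h2, map_sum, Fintype.sum_prod_type, Finset.sum_comm]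
        refine Finset.sum_congr rfl fun b _ => ?_
        rw [extP_tmul]
        refine Finset.sum_congr rfl fun s _ => ?_
        simp only [w]
        rw [mul_assoc _ (coeff A b f), (hf b _).eq]
      have h2 : Y = -∑ _i : Fin r, Y := by
        have h3 : ∀ p : (Fin r → J) × J, (w p * (a * a')) ⊗ₜ[ℝ]
            P.form (fun i => Module.finBasis ℝ V₀ (p.1 i))
              (L.jac x x' (Module.finBasis ℝ V₀ p.2)) = -∑ i, (w p * (a * a')) ⊗ₜ[ℝ]
            P.form (Function.update (fun i => Module.finBasis ℝ V₀ (p.1 i)) i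
              (Module.finBasis ℝ V₀ p.2)) (L.jac x x' (Module.finBasis ℝ V₀ (p.1 i))) := fun p => by
          rw [P.form_jac, TensorProduct.tmul_neg, TensorProduct.tmul_sum]
        refine h1.trans ?_
        rw [Finset.sum_congr rfl fun p _ => h3 p, Finset.sum_neg_distrib, Finset.sum_comm]
        congr 1
        refine Finset.sum_congr rfl fun i _ => ?_
        rw [h1]
        -- Exchanging the index of slot `i` with that of the bracket argument is a bijection of the
        -- index set and, by `hw`, preserves the coefficients.
        have hinv : Function.Involutive fun p : (Fin r → J) × J =>
            (Function.update p.1 i p.2, p.1 i) := fun p => by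
          refine Prod.ext ?_ (Function.update_self _ _ _)
          exact (Function.update_idem _ _ _).trans (Function.update_eq_self _ _)
        refine Fintype.sum_equiv hinv.toPerm _ _ fun p => ?_
        rw [Function.Involutive.coe_toPerm]
        simp only [hw]
        congr 2
        congr 1
        funext l
        by_cases hl : l = i
        · subst hl; simp
        · simp [hl]
      have h3 : ((r : ℝ) + 1) • Y = 0 := by
        simp only [Finset.sum_const, Finset.card_univ, Fintype.card_fin] at h2
        rw [add_smul, one_smul, Nat.cast_smul_eq_nsmul]
        nth_rewrite 2 [h2]
        exact add_neg_cancel _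
      exact (smul_eq_zero.1 h3).resolve_left (by positivity)

end InvariantForm

/-! ### Linearity of the embedding, the exterior derivative, and commutation of coefficients -/

section Hat

variable {T : Type*} [NormedAddCommGroup T] [NormedSpace ℝ T] [FiniteDimensional ℝ T]
  {F G : Type*} [NormedAddCommGroup F] [NormedSpace ℝ F] [NormedAddCommGroup G] [NormedSpace ℝ G]

instance finiteDimensional_alternating [FiniteDimensional ℝ F] {n : ℕ} :
    FiniteDimensional ℝ (T [⋀^Fin n]→L[ℝ] F) := by
  let f : (T [⋀^Fin n]→L[ℝ] F) →ₗ[ℝ] ((Fin n → Fin (Module.finrank ℝ T)) → F) :=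
    { toFun := fun ψ s => ψ fun i => Module.finBasis ℝ T (s i)
      map_add' := fun _ _ => rfl
      map_smul' := fun _ _ => rfl }
  refine FiniteDimensional.of_injective f fun ψ θ h => hat_injective ?_
  rw [hat_eq_antiSum, hat_eq_antiSum]
  congr 1
  funext s
  exact congrArg _ (congrFun h s)

theorem hat_add {n : ℕ} (ψ θ : T [⋀^Fin n]→L[ℝ] F) : hat (ψ + θ) = hat ψ + hat θ := by
  simp only [hat_eq_antiSum, ← antiSum_add, ← smul_add]
  rfl

theorem hat_smul {n : ℕ} (c : ℝ) (ψ : T [⋀^Fin n]→L[ℝ] F) : hat (c • ψ) = c • hat ψ := by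
  simp only [hat_eq_antiSum, smul_antiSum, smul_comm c]
  rfl

theorem hat_zero {n : ℕ} : hat (0 : T [⋀^Fin n]→L[ℝ] F) = 0 := by
  rw [← zero_smul ℝ (0 : T [⋀^Fin n]→L[ℝ] F), hat_smul, zero_smul]

theorem hat_sub {n : ℕ} (ψ θ : T [⋀^Fin n]→L[ℝ] F) : hat (ψ - θ) = hat ψ - hat θ := by
  simp only [hat_eq_antiSum, ← antiSum_sub, ← smul_sub]
  rfl

theorem hat_sum {n : ℕ} {ι : Type*} (s : Finset ι) (ψ : ι → T [⋀^Fin n]→L[ℝ] F) :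
    hat (∑ i ∈ s, ψ i) = ∑ i ∈ s, hat (ψ i) := by
  classical
  induction s using Finset.induction_on with
  | empty => simp [hat_zero]
  | insert i s hi h => rw [Finset.sum_insert hi, Finset.sum_insert hi, hat_add, h]

theorem hat_comp {n : ℕ} (α : F →L[ℝ] G) (ψ : T [⋀^Fin n]→L[ℝ] F) :
    hat (α.compContinuousAlternatingMap ψ) = (α : F →ₗ[ℝ] G).lTensor _ (hat ψ) := by
  simp only [hat_eq_antiSum, lTensor_antiSum, map_smul]
  rfl

theorem antiSum_succ {n : ℕ} (f : Fin (Module.finrank ℝ T) → (Fin n → Fin (Module.finrank ℝ T)) → F) :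
    antiSum (n + 1) (fun s => f (s 0) fun i => s i.succ) =
      ∑ j, gen T j • antiSum n (f j) := by
  simp only [antiSum, ExteriorAlgebra.ιMulti_apply, Finset.smul_sum]
  rw [← Fintype.sum_prod_type']
  refine Fintype.sum_equiv (Fin.consEquiv _).symm _ _ fun s => ?_
  obtain ⟨⟨j, s⟩, rfl⟩ := (Fin.consEquiv fun _ => Fin (Module.finrank ℝ T)).surjective s
  simp only [Equiv.symm_apply_apply, List.ofFn_succ, List.prod_cons, TensorProduct.smul_tmul',
    smul_eq_mul]
  congr 2

/-- The `n + 1` terms of the alternation agree after a cyclic reordering whose sign cancels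
`(-1)^i`; the factor `n + 1` then adjusts the factorial. In the exterior algebra `d` is simply ∑ eʲ
∂ⱼ. -/
theorem hat_extDeriv {n : ℕ} (w : T → T [⋀^Fin n]→L[ℝ] F) (x : T) :
    hat (extDeriv w x) = ∑ j, gen T j • hat (fderiv ℝ w x (Module.finBasis ℝ T j)) := by
  have h1 : ∀ s : Fin (n + 1) → Fin (Module.finrank ℝ T),
      extDeriv w x (fun i => Module.finBasis ℝ T (s i)) = ∑ i : Fin (n + 1), (-1 : ℤ) ^ (i : ℕ) •
        (fun s : Fin (n + 1) → Fin (Module.finrank ℝ T) =>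
          fderiv ℝ w x (Module.finBasis ℝ T (s 0)) fun j => Module.finBasis ℝ T (s j.succ))
          (s ∘ i.cycleRange.symm) := fun s => by
    rw [extDeriv, ContinuousAlternatingMap.alternatizeUncurryFin_apply]
    refine Finset.sum_congr rfl fun i _ => ?_
    simp only [Function.comp_apply, Fin.cycleRange_symm_zero, Fin.cycleRange_symm_succ]
    rfl
  have h2 : ∀ (c : ℝ) (m : Fin (n + 1) → (Fin (n + 1) → Fin (Module.finrank ℝ T)) → F),
      antiSum (n + 1) (fun s => c • ∑ i : Fin (n + 1), (-1 : ℤ) ^ (i : ℕ) • m i s) =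
        c • ∑ i : Fin (n + 1), (-1 : ℤ) ^ (i : ℕ) • antiSum (n + 1) (m i) := fun c m => by
    simp only [antiSum, TensorProduct.tmul_smul, TensorProduct.tmul_sum, Finset.smul_sum]
    rw [Finset.sum_comm]
  rw [hat_eq_antiSum]
  simp only [h1]
  rw [h2]
  have h3 : ∀ i : Fin (n + 1), (-1 : ℤ) ^ (i : ℕ) • antiSum (T := T) (n + 1) (fun s =>
      (fun s : Fin (n + 1) → Fin (Module.finrank ℝ T) =>
        fderiv ℝ w x (Module.finBasis ℝ T (s 0)) fun j => Module.finBasis ℝ T (s j.succ))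
          (s ∘ i.cycleRange.symm)) = antiSum (n + 1) fun s =>
        fderiv ℝ w x (Module.finBasis ℝ T (s 0)) fun j => Module.finBasis ℝ T (s j.succ) :=
    fun i => by
      rw [show antiSum (T := T) (n + 1) (fun s =>
        (fun s : Fin (n + 1) → Fin (Module.finrank ℝ T) =>
          fderiv ℝ w x (Module.finBasis ℝ T (s 0)) fun j => Module.finBasis ℝ T (s j.succ))
            (s ∘ i.cycleRange.symm)) = _ from antiSum_comp_perm i.cycleRange.symm
        fun s => fderiv ℝ w x (Module.finBasis ℝ T (s 0)) fun j => Module.finBasis ℝ T (s j.succ),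
        Equiv.Perm.sign_symm, Fin.sign_cycleRange, smul_smul]
      simp [← mul_pow]
  rw [Finset.sum_congr rfl fun i _ => h3 i, Finset.sum_const, Finset.card_univ, Fintype.card_fin]
  simp only [hat_eq_antiSum]
  rw [antiSum_succ fun i s => fderiv ℝ w x (Module.finBasis ℝ T i) fun j => Module.finBasis ℝ T (s j)]
  simp only [← smul_antiSum, smul_comm (gen T _) (_ : ℝ), ← Finset.smul_sum]
  rw [← Nat.cast_smul_eq_nsmul ℝ, smul_smul, Nat.factorial_succ]
  congr 1
  have := Nat.factorial_ne_zero n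
  push_cast
  field_simp

omit [FiniteDimensional ℝ T] in
-- Passing a generator costs two signs. This makes the coefficients of two-forms central.
theorem ι_mul_ι_commute (d d' : Module.Dual ℝ T) (b : ExtDual T) :
    Commute (ExteriorAlgebra.ι ℝ d * ExteriorAlgebra.ι ℝ d') b := by
  have h : ∀ d d' : Module.Dual ℝ T, ExteriorAlgebra.ι ℝ d * ExteriorAlgebra.ι ℝ d' =
      -(ExteriorAlgebra.ι ℝ d' * ExteriorAlgebra.ι ℝ d) := fun d d' =>
    eq_neg_of_add_eq_zero_left (ExteriorAlgebra.ι_add_mul_swap _ _)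
  induction b using ExteriorAlgebra.induction with
  | algebraMap r => exact (Algebra.commutes r _).symm
  | ι e =>
    change _ * _ = _ * _
    rw [mul_assoc, h d' e, mul_neg, ← mul_assoc, h d e, neg_mul, neg_neg, mul_assoc]
  | mul a b ha hb => exact ha.mul_right hb
  | add a b ha hb => exact ha.add_right hb

theorem isCentralVec_hat [FiniteDimensional ℝ F] (ψ : T [⋀^Fin 2]→L[ℝ] F) :
    IsCentralVec (hat ψ) := by
  intro i b
  rw [hat_eq_antiSum, antiSum, map_sum]
  refine Commute.sum_left _ _ _ fun s _ => ?_
  rw [coeff_tmul, ExteriorAlgebra.ιMulti_apply]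
  simp only [List.ofFn_succ, List.ofFn_zero, List.prod_cons, List.prod_nil, mul_one]
  exact (ι_mul_ι_commute _ _ b).smul_left _

omit [FiniteDimensional ℝ T] in
-- A monomial of degree three is a generator times a central element, so only the first generators
-- produce a sign.
theorem ιMulti_three_anticomm (u v : Fin 3 → Module.Dual ℝ T) :
    ExteriorAlgebra.ιMulti ℝ 3 u * ExteriorAlgebra.ιMulti ℝ 3 v =
      -(ExteriorAlgebra.ιMulti ℝ 3 v * ExteriorAlgebra.ιMulti ℝ 3 u) := by
  have key : ∀ a b z z' : ExtDual T, (∀ c, Commute z c) → (∀ c, Commute z' c) →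
      a * b = -(b * a) → a * z * (b * z') = -(b * z' * (a * z)) := by
    intro a b z z' hz hz' h
    rw [mul_assoc, ← mul_assoc z, (hz b).eq, mul_assoc b, ← mul_assoc a, h, mul_assoc b z',
      ← mul_assoc z', (hz' a).eq, mul_assoc a, ← mul_assoc b, (hz z').eq, neg_mul]
  simp only [ExteriorAlgebra.ιMulti_apply, List.ofFn_succ, List.ofFn_zero, List.prod_cons,
    List.prod_nil, mul_one]
  exact key _ _ _ _ (ι_mul_ι_commute _ _) (ι_mul_ι_commute _ _)
    (eq_neg_of_add_eq_zero_left (ExteriorAlgebra.ι_add_mul_swap _ _))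

end Hat

/-! ### The algebraic identity behind closedness -/

section Closed

variable {T : Type*} [NormedAddCommGroup T] [NormedSpace ℝ T] [FiniteDimensional ℝ T]
  {V₀ V₁ : Type*} [NormedAddCommGroup V₀] [NormedSpace ℝ V₀] [FiniteDimensional ℝ V₀]
  [NormedAddCommGroup V₁] [NormedSpace ℝ V₁]
  {L : TwoTermLInfty V₀ V₁} {r : ℕ} (P : InvariantForm L r)

/-- The pairing is symmetric under `form_α`, while the coefficients of the two copies of the
three-form anticommute; hence it equals its negative. -/
theorem extP_update_α_self (f : T [⋀^Fin 2]→L[ℝ] V₀) (H : T [⋀^Fin 3]→L[ℝ] V₁) (i : Fin r) :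
    extP _ P.form (Function.update (fun _ => hat f) i (eα L (hat H))) (hat H) = 0 := by
  have h1 : ∀ X : ExtDual T ⊗[ℝ] ℝ, X = -X → X = 0 := fun X h => by
    have h2 : (2 : ℝ) • X = 0 := by
      rw [two_smul]
      nth_rewrite 1 [h]
      exact neg_add_cancel _
    exact (smul_eq_zero.1 h2).resolve_left two_ne_zero
  refine h1 _ ?_
  rw [hat_eq_antiSum H, eα, lTensor_antiSum, antiSum, antiSum, extP_update_sum]
  simp only [map_sum, LinearMap.sum_apply]
  conv_rhs => rw [Finset.sum_comm]
  rw [← Finset.sum_neg_distrib]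
  refine Finset.sum_congr rfl fun s _ => ?_
  rw [← Finset.sum_neg_distrib]
  refine Finset.sum_congr rfl fun t _ => ?_
  exact extP_α_swap P (isCentralVec_hat f) i _ _ (ιMulti_three_anticomm _ _) _ _

omit [FiniteDimensional ℝ V₀] in
-- Two-forms commute and the bracket is antisymmetric.
theorem eBr_two_two (f : T [⋀^Fin 2]→L[ℝ] V₀) : eBr L (hat f) (hat f) = 0 := by
  have h0 : hat f = antiSum 2 fun s => (fun i j => (2 : ℝ)⁻¹ •
      f ![Module.finBasis ℝ T i, Module.finBasis ℝ T j]) (s 0) (s 1) := by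
    rw [hat_eq_antiSum]
    congr 1
    funext s
    congr 2
    funext i
    fin_cases i <;> rfl
  rw [h0]
  generalize (fun i j => (2 : ℝ)⁻¹ •
      f ![Module.finBasis ℝ T i, Module.finBasis ℝ T j]) = c
  set m : (Fin 4 → Fin (Module.finrank ℝ T)) → V₀ := fun s => L.br (c (s 0) (s 1)) (c (s 2) (s 3))
    with hm
  have h1 : eBr L (antiSum (T := T) 2 fun s => c (s 0) (s 1)) (antiSum 2 fun s => c (s 0) (s 1)) =
      antiSum 4 m := ext₂_antiSum _ _ _
  have h2 := antiSum_eq_of_perm (T := T) (finRotate 4 * finRotate 4) m (by decide)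
  have h3 : antiSum (T := T) 4 m = -antiSum 4 m := by
    nth_rewrite 1 [← h2]
    rw [← antiSum_neg]
    exact congrArg _ (funext fun s => L.br_swap _ _)
  have h4 : (2 : ℝ) • antiSum (T := T) 4 m = 0 := by
    rw [two_smul]
    nth_rewrite 1 [h3]
    exact neg_add_cancel _
  rw [h1]
  exact (smul_eq_zero.1 h4).resolve_left two_ne_zero

/-- The inserted expressions are the right-hand sides of the Bianchi identities. The terms with `[a,
·]` cancel by `extP_act`, the term with `α` vanishes by `extP_update_α_self`, the term `[f, b]`
vanishes by `extP_act` and `[f, f] = 0`, and the trilinear term by `extP_jac`. -/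
theorem invariant_closed (a : ExtDual T ⊗[ℝ] V₀) (f : T [⋀^Fin 2]→L[ℝ] V₀)
    (b : ExtDual T ⊗[ℝ] V₁) (H : T [⋀^Fin 3]→L[ℝ] V₁) :
    ∑ i, extP _ P.form (Function.update (fun _ => hat f) i
        (-eBr L a (hat f) - eα L (hat H))) (hat H) +
      extP _ P.form (fun _ => hat f)
        (-eAct L a (hat H) + eAct L (hat f) b - (1 / 2 : ℝ) • eJac L a a (hat f)) = 0 := by
  have hf := isCentralVec_hat f
  have h1 := extP_act P hf a (hat H)
  have h2 := extP_act P hf (hat f) b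
  have h3 := extP_jac P hf a a
  have h4 : ext₂ _ L.br (hat f) (hat f) = 0 := eBr_two_two f
  simp only [h4, extP_update_zero, LinearMap.zero_apply, Finset.sum_const_zero, neg_zero] at h2
  simp only [sub_eq_add_neg (-eBr L a (hat f)), extP_update_add, extP_update_neg,
    LinearMap.add_apply, LinearMap.neg_apply, extP_update_α_self, neg_zero, add_zero,
    Finset.sum_neg_distrib]
  rw [map_sub, map_add, map_neg, map_smul, h1, h2, h3]
  simp

end Closed

/-! ### Derivatives of multilinear expressions in finite dimensions -/

section FiniteDimensional

variable {X E₁ E₂ E₃ : Type*} [NormedAddCommGroup X] [NormedSpace ℝ X]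
  [NormedAddCommGroup E₁] [NormedSpace ℝ E₁] [FiniteDimensional ℝ E₁]
  [NormedAddCommGroup E₂] [NormedSpace ℝ E₂] [FiniteDimensional ℝ E₂]
  [NormedAddCommGroup E₃] [NormedSpace ℝ E₃]

theorem fderiv_bilinear (B : E₁ →ₗ[ℝ] E₂ →ₗ[ℝ] E₃) {f : X → E₁} {g : X → E₂} {x : X}
    (hf : DifferentiableAt ℝ f x) (hg : DifferentiableAt ℝ g x) (v : X) :
    fderiv ℝ (fun y => B (f y) (g y)) x v =
      B (fderiv ℝ f x v) (g x) + B (f x) (fderiv ℝ g x v) := by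
  have h := congrArg (fun f => f v)
    ((LinearMap.toContinuousBilinearMap B).fderiv_of_bilinear hf hg)
  exact h.trans (add_comm _ _)

theorem contDiffAt_bilinear (B : E₁ →ₗ[ℝ] E₂ →ₗ[ℝ] E₃) {f : X → E₁} {g : X → E₂} {x : X}
    {n : WithTop ℕ∞} (hf : ContDiffAt ℝ n f x) (hg : ContDiffAt ℝ n g x) :
    ContDiffAt ℝ n (fun y => B (f y) (g y)) x :=
  (hf.continuousLinearMap_comp (LinearMap.toContinuousBilinearMap B)).clm_apply hg

variable {ι : Type*} [Fintype ι] [DecidableEq ι]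

theorem fderiv_multilinear (P : MultilinearMap ℝ (fun _ : ι => E₁) E₃) {f : ι → X → E₁} {x : X}
    (hf : ∀ i, DifferentiableAt ℝ (f i) x) (v : X) :
    fderiv ℝ (fun y => P fun i => f i y) x v =
      ∑ i, P (Function.update (fun l => f l x) i (fderiv ℝ (f i) x v)) := by
  have h := (HasFDerivAt.multilinear_comp ⟨P, multilinear_continuous P⟩ (g := f)
    fun i => (hf i).hasFDerivAt).fderiv
  have h2 := congrArg (fun f => f v) h
  refine h2.trans ?_
  simp only [sum_apply]
  rfl

omit [DecidableEq ι] in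
theorem contDiffAt_multilinear (P : MultilinearMap ℝ (fun _ : ι => E₁) E₃) {f : ι → X → E₁} {x : X}
    {n : WithTop ℕ∞} (hf : ∀ i, ContDiffAt ℝ n (f i) x) :
    ContDiffAt ℝ n (fun y => P fun i => f i y) x :=
  ((ContinuousMultilinearMap.contDiff (𝕜 := ℝ) ⟨P, multilinear_continuous P⟩).contDiffAt
    (x := fun i => f i x)).comp x (contDiffAt_pi.2 hf)

theorem fderiv_multilinear_apply (P : MultilinearMap ℝ (fun _ : ι => E₁) (E₂ →ₗ[ℝ] E₃))
    {f : ι → X → E₁} {g : X → E₂} {x : X} (hf : ∀ i, DifferentiableAt ℝ (f i) x)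
    (hg : DifferentiableAt ℝ g x) (v : X) :
    fderiv ℝ (fun y => P (fun i => f i y) (g y)) x v =
      ∑ i, P (Function.update (fun l => f l x) i (fderiv ℝ (f i) x v)) (g x) +
        P (fun l => f l x) (fderiv ℝ g x v) := by
  have h1 := HasFDerivAt.multilinear_comp
    (⟨_, multilinear_continuous (LinearMap.toContinuousLinearMap.toLinearMap.compMultilinearMap P)⟩ :
      ContinuousMultilinearMap ℝ (fun _ : ι => E₁) (E₂ →L[ℝ] E₃)) (g := f)
    fun i => (hf i).hasFDerivAt
  have h2 := congrArg (fun f => f v) (h1.clm_apply hg.hasFDerivAt).fderiv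
  refine h2.trans ?_
  simp only [add_apply, ContinuousLinearMap.flip_apply, ContinuousLinearMap.comp_apply,
    sum_apply]
  exact add_comm _ _

omit [DecidableEq ι] in
theorem contDiffAt_multilinear_apply (P : MultilinearMap ℝ (fun _ : ι => E₁) (E₂ →ₗ[ℝ] E₃))
    {f : ι → X → E₁} {g : X → E₂} {x : X} {n : WithTop ℕ∞} (hf : ∀ i, ContDiffAt ℝ n (f i) x)
    (hg : ContDiffAt ℝ n g x) : ContDiffAt ℝ n (fun y => P (fun i => f i y) (g y)) x :=
  (contDiffAt_multilinear
    (LinearMap.toContinuousLinearMap.toLinearMap.compMultilinearMap P) hf).clm_apply hg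

end FiniteDimensional

/-! ### Product rules and smoothness for wedge products -/

section Products

variable {T : Type*} [NormedAddCommGroup T] [NormedSpace ℝ T] [FiniteDimensional ℝ T]
  {X : Type*} [NormedAddCommGroup X] [NormedSpace ℝ X]
  {F G H : Type*} [NormedAddCommGroup F] [NormedSpace ℝ F] [FiniteDimensional ℝ F]
  [NormedAddCommGroup G] [NormedSpace ℝ G] [FiniteDimensional ℝ G]
  [NormedAddCommGroup H] [NormedSpace ℝ H]

/-- The wedge product along a bilinear map, as a bilinear map. -/
def wedge₂Lin (T : Type*) [NormedAddCommGroup T] [NormedSpace ℝ T] [FiniteDimensional ℝ T]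
    (μ : F →ₗ[ℝ] G →ₗ[ℝ] H) (p q : ℕ) :
    (T [⋀^Fin p]→L[ℝ] F) →ₗ[ℝ] (T [⋀^Fin q]→L[ℝ] G) →ₗ[ℝ] (T [⋀^Fin (p + q)]→L[ℝ] H) :=
  LinearMap.mk₂ ℝ (fun ψ θ => wedge₂ μ ψ θ)
    (fun _ _ _ => hat_injective (by simp [hat_wedge₂, hat_add]))
    (fun _ _ _ => hat_injective (by simp [hat_wedge₂, hat_smul]))
    (fun _ _ _ => hat_injective (by simp [hat_wedge₂, hat_add]))
    (fun _ _ _ => hat_injective (by simp [hat_wedge₂, hat_smul]))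

theorem fderiv_wedge₂ (μ : F →ₗ[ℝ] G →ₗ[ℝ] H) {p q : ℕ} {ψ : X → T [⋀^Fin p]→L[ℝ] F}
    {θ : X → T [⋀^Fin q]→L[ℝ] G} {x : X} (hψ : DifferentiableAt ℝ ψ x)
    (hθ : DifferentiableAt ℝ θ x) (v : X) :
    fderiv ℝ (fun y => wedge₂ μ (ψ y) (θ y)) x v =
      wedge₂ μ (fderiv ℝ ψ x v) (θ x) + wedge₂ μ (ψ x) (fderiv ℝ θ x v) :=
  fderiv_bilinear (wedge₂Lin T μ p q) hψ hθ v

theorem contDiffAt_wedge₂ (μ : F →ₗ[ℝ] G →ₗ[ℝ] H) {p q : ℕ} {ψ : X → T [⋀^Fin p]→L[ℝ] F}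
    {θ : X → T [⋀^Fin q]→L[ℝ] G} {x : X} {n : WithTop ℕ∞} (hψ : ContDiffAt ℝ n ψ x)
    (hθ : ContDiffAt ℝ n θ x) : ContDiffAt ℝ n (fun y => wedge₂ μ (ψ y) (θ y)) x :=
  contDiffAt_bilinear (wedge₂Lin T μ p q) hψ hθ

/-- The wedge product along a trilinear map, as a multilinear map. -/
def wedge₃MM (T : Type*) [NormedAddCommGroup T] [NormedSpace ℝ T] [FiniteDimensional ℝ T]
    (μ : F →ₗ[ℝ] F →ₗ[ℝ] F →ₗ[ℝ] H) (p : ℕ) :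
    MultilinearMap ℝ (fun _ : Fin 3 => T [⋀^Fin p]→L[ℝ] F) (T [⋀^Fin (p + p + p)]→L[ℝ] H) :=
  MultilinearMap.mk' (fun ψ => wedge₃ μ (ψ 0) (ψ 1) (ψ 2))
    (fun m i x y => hat_injective (by
      simp only [hat_add, hat_wedge₃]
      fin_cases i <;> simp [Function.update, hat_add]))
    (fun m i c x => hat_injective (by
      simp only [hat_smul, hat_wedge₃]
      fin_cases i <;> simp [Function.update, hat_smul]))

theorem fderiv_wedge₃ (μ : F →ₗ[ℝ] F →ₗ[ℝ] F →ₗ[ℝ] H) {p : ℕ} {ψ : X → T [⋀^Fin p]→L[ℝ] F}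
    {x : X} (hψ : DifferentiableAt ℝ ψ x) (v : X) :
    fderiv ℝ (fun y => wedge₃ μ (ψ y) (ψ y) (ψ y)) x v =
      wedge₃ μ (fderiv ℝ ψ x v) (ψ x) (ψ x) + wedge₃ μ (ψ x) (fderiv ℝ ψ x v) (ψ x) +
        wedge₃ μ (ψ x) (ψ x) (fderiv ℝ ψ x v) := by
  have h := fderiv_multilinear (wedge₃MM T μ p) (f := fun _ => ψ) (fun _ => hψ) v
  rw [Fin.sum_univ_three] at h
  exact h

theorem contDiffAt_wedge₃ (μ : F →ₗ[ℝ] F →ₗ[ℝ] F →ₗ[ℝ] H) {p : ℕ} {ψ : X → T [⋀^Fin p]→L[ℝ] F}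
    {x : X} {n : WithTop ℕ∞} (hψ : ContDiffAt ℝ n ψ x) :
    ContDiffAt ℝ n (fun y => wedge₃ μ (ψ y) (ψ y) (ψ y)) x :=
  contDiffAt_multilinear (wedge₃MM T μ p) (f := fun _ => ψ) fun _ => hψ

/-- The product `⟨f₁, …, f_r; θ⟩` of two-forms `f_i` with a form `θ`, as a multilinear map. -/
def wedgePairMM (T : Type*) [NormedAddCommGroup T] [NormedSpace ℝ T] [FiniteDimensional ℝ T]
    {r : ℕ} (P : MultilinearMap ℝ (fun _ : Fin r => F) (G →ₗ[ℝ] ℝ)) {q n : ℕ}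
    (h : ∑ _i : Fin r, 2 + q = n) :
    MultilinearMap ℝ (fun _ : Fin r => T [⋀^Fin 2]→L[ℝ] F)
      ((T [⋀^Fin q]→L[ℝ] G) →ₗ[ℝ] (T [⋀^Fin n]→L[ℝ] ℝ)) :=
  MultilinearMap.mk' (fun f =>
      { toFun := fun θ => wedgePair P (fun i => ⟨2, f i⟩) θ h
        map_add' := fun θ θ' => hat_injective (by simp [hat_wedgePair, hat_add])
        map_smul' := fun c θ => hat_injective (by simp [hat_wedgePair, hat_smul]) })
    (fun m i x y => by
      ext1 θ
      refine hat_injective ?_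
      have h1 : ∀ z, (fun l => hat (Function.update m i z l)) =
          Function.update (fun l => hat (m l)) i (hat z) := fun z => by
        funext l
        exact Function.apply_update (fun _ => hat) m i z l
      simp [hat_wedgePair, h1, hat_add])
    (fun m i c x => by
      ext1 θ
      refine hat_injective ?_
      have h1 : ∀ z, (fun l => hat (Function.update m i z l)) =
          Function.update (fun l => hat (m l)) i (hat z) := fun z => by
        funext l
        exact Function.apply_update (fun _ => hat) m i z l
      simp [hat_wedgePair, h1, hat_smul])

/-- For closedness of the invariant all multilinear slots are two-forms, so the product can be
treated as one multilinear map on a fixed space. -/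
theorem hat_fderiv_wedgePair {r : ℕ} (P : MultilinearMap ℝ (fun _ : Fin r => F) (G →ₗ[ℝ] ℝ))
    {q n : ℕ} (h : ∑ _i : Fin r, 2 + q = n) {f : X → T [⋀^Fin 2]→L[ℝ] F}
    {θ : X → T [⋀^Fin q]→L[ℝ] G} {x : X} (hf : DifferentiableAt ℝ f x)
    (hθ : DifferentiableAt ℝ θ x) (v : X) :
    hat (fderiv ℝ (fun y => wedgePair P (fun _ => ⟨2, f y⟩) (θ y) h) x v) =
      ∑ i, extP _ P (Function.update (fun _ => hat (f x)) i (hat (fderiv ℝ f x v))) (hat (θ x)) +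
        extP _ P (fun _ => hat (f x)) (hat (fderiv ℝ θ x v)) := by
  have h3 : fderiv ℝ (fun y => wedgePair P (fun _ => ⟨2, f y⟩) (θ y) h) x v =
      ∑ i, wedgePair P (fun l => ⟨2, Function.update (fun _ => f x) i (fderiv ℝ f x v) l⟩)
        (θ x) h + wedgePair P (fun _ => ⟨2, f x⟩) (fderiv ℝ θ x v) h :=
    fderiv_multilinear_apply (wedgePairMM T P h) (f := fun _ => f) (fun _ => hf) hθ v
  rw [h3, hat_add, hat_sum]
  simp only [hat_wedgePair, extP]
  congr 1
  refine Finset.sum_congr rfl fun i _ => ?_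
  congr 3
  funext l
  exact Function.apply_update (fun _ => hat) _ i _ l

theorem contDiffAt_wedgePair {r : ℕ} (P : MultilinearMap ℝ (fun _ : Fin r => F) (G →ₗ[ℝ] ℝ))
    {q n : ℕ} (h : ∑ _i : Fin r, 2 + q = n) {f : X → T [⋀^Fin 2]→L[ℝ] F}
    {θ : X → T [⋀^Fin q]→L[ℝ] G} {x : X} {k : WithTop ℕ∞} (hf : ContDiffAt ℝ k f x)
    (hθ : ContDiffAt ℝ k θ x) :
    ContDiffAt ℝ k (fun y => wedgePair P (fun _ => ⟨2, f y⟩) (θ y) h) x :=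
  contDiffAt_multilinear_apply (wedgePairMM T P h) (f := fun _ => f) (fun _ => hf) hθ

omit [FiniteDimensional ℝ T] in
theorem contDiffAt_extDeriv {n : ℕ} {w : T → T [⋀^Fin n]→L[ℝ] H} {x : T}
    (hw : ContDiffAt ℝ ∞ w x) : ContDiffAt ℝ ∞ (extDeriv w) x :=
  (ContinuousAlternatingMap.alternatizeUncurryFinCLM ℝ T H).contDiff.contDiffAt.comp x
    (hw.fderiv_right (by simp))

end Products

/-! ### Moving generators through products -/

section Bianchi

variable {T : Type*} [NormedAddCommGroup T] [NormedSpace ℝ T] [FiniteDimensional ℝ T]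
  {F G H : Type*} [AddCommGroup F] [Module ℝ F] [AddCommGroup G] [Module ℝ G]
  [AddCommGroup H] [Module ℝ H]

omit [FiniteDimensional ℝ T] in
theorem smul_ext₂ (μ : F →ₗ[ℝ] G →ₗ[ℝ] H) (c : ExtDual T) (x : ExtDual T ⊗[ℝ] F)
    (y : ExtDual T ⊗[ℝ] G) : c • ext₂ _ μ x y = ext₂ _ μ (c • x) y := by
  induction x with
  | zero => simp
  | add x x' h h' => simp only [map_add, smul_add, LinearMap.add_apply, h, h']
  | tmul a x =>
    induction y with
    | zero => simp
    | add y y' h h' => simp only [map_add, smul_add, h, h']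
    | tmul b y => simp [TensorProduct.smul_tmul', mul_assoc]

/-- A generator passes `p` others; this is the sign in the graded Leibniz rule. -/
theorem gen_smul_ext₂_antiSum (μ : F →ₗ[ℝ] G →ₗ[ℝ] H) (j : Fin (Module.finrank ℝ T)) {p : ℕ}
    (a : (Fin p → Fin (Module.finrank ℝ T)) → F) (y : ExtDual T ⊗[ℝ] G) :
    gen T j • ext₂ _ μ (antiSum p a) y = (-1 : ℝ) ^ p • ext₂ _ μ (antiSum p a) (gen T j • y) := by
  have key : ∀ (p : ℕ) (u : Fin p → Module.Dual ℝ T), gen T j * ExteriorAlgebra.ιMulti ℝ p u =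
      (-1 : ℝ) ^ p • (ExteriorAlgebra.ιMulti ℝ p u * gen T j) := by
    intro p
    induction p with
    | zero => intro u; simp
    | succ p ih =>
      intro u
      have h1 := ih (Matrix.vecTail u)
      rw [ExteriorAlgebra.ιMulti_succ_apply, ← mul_assoc]
      have h2 : gen T j * ExteriorAlgebra.ι ℝ (u 0) = -(ExteriorAlgebra.ι ℝ (u 0) * gen T j) :=
        eq_neg_of_add_eq_zero_left (ExteriorAlgebra.ι_add_mul_swap _ _)
      rw [h2, neg_mul, mul_assoc, h1, pow_succ, mul_neg_one, neg_smul, mul_smul_comm, mul_assoc]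
  rw [antiSum]
  simp only [map_sum, LinearMap.sum_apply, Finset.smul_sum]
  refine Finset.sum_congr rfl fun s _ => ?_
  induction y with
  | zero => simp
  | add y y' h h' => simp only [map_add, smul_add, h, h']
  | tmul b y =>
    simp only [ext₂_tmul, TensorProduct.smul_tmul', smul_eq_mul, ← mul_assoc, key]
    rw [smul_mul_assoc]

end Bianchi

/-! ### The Bianchi identities and closedness of the invariant -/

section Curvature

variable {T : Type*} [NormedAddCommGroup T] [NormedSpace ℝ T] [FiniteDimensional ℝ T]
  {F G H : Type*} [NormedAddCommGroup F] [NormedSpace ℝ F] [FiniteDimensional ℝ F]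
  [NormedAddCommGroup G] [NormedSpace ℝ G] [FiniteDimensional ℝ G]
  [NormedAddCommGroup H] [NormedSpace ℝ H] [FiniteDimensional ℝ H]
  {V₀ V₁ : Type*} [NormedAddCommGroup V₀] [NormedSpace ℝ V₀] [FiniteDimensional ℝ V₀]
  [NormedAddCommGroup V₁] [NormedSpace ℝ V₁] [FiniteDimensional ℝ V₁]

omit [FiniteDimensional ℝ T] [FiniteDimensional ℝ F] in
theorem extDeriv_sub {n : ℕ} {w w' : T → T [⋀^Fin n]→L[ℝ] F} {x : T}
    (hw : DifferentiableAt ℝ w x) (hw' : DifferentiableAt ℝ w' x) :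
    extDeriv (w - w') x = extDeriv w x - extDeriv w' x := by
  have h := extDeriv_add hw (hw'.const_smul (-1 : ℝ))
  rw [extDeriv_smul] at h
  rw [sub_eq_add_neg, sub_eq_add_neg, ← neg_one_smul ℝ w', h, neg_one_smul]

omit [FiniteDimensional ℝ F] in
theorem exists_hat_one (ψ : T [⋀^Fin 1]→L[ℝ] F) :
    ∃ a : Fin (Module.finrank ℝ T) → F, hat ψ = antiSum 1 fun s => a (s 0) :=
  ⟨fun j => (Nat.factorial 1 : ℝ)⁻¹ • ψ fun _ => Module.finBasis ℝ T j, by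
    rw [hat_eq_antiSum]
    congr 1
    funext s
    congr 2
    funext i
    rw [Subsingleton.elim i 0]⟩

omit [FiniteDimensional ℝ F] in
theorem exists_hat_two (ψ : T [⋀^Fin 2]→L[ℝ] F) :
    ∃ c : Fin (Module.finrank ℝ T) → Fin (Module.finrank ℝ T) → F,
      hat ψ = antiSum 2 fun s => c (s 0) (s 1) :=
  ⟨fun j l => (Nat.factorial 2 : ℝ)⁻¹ • ψ ![Module.finBasis ℝ T j, Module.finBasis ℝ T l], by
    rw [hat_eq_antiSum]
    congr 1
    funext s
    congr 2
    funext i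
    fin_cases i <;> rfl⟩

omit [FiniteDimensional ℝ H] in
theorem hat_extDeriv_wedge₂ (μ : F →ₗ[ℝ] G →ₗ[ℝ] H) {p q : ℕ} {ψ : T → T [⋀^Fin p]→L[ℝ] F}
    {θ : T → T [⋀^Fin q]→L[ℝ] G} {x : T} (hψ : DifferentiableAt ℝ ψ x)
    (hθ : DifferentiableAt ℝ θ x) :
    hat (extDeriv (fun y => wedge₂ μ (ψ y) (θ y)) x) =
      ext₂ _ μ (hat (extDeriv ψ x)) (hat (θ x)) +
        (-1 : ℝ) ^ p • ext₂ _ μ (hat (ψ x)) (hat (extDeriv θ x)) := by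
  rw [hat_extDeriv, hat_extDeriv, hat_extDeriv]
  simp only [fderiv_wedge₂ μ hψ hθ, hat_add, hat_wedge₂, smul_add, Finset.sum_add_distrib,
    map_sum, LinearMap.sum_apply, Finset.smul_sum]
  congr 1
  · exact Finset.sum_congr rfl fun j _ => smul_ext₂ _ _ _ _
  · refine Finset.sum_congr rfl fun j _ => ?_
    rw [hat_eq_antiSum (ψ x), gen_smul_ext₂_antiSum]

omit [FiniteDimensional ℝ H] in
theorem hat_extDeriv_wedge₃ (μ : F →ₗ[ℝ] F →ₗ[ℝ] F →ₗ[ℝ] H) {ψ : T → T [⋀^Fin 1]→L[ℝ] F}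
    {x : T} (hψ : DifferentiableAt ℝ ψ x) :
    hat (extDeriv (fun y => wedge₃ μ (ψ y) (ψ y) (ψ y)) x) =
      ext₂ _ LinearMap.id (ext₂ _ μ (hat (extDeriv ψ x)) (hat (ψ x))) (hat (ψ x)) -
      ext₂ _ LinearMap.id (ext₂ _ μ (hat (ψ x)) (hat (extDeriv ψ x))) (hat (ψ x)) +
      ext₂ _ LinearMap.id (ext₂ _ μ (hat (ψ x)) (hat (ψ x))) (hat (extDeriv ψ x)) := by
  rw [hat_extDeriv, hat_extDeriv]
  simp only [fderiv_wedge₃ μ hψ, hat_add, hat_wedge₃, smul_add, Finset.sum_add_distrib,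
    map_sum, LinearMap.sum_apply]
  obtain ⟨a, ha⟩ := exists_hat_one (ψ x)
  have h2 : ext₂ (ExtDual T) μ (hat (ψ x)) (hat (ψ x)) =
      antiSum (1 + 1) fun s => μ (a (s 0)) (a (s 1)) := by
    rw [ha]; exact ext₂_antiSum _ _ _
  congr 1
  · rw [sub_eq_add_neg, ← Finset.sum_neg_distrib]
    congr 1
    · refine Finset.sum_congr rfl fun j _ => ?_
      rw [smul_ext₂, smul_ext₂]
    · refine Finset.sum_congr rfl fun j _ => ?_
      rw [smul_ext₂, ha, gen_smul_ext₂_antiSum]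
      simp
  · refine Finset.sum_congr rfl fun j _ => ?_
    rw [h2, gen_smul_ext₂_antiSum]
    simp

omit [FiniteDimensional ℝ T] [FiniteDimensional ℝ F] [FiniteDimensional ℝ G] in
theorem contDiffAt_comp_alternating (α : F →L[ℝ] G) {p : ℕ} {ψ : T → T [⋀^Fin p]→L[ℝ] F} {x : T}
    {n : WithTop ℕ∞} (hψ : ContDiffAt ℝ n ψ x) :
    ContDiffAt ℝ n (fun y => α.compContinuousAlternatingMap (ψ y)) x :=
  hψ.continuousLinearMap_comp
    (ContinuousLinearMap.compContinuousAlternatingMapCLM ℝ T F G (Fin p) α)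

omit [FiniteDimensional ℝ F] [FiniteDimensional ℝ G] in
theorem hat_extDeriv_comp (α : F →L[ℝ] G) {p : ℕ} {ψ : T → T [⋀^Fin p]→L[ℝ] F} {x : T}
    (hψ : DifferentiableAt ℝ ψ x) :
    hat (extDeriv (fun y => α.compContinuousAlternatingMap (ψ y)) x) =
      (α : F →ₗ[ℝ] G).lTensor _ (hat (extDeriv ψ x)) := by
  have h : ∀ v, fderiv ℝ (fun y => α.compContinuousAlternatingMap (ψ y)) x v =
      α.compContinuousAlternatingMap (fderiv ℝ ψ x v) := fun v =>
    congrArg (fun f => f v) (((ContinuousLinearMap.compContinuousAlternatingMapCLM ℝ T F G (Fin p)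
      α).hasFDerivAt.comp x hψ.hasFDerivAt).fderiv)
  rw [hat_extDeriv, hat_extDeriv, map_sum]
  refine Finset.sum_congr rfl fun j _ => ?_
  rw [h, hat_comp, ← LinearMap.baseChange_eq_ltensor, map_smul]

/-- The curvature `𝓕` of a doublet of forms on a vector space. -/
def locF (L : TwoTermLInfty V₀ V₁) (A : T → T [⋀^Fin 1]→L[ℝ] V₀) (B : T → T [⋀^Fin 2]→L[ℝ] V₁)
    (x : T) : T [⋀^Fin 2]→L[ℝ] V₀ :=
  extDeriv A x + (1 / 2 : ℝ) • wedge₂ L.br (A x) (A x)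
    - (LinearMap.toContinuousLinearMap L.α).compContinuousAlternatingMap (B x)

/-- The curvature `𝓗` of a doublet of forms on a vector space. -/
def locH (L : TwoTermLInfty V₀ V₁) (A : T → T [⋀^Fin 1]→L[ℝ] V₀) (B : T → T [⋀^Fin 2]→L[ℝ] V₁)
    (x : T) : T [⋀^Fin 3]→L[ℝ] V₁ :=
  extDeriv B x + wedge₂ L.act (A x) (B x) - (1 / 6 : ℝ) • wedge₃ L.jac (A x) (A x) (A x)

variable (L : TwoTermLInfty V₀ V₁) {A : T → T [⋀^Fin 1]→L[ℝ] V₀} {B : T → T [⋀^Fin 2]→L[ℝ] V₁}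
  {x : T}

omit [FiniteDimensional ℝ V₀] in
theorem hat_locF : hat (locF L A B x) = hat (extDeriv A x) +
    (1 / 2 : ℝ) • eBr L (hat (A x)) (hat (A x)) - eα L (hat (B x)) := by
  rw [locF, hat_sub, hat_add, hat_smul, hat_comp]
  exact congrArg₂ _ (congrArg₂ _ rfl (congrArg _ (hat_wedge₂ _ _ _))) rfl

omit [FiniteDimensional ℝ V₀] [FiniteDimensional ℝ V₁] in
theorem hat_locH : hat (locH L A B x) = hat (extDeriv B x) +
    eAct L (hat (A x)) (hat (B x)) - (1 / 6 : ℝ) • eJac L (hat (A x)) (hat (A x)) (hat (A x)) := by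
  rw [locH, hat_sub, hat_add, hat_smul]
  exact congrArg₂ _ (congrArg₂ _ rfl (hat_wedge₂ _ _ _)) (congrArg _ (hat_wedge₃ _ _ _ _))

theorem contDiffAt_locF (hA : ContDiffAt ℝ ∞ A x) (hB : ContDiffAt ℝ ∞ B x) :
    ContDiffAt ℝ ∞ (locF L A B) x :=
  ((contDiffAt_extDeriv hA).add ((contDiffAt_wedge₂ L.br hA hA).const_smul (1 / 2 : ℝ))).sub
    (contDiffAt_comp_alternating _ hB)

theorem contDiffAt_locH (hA : ContDiffAt ℝ ∞ A x) (hB : ContDiffAt ℝ ∞ B x) :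
    ContDiffAt ℝ ∞ (locH L A B) x := by
  have h1 : ContDiffAt ℝ ∞ (extDeriv B) x := contDiffAt_extDeriv hB
  have h2 : ContDiffAt ℝ ∞ (fun y => (wedge₂ L.act (A y) (B y) : T [⋀^Fin 3]→L[ℝ] V₁)) x :=
    contDiffAt_wedge₂ L.act hA hB
  have h3 : ContDiffAt ℝ ∞ (fun y => (wedge₃ L.jac (A y) (A y) (A y) : T [⋀^Fin 3]→L[ℝ] V₁)) x :=
    contDiffAt_wedge₃ L.jac hA
  exact (h1.add h2).sub (h3.const_smul (1 / 6 : ℝ))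

omit [FiniteDimensional ℝ T] [FiniteDimensional ℝ F] in
theorem extDeriv_extDeriv_of_contDiffAt {n : ℕ} {w : T → T [⋀^Fin n]→L[ℝ] F}
    (hw : ContDiffAt ℝ ∞ w x) : extDeriv (extDeriv w) x = 0 :=
  extDeriv_extDeriv_apply (hw.of_le le_rfl) (by simpa using (WithTop.coe_le_coe.2 le_top : ((2 : ℕ∞) : WithTop ℕ∞) ≤ (⊤ : ℕ∞)))

/-- Here ½ d[A,A] = -[A,dA] by `eBr_two_one`, and α([A,B]) = [A,α(B)]. The cubic terms -½[A,[A,A]]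
and ⅙ α([A,A,A]) cancel by `eBr_eBr`. -/
theorem hat_extDeriv_locF (hA : ContDiffAt ℝ ∞ A x) (hB : ContDiffAt ℝ ∞ B x) :
    hat (extDeriv (locF L A B) x) =
      -eBr L (hat (A x)) (hat (locF L A B x)) - eα L (hat (locH L A B x)) := by
  have dA := hA.differentiableAt (by simp)
  have dB := hB.differentiableAt (by simp)
  have h1 : DifferentiableAt ℝ (extDeriv A) x := (contDiffAt_extDeriv hA).differentiableAt (by simp)
  have h2 : DifferentiableAt ℝ (fun y => wedge₂ L.br (A y) (A y)) x :=
    (contDiffAt_wedge₂ L.br hA hA).differentiableAt (by simp)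
  have h3 : DifferentiableAt ℝ (fun y =>
      (LinearMap.toContinuousLinearMap L.α).compContinuousAlternatingMap (B y)) x :=
    (contDiffAt_comp_alternating _ hB).differentiableAt (by simp)
  have h4 : hat (extDeriv (fun y =>
      (LinearMap.toContinuousLinearMap L.α).compContinuousAlternatingMap (B y)) x) =
      eα L (hat (extDeriv B x)) := hat_extDeriv_comp _ dB
  have h5 : extDeriv (locF L A B) x = extDeriv (extDeriv A) x +
      (1 / 2 : ℝ) • extDeriv (fun y => wedge₂ L.br (A y) (A y)) x - extDeriv (fun y =>
      (LinearMap.toContinuousLinearMap L.α).compContinuousAlternatingMap (B y)) x := by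
    rw [← extDeriv_smul, ← extDeriv_add h1 (h2.const_smul _),
      ← extDeriv_sub (h1.add (h2.const_smul _)) h3]
    rfl
  rw [h5, hat_sub, hat_add, hat_smul, h4, extDeriv_extDeriv_of_contDiffAt hA, hat_zero,
    hat_locF, hat_locH]
  have h6 := hat_extDeriv_wedge₂ L.br dA dA
  rw [show hat (extDeriv (fun y => wedge₂ L.br (A y) (A y)) x) = _ from h6]
  obtain ⟨a, ha⟩ := exists_hat_one (A x)
  obtain ⟨c, hc⟩ := exists_hat_two (extDeriv A x)
  have e1 := eBr_two_one L a c
  have e2 := eBr_eBr (T := T) L a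
  have e3 := eα_eAct L (hat (A x)) (hat (B x))
  rw [← ha, ← hc] at e1
  rw [← ha] at e2
  simp only [eBr, eα, eAct, eJac] at *
  simp only [map_add, map_sub, map_smul, e1, e3, ← e2]
  module

/-- The three terms of d[A,A,A] coincide, which turns ⅙ into ½. The other terms are matched by
degree: quadratic in `B` by `eAct_eα`, quadratic in `A` and linear in `B` by `eAct_eAct`, quartic in
`A` by `eJac_eBr`. -/
theorem hat_extDeriv_locH (hA : ContDiffAt ℝ ∞ A x) (hB : ContDiffAt ℝ ∞ B x) :
    hat (extDeriv (locH L A B) x) =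
      -eAct L (hat (A x)) (hat (locH L A B x)) + eAct L (hat (locF L A B x)) (hat (B x)) -
        (1 / 2 : ℝ) • eJac L (hat (A x)) (hat (A x)) (hat (locF L A B x)) := by
  have dA := hA.differentiableAt (by simp)
  have dB := hB.differentiableAt (by simp)
  have h1 : DifferentiableAt ℝ (extDeriv B) x := (contDiffAt_extDeriv hB).differentiableAt (by simp)
  have h2 : DifferentiableAt ℝ (fun y => wedge₂ L.act (A y) (B y)) x :=
    (contDiffAt_wedge₂ L.act hA hB).differentiableAt (by simp)
  have h3 : DifferentiableAt ℝ (fun y => wedge₃ L.jac (A y) (A y) (A y)) x :=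
    (contDiffAt_wedge₃ L.jac hA).differentiableAt (by simp)
  have h5 : extDeriv (locH L A B) x = extDeriv (extDeriv B) x +
      extDeriv (fun y => wedge₂ L.act (A y) (B y)) x -
      (1 / 6 : ℝ) • extDeriv (fun y => wedge₃ L.jac (A y) (A y) (A y)) x := by
    rw [← extDeriv_smul, ← extDeriv_add h1 h2, ← extDeriv_sub (h1.add h2) (h3.const_smul _)]
    rfl
  rw [h5, hat_sub, hat_add, hat_smul, extDeriv_extDeriv_of_contDiffAt hB, hat_zero,
    hat_locF, hat_locH]
  rw [show hat (extDeriv (fun y => wedge₂ L.act (A y) (B y)) x) = _ from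
    hat_extDeriv_wedge₂ L.act dA dB,
    show hat (extDeriv (fun y => wedge₃ L.jac (A y) (A y) (A y)) x) = _ from
    hat_extDeriv_wedge₃ L.jac dA]
  obtain ⟨a, ha⟩ := exists_hat_one (A x)
  obtain ⟨b, hb⟩ := exists_hat_two (B x)
  obtain ⟨c, hc⟩ := exists_hat_two (extDeriv A x)
  have e1 := eJac_two_one_one L a c
  have e2 := eJac_one_two_one L a c
  have e3 := eAct_eα (T := T) L b
  have e4 := eAct_eAct (T := T) L a b
  have e5 := eJac_eBr (T := T) L a
  rw [← ha, ← hc] at e1 e2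
  rw [← hb] at e3
  rw [← ha, ← hb] at e4
  rw [← ha] at e5
  simp only [eBr, eα, eAct, eJac] at *
  simp only [map_add, map_sub, map_smul, LinearMap.add_apply, LinearMap.sub_apply,
    LinearMap.smul_apply, e1, e2, e3]
  -- The quartic terms are ⅙ [A,[A,A,A]] - ¼ [A,A,[A,A]], which is one twelfth of the two sides of
  -- `e5` subtracted.
  linear_combination (norm := module) (1 / 2 : ℝ) • e4 + (1 / 12 : ℝ) • e5

variable {r : ℕ} (P : InvariantForm L r)

/-- After the product rule each generator enters the slot that was differentiated, since the other
slots are central. There the sums reassemble to d𝓕 and d𝓗, and the Bianchi identities reduce the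
claim to `invariant_closed`. -/
theorem extDeriv_invariant {n : ℕ} (h : ∑ _i : Fin r, 2 + 3 = n) (hA : ContDiffAt ℝ ∞ A x)
    (hB : ContDiffAt ℝ ∞ B x) :
    extDeriv (fun y => wedgePair P.form (fun _ => ⟨2, locF L A B y⟩) (locH L A B y) h) x = 0 := by
  refine hat_injective ?_
  have hF := (contDiffAt_locF L hA hB).differentiableAt (by simp)
  have hH := (contDiffAt_locH L hA hB).differentiableAt (by simp)
  rw [hat_extDeriv, hat_zero]
  simp only [hat_fderiv_wedgePair P.form h hF hH, smul_add, Finset.smul_sum]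
  rw [← invariant_closed P (hat (A x)) (locF L A B x) (hat (B x)) (locH L A B x),
    ← hat_extDeriv_locF L hA hB, ← hat_extDeriv_locH L hA hB, hat_extDeriv, hat_extDeriv,
    Finset.sum_add_distrib, Finset.sum_comm]
  have hc := isCentralVec_hat (locF L A B x)
  congr 1
  · refine Finset.sum_congr rfl fun i _ => ?_
    simp only [smul_extP_update P.form hc, extP_update_sum, LinearMap.sum_apply]
  · simp only [smul_extP P.form hc, map_sum]

end Curvature

/-! ### Ordered products with a central factor -/

section ListProducts

variable {A : Type*} [Ring A]

theorem prod_ofFn_central {r : ℕ} (h : Fin (r + 1) → A) (i : Fin (r + 1))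
    (hc : ∀ b, Commute (h i) b) :
    (List.ofFn h).prod = h i * (List.ofFn fun l => h (i.succAbove l)).prod := by
  induction r with
  | zero =>
    rw [Fin.fin_one_eq_zero i]
    simp
  | succ r ih =>
    refine Fin.cases (fun hc => ?_) (fun i hc => ?_) i hc
    · rw [List.ofFn_succ, List.prod_cons]
      rfl
    · rw [List.ofFn_succ, List.prod_cons, ih (fun l => h l.succ) i hc, List.ofFn_succ,
        List.prod_cons, ← mul_assoc, ← (hc _).eq, mul_assoc]
      simp [Fin.succ_succAbove_succ]

/-- Pull the central factor to the front on both sides; the remaining factors are in the same order.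
-/
theorem prod_ofFn_swap {r : ℕ} (g h : Fin (r + 1) → A) (i : Fin r)
    (hgh : ∀ l, g l = h (Equiv.swap i.castSucc i.succ l)) (hc : ∀ b, Commute (h i.castSucc) b) :
    (List.ofFn g).prod = (List.ofFn h).prod := by
  have h1 : g i.succ = h i.castSucc := by rw [hgh, Equiv.swap_apply_right]
  rw [prod_ofFn_central h i.castSucc hc, prod_ofFn_central g i.succ (h1 ▸ hc), h1]
  congr 3
  funext l
  rw [hgh]
  congr 1
  by_cases hl : l = i
  · subst hl
    simp
  · rcases lt_or_gt_of_ne hl with hl | hl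
    · rw [Fin.succAbove_of_castSucc_lt i.castSucc l (by simpa using hl),
        Fin.succAbove_of_castSucc_lt i.succ l (Fin.castSucc_lt_succ_iff.2 hl.le)]
      refine Equiv.swap_apply_of_ne_of_ne (by simpa using hl.ne) (Fin.ne_of_lt ?_)
      exact Fin.castSucc_lt_succ_iff.2 hl.le
    · rw [Fin.succAbove_of_le_castSucc i.castSucc l (by simpa using hl.le),
        Fin.succAbove_of_le_castSucc i.succ l (Fin.succ_le_castSucc_iff.2 hl)]
      refine Equiv.swap_apply_of_ne_of_ne (Fin.ne_of_gt ?_) (by simpa using hl.ne')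
      exact Fin.castSucc_lt_succ_iff.2 hl.le

end ListProducts

/-! ### Iterated contraction of the invariant -/

section Contraction

variable {T : Type*} [NormedAddCommGroup T] [NormedSpace ℝ T]
  {F G : Type*} [AddCommGroup F] [Module ℝ F] [FiniteDimensional ℝ F]
  [AddCommGroup G] [Module ℝ G]

/-- Contraction in the exterior algebra with a tangent vector. -/
abbrev icontr (v : T) : ExtDual T →ₗ[ℝ] ExtDual T :=
  CliffordAlgebra.contractLeft (Module.Dual.eval ℝ T v)

/-- The grading involution of the exterior algebra. -/
abbrev grading (T : Type*) [NormedAddCommGroup T] [NormedSpace ℝ T] :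
    ExtDual T →ₐ[ℝ] ExtDual T :=
  CliffordAlgebra.involute

/-- The grading involution on exterior-algebra valued vectors. -/
def gradingVec : ExtDual T ⊗[ℝ] F →ₗ[ℝ] ExtDual T ⊗[ℝ] F :=
  (grading T).toLinearMap.rTensor F

theorem icontr_mul (v : T) (a b : ExtDual T) :
    icontr v (a * b) = icontr v a * b + grading T a * icontr v b := by
  induction a using CliffordAlgebra.left_induction with
  | algebraMap r => simp [CliffordAlgebra.contractLeft_algebraMap_mul]
  | add x y hx hy => simp only [add_mul, map_add, hx, hy]; abel
  | ι_mul x m hx =>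
    simp only [icontr] at hx ⊢
    rw [mul_assoc, CliffordAlgebra.contractLeft_ι_mul, hx, CliffordAlgebra.contractLeft_ι_mul,
      map_mul, grading, CliffordAlgebra.involute_ι]
    simp only [mul_add, sub_mul, smul_mul_assoc, neg_mul, mul_assoc]
    abel

theorem icontr_prod_ofFn (v : T) {r : ℕ} (h : Fin r → ExtDual T) :
    icontr v (List.ofFn h).prod = ∑ i, (List.ofFn fun l => if l < i then grading T (h l) else
      if l = i then icontr v (h l) else h l).prod := by
  induction r with
  | zero => simp [icontr, CliffordAlgebra.contractLeft_one]
  | succ r ih =>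
    rw [List.ofFn_succ, List.prod_cons, icontr_mul, ih, Fin.sum_univ_succ]
    congr 1
    · simp [List.ofFn_succ, Fin.succ_ne_zero]
    · rw [Finset.mul_sum]
      refine Finset.sum_congr rfl fun i _ => ?_
      rw [List.ofFn_succ, List.prod_cons]
      simp

theorem grading_prod_ofFn {r : ℕ} (h : Fin r → ExtDual T) :
    grading T (List.ofFn h).prod = (List.ofFn fun l => grading T (h l)).prod := by
  rw [map_list_prod, List.map_ofFn]
  rfl

theorem coeff_contr (v : T) (i : Fin (Module.finrank ℝ F)) (f : ExtDual T ⊗[ℝ] F) :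
    coeff _ i (contr v f) = icontr v (coeff _ i f) := by
  induction f with
  | zero => simp
  | add f g hf hg => simp only [map_add, hf, hg]
  | tmul a x => simp [contr]

theorem coeff_gradingVec (i : Fin (Module.finrank ℝ F)) (f : ExtDual T ⊗[ℝ] F) :
    coeff _ i (gradingVec f) = grading T (coeff _ i f) := by
  induction f with
  | zero => simp
  | add f g hf hg => simp only [map_add, hf, hg]
  | tmul a x => simp [gradingVec]

theorem contr_extP {r : ℕ} (P : MultilinearMap ℝ (fun _ : Fin r => F) (G →ₗ[ℝ] ℝ)) (v : T)
    (f : Fin r → ExtDual T ⊗[ℝ] F) (X : ExtDual T ⊗[ℝ] G) :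
    contr v (extP _ P f X) = ∑ i, extP _ P (fun l => if l < i then gradingVec (f l) else
      if l = i then contr v (f l) else f l) X + extP _ P (fun l => gradingVec (f l)) (contr v X) := by
  induction X with
  | zero => simp
  | add x y hx hy => simp only [map_add, hx, hy, Finset.sum_add_distrib]; abel
  | tmul b X =>
    have h1 : contr v (b ⊗ₜ[ℝ] X) = icontr v b ⊗ₜ X := rfl
    rw [h1]
    simp only [extP_tmul, map_sum]
    rw [Finset.sum_comm, ← Finset.sum_add_distrib]
    refine Finset.sum_congr rfl fun s _ => ?_
    have h2 : ∀ (a : ExtDual T) (c : ℝ), contr v (a ⊗ₜ[ℝ] c) = icontr v a ⊗ₜ c := fun _ _ => rfl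
    rw [h2, icontr_mul, icontr_prod_ofFn, grading_prod_ofFn, TensorProduct.add_tmul,
      Finset.sum_mul, TensorProduct.sum_tmul]
    simp only [apply_ite (coeff (ExtDual T) (s _)), coeff_contr, coeff_gradingVec]

/-- The extension of `P` to the arguments `a₀, …, a_{m-1}, f, …, f`. -/
def extSlots {r : ℕ} (P : MultilinearMap ℝ (fun _ : Fin r => F) (G →ₗ[ℝ] ℝ)) (m : ℕ)
    (a : ℕ → ExtDual T ⊗[ℝ] F) (f : ExtDual T ⊗[ℝ] F) : ExtDual T ⊗[ℝ] G →ₗ[ℝ] ExtDual T ⊗[ℝ] ℝ :=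
  extP _ P fun l => if (l : ℕ) < m then a l else f

/-- The exceptional argument moves left by adjacent transpositions. Each one passes a central `f`,
so the coefficients do not change, and the symmetry of `P` takes care of the basis vectors. -/
theorem extP_move {r : ℕ} (P : MultilinearMap ℝ (fun _ : Fin r => F) (G →ₗ[ℝ] ℝ))
    (hP : ∀ (v : Fin r → F) (i j : Fin r) (X : G), P (v ∘ Equiv.swap i j) X = P v X) (m : ℕ)
    (a : ℕ → ExtDual T ⊗[ℝ] F) {f : ExtDual T ⊗[ℝ] F} (hf : IsCentralVec f)
    (X : ExtDual T ⊗[ℝ] G) (i : ℕ) (hmi : m ≤ i) (hi : i < r) :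
    extP _ P (fun l => if (l : ℕ) < m then a l else if (l : ℕ) = i then a m else f) X =
      extSlots P (m + 1) a f X := by
  induction i, hmi using Nat.le_induction with
  | base =>
    rw [extSlots]
    congr 2
    funext l
    rcases lt_trichotomy (l : ℕ) m with h | h | h
    · simp [h, Nat.lt_succ_of_lt h]
    · simp [h]
    · simp [h.not_gt, h.ne', h.not_ge]
  | succ i hmi ih =>
    rw [← ih (by omega)]
    clear ih
    obtain ⟨r, rfl⟩ : ∃ r', r = r' + 1 := ⟨r - 1, by omega⟩
    have hi' : i < r := by omega
    let j : Fin r := ⟨i, hi'⟩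
    induction X with
    | zero => simp
    | add x y hx hy => simp only [map_add, hx, hy]
    | tmul b X =>
      simp only [extP_tmul]
      refine Fintype.sum_equiv (Equiv.arrowCongr (Equiv.swap j.castSucc j.succ) (Equiv.refl _))
        _ _ fun s => ?_
      have h1 : ∀ l, (Equiv.arrowCongr (Equiv.swap j.castSucc j.succ) (Equiv.refl _)) s l =
        s (Equiv.swap j.castSucc j.succ l) := fun l => by simp [Equiv.arrowCongr]
      congr 1
      · congr 1
        symm
        refine prod_ofFn_swap _ _ j (fun l => ?_) fun b => ?_
        · rw [h1]
          congr 1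
          rcases eq_or_ne l j.castSucc with rfl | hl
          · simp [j, hmi.not_gt, (Nat.le_succ_of_le hmi).not_gt]
          rcases eq_or_ne l j.succ with rfl | hl'
          · simp [j, hmi.not_gt, (Nat.le_succ_of_le hmi).not_gt]
          · rw [Equiv.swap_apply_of_ne_of_ne hl hl']
            have e1 : (l : ℕ) ≠ i := fun h => hl (Fin.ext h)
            have e2 : (l : ℕ) ≠ i + 1 := fun h => hl' (Fin.ext h)
            simp [e1, e2]
        · have : ((j.castSucc : Fin (r + 1)) : ℕ) = i := rfl
          simp only [this, hmi.not_gt, if_false, (Nat.lt_succ_self i).ne]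
          exact hf _ b
      · have := hP (fun l => Module.finBasis ℝ F (s l)) j.castSucc j.succ X
        rw [← this]
        congr 2

theorem extP_neg_slots {r : ℕ} (P : MultilinearMap ℝ (fun _ : Fin r => F) (G →ₗ[ℝ] ℝ)) {m : ℕ}
    (hm : m ≤ r) (g : Fin r → ExtDual T ⊗[ℝ] F) :
    extP _ P (fun l => if (l : ℕ) < m then -g l else g l) = (-1 : ℝ) ^ m • extP _ P g := by
  have h := (extM (ExtDual T) P).map_smul_univ (fun l => if (l : ℕ) < m then (-1 : ℝ) else 1) g
  have h2 : (∏ l : Fin r, if (l : ℕ) < m then (-1 : ℝ) else 1) = (-1) ^ m := by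
    rw [Finset.prod_ite, Finset.prod_const, Finset.prod_const_one, mul_one]
    congr 1
    rw [Fin.card_filter_val_lt]
    omega
  rw [h2] at h
  rw [extP, extP, ← map_smul, ← h]
  congr 2
  funext l
  split_ifs <;> simp

/-- The slots `a l` are annihilated, and each of the `r - m` slots `f` becomes `a m`, which is then
moved to position `m`. Passing the `m` odd slots gives the sign. -/
theorem contr_extSlots {r : ℕ} (P : MultilinearMap ℝ (fun _ : Fin r => F) (G →ₗ[ℝ] ℝ))
    (hP : ∀ (v : Fin r → F) (i j : Fin r) (X : G), P (v ∘ Equiv.swap i j) X = P v X) {m : ℕ}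
    (hm : m ≤ r) (a : ℕ → ExtDual T ⊗[ℝ] F) {f : ExtDual T ⊗[ℝ] F} (hf : IsCentralVec f)
    (hf' : gradingVec f = f) (ha : ∀ l < m, gradingVec (a l) = -a l) (v : T)
    (hva : ∀ l < m, contr v (a l) = 0) (hvf : contr v f = a m) (X : ExtDual T ⊗[ℝ] G) :
    contr v (extSlots P m a f X) = (-1 : ℝ) ^ m • (((r - m : ℕ) : ℝ) • extSlots P (m + 1) a f X +
      extSlots P m a f (contr v X)) := by
  rw [extSlots, contr_extP, smul_add]
  congr 1
  · have h1 : ∀ i : Fin r, extP _ P (fun l => if l < i then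
        gradingVec (if (l : ℕ) < m then a l else f) else if l = i then
        contr v (if (l : ℕ) < m then a l else f) else if (l : ℕ) < m then a l else f) X =
        if (i : ℕ) < m then 0 else (-1 : ℝ) ^ m • extSlots P (m + 1) a f X := fun i => by
      split_ifs with hi
      · rw [extP, (extM (ExtDual T) P).map_coord_zero i (by simp [hi, hva]), map_zero]
        rfl
      · rw [← extP_move P hP m a hf X i (not_lt.1 hi) i.2, ← LinearMap.smul_apply,
          ← extP_neg_slots P hm]
        congr 2
        funext l
        rcases lt_trichotomy l i with h | h | h
        · by_cases hl : (l : ℕ) < m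
          · simp [h, hl, ha l hl]
          · have : (l : ℕ) ≠ i := fun e => h.ne (Fin.ext e)
            simp [h, hl, hf', this]
        · subst h
          simp [hi, hvf]
        · have h2 : ¬ (l : ℕ) < m := by
            have : (i : ℕ) < l := h
            omega
          have : (l : ℕ) ≠ i := fun e => h.ne' (Fin.ext e)
          simp [h.not_gt, h.ne', h2, this]
    rw [Finset.sum_congr rfl fun i _ => h1 i, Finset.sum_ite, Finset.sum_const_zero, zero_add,
      Finset.sum_const, ← Nat.cast_smul_eq_nsmul ℝ]
    have h3 := Finset.card_filter_add_card_filter_not (s := (Finset.univ : Finset (Fin r)))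
      (fun i : Fin r => (i : ℕ) < m)
    rw [Fin.card_filter_val_lt, Finset.card_univ, Fintype.card_fin] at h3
    rw [show (Finset.univ.filter fun i : Fin r => ¬ (i : ℕ) < m).card = r - m by omega, smul_comm]
  · rw [← LinearMap.smul_apply, ← extP_neg_slots P hm]
    congr 2
    funext l
    split_ifs with h
    · exact ha l h
    · exact hf'

/-- The sequence `f` with its `i`-th term deleted. -/
def skip {X : Type*} (i : ℕ) (f : ℕ → X) (j : ℕ) : X := if j < i then f j else f (j + 1)

/-- The successive contractions with `v₀, …, v_{m-1}`. -/
def contrIter (v : ℕ → T) : ℕ → ExtDual T ⊗[ℝ] F →ₗ[ℝ] ExtDual T ⊗[ℝ] F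
  | 0 => LinearMap.id
  | m + 1 => contr (v m) ∘ₗ contrIter v m

/-- The sign relating the iterated contraction to the ordered product of contractions. -/
def contrSign : ℕ → ℝ
  | 0 => 1
  | m + 1 => contrSign m * (-1) ^ m

theorem contrSign_mul_self (m : ℕ) : contrSign m * contrSign m = 1 := by
  induction m with
  | zero => simp [contrSign]
  | succ m ih =>
    rw [contrSign, mul_mul_mul_comm, ih, one_mul, ← mul_pow]
    simp

/-- The algebraic form of the integrand of the Chern–Simons forms. -/
def transgression {r : ℕ} (P : MultilinearMap ℝ (fun _ : Fin r => F) (G →ₗ[ℝ] ℝ)) (m : ℕ)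
    (a : ℕ → ExtDual T ⊗[ℝ] F) (b : ℕ → ExtDual T ⊗[ℝ] G) (f : ExtDual T ⊗[ℝ] F)
    (X : ExtDual T ⊗[ℝ] G) : ExtDual T ⊗[ℝ] ℝ :=
  (r.descFactorial m : ℝ) • extSlots P m a f X + (r.descFactorial (m - 1) : ℝ) •
    ∑ i ∈ Finset.range m, (-1 : ℝ) ^ (m + 1 + i) • extSlots P (m - 1) (skip i a) f (b i)

/-- Each new contraction hits either a two-form slot, creating one more one-form and the next factor
of the falling factorial, or the last argument, creating a new summand with `b m`. The last argument
can be hit only once, because contraction annihilates the `b i`. -/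
theorem contrIter_extP {r : ℕ} (P : MultilinearMap ℝ (fun _ : Fin r => F) (G →ₗ[ℝ] ℝ))
    (hP : ∀ (v : Fin r → F) (i j : Fin r) (X : G), P (v ∘ Equiv.swap i j) X = P v X)
    (v : ℕ → T) (a : ℕ → ExtDual T ⊗[ℝ] F) (b : ℕ → ExtDual T ⊗[ℝ] G) {f : ExtDual T ⊗[ℝ] F}
    (hf : IsCentralVec f) (hf' : gradingVec f = f) (X : ExtDual T ⊗[ℝ] G) {m : ℕ} (hm : m ≤ r)
    (ha : ∀ l < m, gradingVec (a l) = -a l)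
    (hva : ∀ j < m, ∀ l < m, contr (v j) (a l) = 0) (hvb : ∀ j < m, ∀ l < m, contr (v j) (b l) = 0)
    (hvf : ∀ j < m, contr (v j) f = a j) (hvX : ∀ j < m, contr (v j) X = b j) :
    contrIter v m (extP _ P (fun _ => f) X) = contrSign m • transgression P m a b f X := by
  induction m with
  | zero => simp [contrIter, contrSign, transgression, extSlots]
  | succ m ih =>
    rw [contrIter, LinearMap.comp_apply, ih (by omega) (fun l hl => ha l (by omega))
      (fun j hj l hl => hva j (by omega) l (by omega))
      (fun j hj l hl => hvb j (by omega) l (by omega))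
      (fun j hj => hvf j (by omega)) (fun j hj => hvX j (by omega)), map_smul, contrSign, mul_smul]
    congr 1
    have h1 := contr_extSlots P hP (show m ≤ r by omega) a hf hf' (fun l hl => ha l (by omega)) (v m)
      (fun l hl => hva m (by omega) l (by omega)) (hvf m (by omega)) X
    have h2 : ∀ i ∈ Finset.range m, contr (v m) (extSlots P (m - 1) (skip i a) f (b i)) =
        (-1 : ℝ) ^ m • (-((r - (m - 1) : ℕ) : ℝ)) • extSlots P m (skip i a) f (b i) := by
      intro i hi
      obtain ⟨m, rfl⟩ : ∃ m', m = m' + 1 := ⟨m - 1, by have := Finset.mem_range.1 hi; omega⟩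
      have hi := Finset.mem_range.1 hi
      have h3 := contr_extSlots P hP (show m ≤ r by omega) (skip i a) hf hf' (fun l hl => by
        unfold skip; split_ifs <;> exact ha _ (by omega)) (v (m + 1))
        (fun l hl => by unfold skip; split_ifs <;> exact hva _ (by omega) _ (by omega))
        (by rw [hvf _ (by omega), skip, if_neg (by omega)]) (b i)
      rw [hvb _ (by omega) _ (by omega), map_zero, add_zero] at h3
      rw [Nat.add_sub_cancel, h3, pow_succ]
      module
    -- Only the first `m` entries matter here, so omitting entry `m` changes nothing; this
    -- identifies the new summand.
    have h4 : extSlots P m (skip m a) f = extSlots P m a f := by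
      unfold extSlots
      congr 1
      funext l
      split_ifs with h
      · rw [skip, if_pos h]
      · rfl
    rw [transgression, map_add, map_smul, map_smul, map_sum, h1, hvX m (by omega), transgression,
      Finset.sum_range_succ, Nat.add_sub_cancel, h4, Nat.descFactorial_succ]
    rw [Finset.sum_congr rfl fun i hi => by rw [map_smul, h2 i hi]]
    have h5 : ∀ i ∈ Finset.range m, ((-1 : ℝ) ^ (m + 1 + 1 + i) • extSlots P m (skip i a) f (b i)) =
        -((-1 : ℝ) ^ (m + 1 + i) • extSlots P m (skip i a) f (b i)) := fun i _ => by
      rw [show m + 1 + 1 + i = (m + 1 + i) + 1 by ring, pow_succ]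
      module
    rw [Finset.sum_congr rfl h5, Finset.sum_neg_distrib]
    have h6 : (-1 : ℝ) ^ (m + 1 + 1 + m) = 1 := by
      rw [show m + 1 + 1 + m = 2 * (m + 1) by ring, pow_mul]
      simp
    rw [h6]
    -- The sum is empty for `m = 0`, where `m - 1` is truncated; otherwise the number of remaining
    -- slots completes the falling factorial.
    have h7 : (r.descFactorial (m - 1) : ℝ) • ∑ i ∈ Finset.range m, (-1 : ℝ) ^ (m + 1 + i) •
        (-1 : ℝ) ^ m • (-((r - (m - 1) : ℕ) : ℝ)) • extSlots P m (skip i a) f (b i) =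
        (-1 : ℝ) ^ m • -((r.descFactorial m : ℝ) • ∑ i ∈ Finset.range m, (-1 : ℝ) ^ (m + 1 + i) •
          extSlots P m (skip i a) f (b i)) := by
      rcases m with _ | m
      · simp
      · rw [Nat.descFactorial_succ, Nat.add_sub_cancel, Finset.smul_sum, Finset.smul_sum,
          ← Finset.sum_neg_distrib, Finset.smul_sum]
        refine Finset.sum_congr rfl fun i _ => ?_
        push_cast
        module
    rw [h7]
    push_cast
    module

omit [FiniteDimensional ℝ F] in
theorem evalExt_contrIter (v u : ℕ → T) (m n : ℕ) (x : ExtDual T ⊗[ℝ] F) :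
    evalExt (m + n) (fun i => if i < m then v i else u (i - m)) x =
      evalExt n u (contrIter v m x) := by
  induction m generalizing n u with
  | zero => simp [contrIter]
  | succ m ih =>
    have h := ih (fun i => if i = 0 then v m else u (i - 1)) (n + 1)
    rw [evalExt, LinearMap.comp_apply] at h
    simp only [Nat.add_eq_zero_iff, one_ne_zero, and_false, if_false, if_true,
      Nat.add_sub_cancel] at h
    rw [contrIter, LinearMap.comp_apply, ← h, Nat.add_right_comm m 1 n, Nat.add_assoc m n 1]
    congr 2
    funext i
    rcases lt_trichotomy i m with h | h | h
    · simp [h, Nat.lt_succ_of_lt h]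
    · simp [h]
    · rw [if_neg (by omega), if_neg (by omega), if_neg (by omega)]
      congr 1

end Contraction

/-! ### Wedge products commute with pull-back -/

section Pullback

variable {T S : Type*} [NormedAddCommGroup T] [NormedSpace ℝ T] [FiniteDimensional ℝ T]
  [NormedAddCommGroup S] [NormedSpace ℝ S] [FiniteDimensional ℝ S]
  {F G H : Type*} [NormedAddCommGroup F] [NormedSpace ℝ F]
  [NormedAddCommGroup G] [NormedSpace ℝ G] [NormedAddCommGroup H] [NormedSpace ℝ H]

theorem alternate_comp {ι : Type*} {n : ℕ} (N : ℕ) (e : ι ≃ Fin n)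
    (m : MultilinearMap ℝ (fun _ : ι => T) H) (f : S →L[ℝ] T) :
    (alternate N e m).compContinuousLinearMap f =
      alternate N e (m.compLinearMap fun _ => (f : S →ₗ[ℝ] T)) := by
  ext v
  simp only [alternate, ContinuousAlternatingMap.compContinuousLinearMap_apply,
    ContinuousAlternatingMap.smul_apply, ContinuousMultilinearMap.alternatization_apply_apply]
  rfl

theorem wedge₂_comp (μ : F →ₗ[ℝ] G →ₗ[ℝ] H) {p q : ℕ} (ψ : T [⋀^Fin p]→L[ℝ] F)
    (θ : T [⋀^Fin q]→L[ℝ] G) (f : S →L[ℝ] T) :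
    (wedge₂ μ ψ θ).compContinuousLinearMap f =
      wedge₂ μ (ψ.compContinuousLinearMap f) (θ.compContinuousLinearMap f) :=
  alternate_comp _ _ _ _

theorem wedge₃_comp (μ : F →ₗ[ℝ] F →ₗ[ℝ] F →ₗ[ℝ] H) {p q s : ℕ} (ψ₁ : T [⋀^Fin p]→L[ℝ] F)
    (ψ₂ : T [⋀^Fin q]→L[ℝ] F) (ψ₃ : T [⋀^Fin s]→L[ℝ] F) (f : S →L[ℝ] T) :
    (wedge₃ μ ψ₁ ψ₂ ψ₃).compContinuousLinearMap f =
      wedge₃ μ (ψ₁.compContinuousLinearMap f) (ψ₂.compContinuousLinearMap f)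
        (ψ₃.compContinuousLinearMap f) :=
  alternate_comp _ _ _ _

theorem wedgePair_comp {r : ℕ} (P : MultilinearMap ℝ (fun _ : Fin r => F) (G →ₗ[ℝ] ℝ))
    (ψ : Fin r → Σ d : ℕ, T [⋀^Fin d]→L[ℝ] F) {q : ℕ} (θ : T [⋀^Fin q]→L[ℝ] G)
    {n : ℕ} (h : ∑ i, (ψ i).1 + q = n) (f : S →L[ℝ] T) :
    (wedgePair P ψ θ h).compContinuousLinearMap f =
      wedgePair P (fun i => ⟨(ψ i).1, (ψ i).2.compContinuousLinearMap f⟩)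
        (θ.compContinuousLinearMap f) h :=
  alternate_comp _ _ _ _

omit [FiniteDimensional ℝ T] in
theorem slots_of_lt {r m : ℕ} (a : Fin m → T [⋀^Fin 1]→L[ℝ] F) (w : T [⋀^Fin 2]→L[ℝ] F)
    {i : Fin r} (h : (i : ℕ) < m) : slots r a w i = ⟨1, a ⟨i, h⟩⟩ := dif_pos h

omit [FiniteDimensional ℝ T] in
theorem slots_of_not_lt {r m : ℕ} (a : Fin m → T [⋀^Fin 1]→L[ℝ] F) (w : T [⋀^Fin 2]→L[ℝ] F)
    {i : Fin r} (h : ¬(i : ℕ) < m) : slots r a w i = ⟨2, w⟩ := dif_neg h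

omit [FiniteDimensional ℝ T] [FiniteDimensional ℝ S] in
theorem slots_comp (r : ℕ) {m : ℕ} (a : Fin m → T [⋀^Fin 1]→L[ℝ] F) (w : T [⋀^Fin 2]→L[ℝ] F)
    (f : S →L[ℝ] T) :
    (fun i => (⟨(slots r a w i).1, (slots r a w i).2.compContinuousLinearMap f⟩ :
      Σ d : ℕ, S [⋀^Fin d]→L[ℝ] F)) =
      slots r (fun j => (a j).compContinuousLinearMap f) (w.compContinuousLinearMap f) := by
  funext i
  by_cases h : (i : ℕ) < m
  · rw [slots_of_lt a w h, slots_of_lt _ _ h]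
  · rw [slots_of_not_lt a w h, slots_of_not_lt _ _ h]

theorem wedgePair_congr {r : ℕ} (P : MultilinearMap ℝ (fun _ : Fin r => F) (G →ₗ[ℝ] ℝ))
    {ψ ψ' : Fin r → Σ d : ℕ, T [⋀^Fin d]→L[ℝ] F} (hψ : ψ = ψ') {q : ℕ}
    {θ θ' : T [⋀^Fin q]→L[ℝ] G} (hθ : θ = θ') {n : ℕ} (h : ∑ i, (ψ i).1 + q = n)
    (h' : ∑ i, (ψ' i).1 + q = n) : wedgePair P ψ θ h = wedgePair P ψ' θ' h' := by
  subst hψ hθ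
  rfl

end Pullback

/-! ### The Chern–Simons integrand at a point -/

section ChernSimonsForm

variable {T S : Type*} [NormedAddCommGroup T] [NormedSpace ℝ T] [FiniteDimensional ℝ T]
  [NormedAddCommGroup S] [NormedSpace ℝ S] [FiniteDimensional ℝ S]
  {V₀ V₁ : Type*} [NormedAddCommGroup V₀] [NormedSpace ℝ V₀]
  [NormedAddCommGroup V₁] [NormedSpace ℝ V₁]
  {L : TwoTermLInfty V₀ V₁} {r : ℕ} (P : InvariantForm L r)

/-- The integrand of the Chern–Simons forms, as a function of the forms that occur in it. -/
def csForm {k : ℕ} (hk : k ≤ r) {n : ℕ} (hn : n + k = 2 * r + 3)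
    (a : Fin k → T [⋀^Fin 1]→L[ℝ] V₀) (b : Fin k → T [⋀^Fin 2]→L[ℝ] V₁)
    (f : T [⋀^Fin 2]→L[ℝ] V₀) (h : T [⋀^Fin 3]→L[ℝ] V₁) : T [⋀^Fin n]→L[ℝ] ℝ :=
  ((r.factorial : ℝ) / ((r - k).factorial : ℝ)) •
    wedgePair P.form (slots r a f) h (by have := slots_degree r a f hk; omega) +
  ((r.factorial : ℝ) / ((r - k + 1).factorial : ℝ) * (-1) ^ k) •
    ∑ i : Fin k, (-1 : ℝ) ^ ((i : ℕ) + 1) •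
      wedgePair P.form (slots r (omitAt a i) f) (b i) (by
        have := slots_degree r (omitAt a i) f (by omega)
        have := i.isLt
        omega)

theorem csForm_comp {k : ℕ} (hk : k ≤ r) {n : ℕ} (hn : n + k = 2 * r + 3)
    (a : Fin k → T [⋀^Fin 1]→L[ℝ] V₀) (b : Fin k → T [⋀^Fin 2]→L[ℝ] V₁)
    (f : T [⋀^Fin 2]→L[ℝ] V₀) (h : T [⋀^Fin 3]→L[ℝ] V₁) (g : S →L[ℝ] T) :
    (csForm P hk hn a b f h).compContinuousLinearMap g =
      csForm P hk hn (fun j => (a j).compContinuousLinearMap g)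
        (fun j => (b j).compContinuousLinearMap g) (f.compContinuousLinearMap g)
        (h.compContinuousLinearMap g) := by
  have hadd : ∀ ψ θ : T [⋀^Fin n]→L[ℝ] ℝ, (ψ + θ).compContinuousLinearMap g =
    ψ.compContinuousLinearMap g + θ.compContinuousLinearMap g := fun _ _ => rfl
  have hsmul : ∀ (c : ℝ) (ψ : T [⋀^Fin n]→L[ℝ] ℝ), (c • ψ).compContinuousLinearMap g =
    c • ψ.compContinuousLinearMap g := fun _ _ => rfl
  have hsum : ∀ ψ : Fin k → T [⋀^Fin n]→L[ℝ] ℝ, (∑ i, ψ i).compContinuousLinearMap g =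
    ∑ i, (ψ i).compContinuousLinearMap g := fun ψ => by
      ext v
      simp
  rw [csForm, csForm, hadd, hsmul, hsmul, hsum]
  simp only [hsmul]
  congr 2
  · rw [wedgePair_comp]
    exact wedgePair_congr _ (slots_comp _ _ _ _) rfl _ _
  · refine Finset.sum_congr rfl fun i _ => ?_
    rw [wedgePair_comp]
    congr 1
    exact wedgePair_congr _ (slots_comp _ _ _ _) rfl _ _

theorem hat_csForm [FiniteDimensional ℝ V₀] {k : ℕ} (hk : k ≤ r) {n : ℕ} (hn : n + k = 2 * r + 3)
    (a : Fin k → T [⋀^Fin 1]→L[ℝ] V₀) (b : Fin k → T [⋀^Fin 2]→L[ℝ] V₁)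
    (f : T [⋀^Fin 2]→L[ℝ] V₀) (h : T [⋀^Fin 3]→L[ℝ] V₁) {a' : ℕ → ExtDual T ⊗[ℝ] V₀}
    {b' : ℕ → ExtDual T ⊗[ℝ] V₁} (ha : ∀ j : Fin k, a' j = hat (a j))
    (hb : ∀ j : Fin k, b' j = hat (b j)) :
    hat (csForm P hk hn a b f h) = transgression P.form k a' b' (hat f) (hat h) := by
  rw [csForm, transgression, hat_add, hat_smul, hat_smul, hat_sum, Finset.sum_range]
  congr 1
  · have h1 : (r.factorial : ℝ) / ((r - k).factorial : ℝ) = r.descFactorial k := by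
      rw [← Nat.factorial_mul_descFactorial hk]
      have := Nat.factorial_ne_zero (r - k)
      push_cast
      field_simp
    rw [h1, hat_wedgePair]
    congr 2
    unfold extSlots extP
    congr 2
    funext l
    split_ifs with hl
    · rw [slots_of_lt a f hl]
      exact (ha ⟨l, hl⟩).symm
    · rw [slots_of_not_lt a f hl]
  -- For `k = 0` the coefficient `r! / (r + 1)!` is not a falling factorial, but the sum that it
  -- multiplies is empty.
  · rcases k with _ | k
    · simp
    have h1 : (r.factorial : ℝ) / ((r - (k + 1) + 1).factorial : ℝ) =
        r.descFactorial (k + 1 - 1) := by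
      change _ = ((r.descFactorial k : ℕ) : ℝ)
      rw [← Nat.factorial_mul_descFactorial (show k ≤ r by omega),
        show r - (k + 1) + 1 = r - k by omega]
      have := Nat.factorial_ne_zero (r - k)
      push_cast
      field_simp
    rw [h1, mul_smul, Finset.smul_sum]
    congr 1
    refine Finset.sum_congr rfl fun i _ => ?_
    rw [hat_smul, smul_smul, ← pow_add, show k + 1 + (↑i + 1) = k + 1 + 1 + i by ring, hat_wedgePair,
      hb i]
    congr 1
    unfold extSlots extP
    congr 3
    funext l
    split_ifs with hl
    · rw [slots_of_lt _ _ hl]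
      unfold omitAt skip
      simp only
      split_ifs with hi
      · exact (ha ⟨l, _⟩).symm
      · exact (ha ⟨l + 1, _⟩).symm
    · rw [slots_of_not_lt _ _ hl]

end ChernSimonsForm

/-! ### Contraction of horizontal forms and their derivatives -/

section MoreContraction

variable {T : Type*} [NormedAddCommGroup T] [NormedSpace ℝ T]

theorem contr_ext₂_eq_zero {F G H : Type*} [AddCommGroup F] [Module ℝ F] [AddCommGroup G]
    [Module ℝ G] [AddCommGroup H] [Module ℝ H] (μ : F →ₗ[ℝ] G →ₗ[ℝ] H) (v : T) {x : ExtDual T ⊗[ℝ] F}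
    {y : ExtDual T ⊗[ℝ] G} (hx : contr v x = 0) (hy : contr v y = 0) :
    contr v (ext₂ _ μ x y) = 0 := by
  have h : ∀ (x : ExtDual T ⊗[ℝ] F) (y : ExtDual T ⊗[ℝ] G), contr v (ext₂ _ μ x y) =
      ext₂ _ μ (contr v x) y + ext₂ _ μ (gradingVec x) (contr v y) := by
    intro x y
    induction x with
    | zero => simp
    | add x x' h h' => simp only [map_add, LinearMap.add_apply, h, h']; abel
    | tmul a x =>
      induction y with
      | zero => simp
      | add y y' h h' => simp only [map_add, h, h']; abel
      | tmul b y =>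
        have h1 : ∀ {K : Type _} [AddCommGroup K] [Module ℝ K] (a : ExtDual T) (z : K),
          contr v (a ⊗ₜ[ℝ] z) = icontr v a ⊗ₜ z := fun _ _ => rfl
        have h2 : gradingVec (a ⊗ₜ[ℝ] x) = grading T a ⊗ₜ x := rfl
        rw [ext₂_tmul, h1, h2]
        change _ = ext₂ _ μ (icontr v a ⊗ₜ x) (b ⊗ₜ y) +
          ext₂ _ μ (grading T a ⊗ₜ x) (icontr v b ⊗ₜ y)
        rw [ext₂_tmul, ext₂_tmul, icontr_mul, TensorProduct.add_tmul]
  rw [h, hx, hy]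
  simp

variable {F G : Type*} [NormedAddCommGroup F] [NormedSpace ℝ F]
  [NormedAddCommGroup G] [NormedSpace ℝ G]

theorem contr_lTensor (α : F →ₗ[ℝ] G) (v : T) (x : ExtDual T ⊗[ℝ] F) :
    contr v (α.lTensor _ x) = α.lTensor _ (contr v x) := by
  induction x with
  | zero => simp
  | add x x' h h' => simp only [map_add, h, h']
  | tmul a x => rfl

variable [FiniteDimensional ℝ T]

theorem gradingVec_hat {n : ℕ} (ψ : T [⋀^Fin n]→L[ℝ] F) :
    gradingVec (hat ψ) = (-1 : ℝ) ^ n • hat ψ := by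
  rw [hat_eq_antiSum, antiSum, map_sum, Finset.smul_sum]
  refine Finset.sum_congr rfl fun s _ => ?_
  have h : ∀ a : ExtDual T, ∀ x : F, gradingVec (a ⊗ₜ[ℝ] x) = grading T a ⊗ₜ x := fun _ _ => rfl
  rw [h, TensorProduct.smul_tmul']
  congr 1
  rw [ExteriorAlgebra.ιMulti_apply]
  have h3 := CliffordAlgebra.involute_prod_map_ι (Q := (0 : QuadraticForm ℝ (Module.Dual ℝ T)))
    (List.ofFn fun i => (Module.finBasis ℝ T).coord (s i))
  rw [List.map_ofFn, List.length_ofFn] at h3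
  exact h3

theorem gradingVec_hat_one (ψ : T [⋀^Fin 1]→L[ℝ] F) : gradingVec (hat ψ) = -hat ψ := by
  rw [gradingVec_hat, pow_one]
  module

theorem contr_hat_comp_eq_zero {S : Type*} [NormedAddCommGroup S] [NormedSpace ℝ S] {n : ℕ}
    (ψ : S [⋀^Fin (n + 1)]→L[ℝ] F) (f : T →L[ℝ] S) {v : T} (hv : f v = 0) :
    contr v (hat (ψ.compContinuousLinearMap f)) = 0 := by
  rw [← hat_zero (T := T) (F := F) (n := n)]
  refine contr_hat v _ 0 fun u => ?_
  symm
  exact ψ.map_coord_zero 0 (by simpa using hv)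

/-- Cartan's formula for a form that vanishes on the constant vector field `v`. -/
theorem contr_hat_extDeriv {n : ℕ} {w : T → T [⋀^Fin n]→L[ℝ] F} {x v : T}
    (hw : DifferentiableAt ℝ w x) (hv : ∀ y (u : Fin n → T) (i : Fin n), u i = v → w y u = 0) :
    contr v (hat (extDeriv w x)) = hat (fderiv ℝ w x v) := by
  refine contr_hat v _ _ fun u => ?_
  rw [extDeriv_apply hw, Fin.sum_univ_succ, Finset.sum_eq_zero, add_zero]
  · simp only [Fin.val_zero, pow_zero, one_smul]
    have h1 : (fun y => w y (Fin.removeNth 0 (Matrix.vecCons v u))) = fun y => w y u := by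
      funext y
      congr 1
    rw [h1]
    have h2 := (ContinuousAlternatingMap.apply ℝ T F u).hasFDerivAt.comp x hw.hasFDerivAt
    exact congrArg (fun g => g v) h2.fderiv.symm
  · intro i _
    rcases n with _ | n
    · exact i.elim0
    -- Removing an argument other than the first leaves `v` among the arguments, where the form
    -- vanishes identically.
    have h1 : (fun y => w y (Fin.removeNth i.succ (Matrix.vecCons v u))) = fun _ => 0 := by
      funext y
      exact hv y _ 0 (by simp [Fin.removeNth])
    rw [h1]
    simp

end MoreContraction

/-! ### The universal doublet on the product with the parameter space -/

section UniversalConnection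

variable {E : Type*} [NormedAddCommGroup E] [NormedSpace ℝ E] {K : ℕ}
  {F : Type*} [NormedAddCommGroup F] [NormedSpace ℝ F]
  {V₀ V₁ : Type*} [NormedAddCommGroup V₀] [NormedSpace ℝ V₀] [FiniteDimensional ℝ V₀]
  [NormedAddCommGroup V₁] [NormedSpace ℝ V₁] [FiniteDimensional ℝ V₁]

/-- The affine combination `w₀ + ∑ tᵢ (wᵢ - w₀)` of forms. -/
def affineForm {n : ℕ} (w : Fin (K + 1) → E → E [⋀^Fin n]→L[ℝ] F) (t : Fin K → ℝ) (y : E) :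
    E [⋀^Fin n]→L[ℝ] F :=
  w 0 y + ∑ i, t i • (w i.succ y - w 0 y)

/-- The form on `E × ℝᴷ` which restricts to `affineForm w t` on `E × {t}` and vanishes on `ℝᴷ`. -/
def univForm {n : ℕ} (w : Fin (K + 1) → E → E [⋀^Fin n]→L[ℝ] F) (p : E × (Fin K → ℝ)) :
    (E × (Fin K → ℝ)) [⋀^Fin n]→L[ℝ] F :=
  (affineForm w p.2 p.1).compContinuousLinearMap (ContinuousLinearMap.fst ℝ E (Fin K → ℝ))

/-- The combination `∑ τᵢ (wᵢ - w₀)` of differences of forms. -/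
def diffForm {n : ℕ} (w : Fin (K + 1) → E → E [⋀^Fin n]→L[ℝ] F) (τ : Fin K → ℝ) (y : E) :
    E [⋀^Fin n]→L[ℝ] F :=
  ∑ i, τ i • (w i.succ y - w 0 y)

theorem contDiffAt_univForm {n : ℕ} {w : Fin (K + 1) → E → E [⋀^Fin n]→L[ℝ] F}
    {p : E × (Fin K → ℝ)} (hw : ∀ i, ContDiffAt ℝ ∞ (w i) p.1) : ContDiffAt ℝ ∞ (univForm w) p := by
  have h1 : ∀ i, ContDiffAt ℝ ∞ (fun q : E × (Fin K → ℝ) => w i q.1) p := fun i =>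
    (hw i).comp p contDiffAt_fst
  have h2 : ∀ i, ContDiffAt ℝ ∞ (fun q : E × (Fin K → ℝ) => q.2 i) p := fun i =>
    contDiffAt_pi.1 contDiffAt_snd i
  have h3 : ContDiffAt ℝ ∞ (fun q : E × (Fin K → ℝ) => affineForm w q.2 q.1) p :=
    (h1 0).add (ContDiffAt.sum fun i _ => (h2 i).smul ((h1 i.succ).sub (h1 0)))
  exact h3.continuousLinearMap_comp
    (ContinuousAlternatingMap.compContinuousLinearMapCLM (ContinuousLinearMap.fst ℝ E (Fin K → ℝ)))

/-- In the parameter directions the form is affine, with slope given by the differences of the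
doublets. -/
theorem fderiv_univForm_vertical {n : ℕ} {w : Fin (K + 1) → E → E [⋀^Fin n]→L[ℝ] F}
    {p : E × (Fin K → ℝ)} (hw : ∀ i, ContDiffAt ℝ ∞ (w i) p.1) (τ : Fin K → ℝ) :
    fderiv ℝ (univForm w) p (0, τ) =
      (diffForm w τ p.1).compContinuousLinearMap (ContinuousLinearMap.fst ℝ E (Fin K → ℝ)) := by
  let R : (E [⋀^Fin n]→L[ℝ] F) →L[ℝ] ((E × (Fin K → ℝ)) [⋀^Fin n]→L[ℝ] F) :=
    ContinuousAlternatingMap.compContinuousLinearMapCLM (ContinuousLinearMap.fst ℝ E (Fin K → ℝ))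
  let Λ : (Fin K → ℝ) →L[ℝ] (E [⋀^Fin n]→L[ℝ] F) :=
    ∑ i, (ContinuousLinearMap.proj (R := ℝ) (φ := fun _ : Fin K => ℝ) i).smulRight
      (w i.succ p.1 - w 0 p.1)
  have h1 : HasFDerivAt (fun s : Fin K → ℝ => w 0 p.1 + Λ s) Λ p.2 := Λ.hasFDerivAt.const_add _
  have h2 : HasFDerivAt (fun s : Fin K → ℝ => R (w 0 p.1 + Λ s)) (R ∘L Λ) p.2 :=
    R.hasFDerivAt.comp p.2 h1
  have h3 : (fun s : Fin K → ℝ => R (w 0 p.1 + Λ s)) = fun s => univForm w (p.1, s) := by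
    funext s
    change R _ = R _
    simp [Λ, affineForm]
  have h4 : HasFDerivAt (fun s : Fin K → ℝ => (p.1, s)) (ContinuousLinearMap.inr ℝ E (Fin K → ℝ)) p.2 :=
    hasFDerivAt_prodMk_right p.1 p.2
  have h5 : HasFDerivAt (univForm w) (fderiv ℝ (univForm w) p) (p.1, p.2) :=
    ((contDiffAt_univForm hw).differentiableAt (by simp)).hasFDerivAt
  have h6 := h5.comp p.2 h4
  rw [h3] at h2
  have h7 := congrArg (fun g => g τ) (h6.unique h2)
  refine h7.trans ?_
  change R _ = R _
  simp [Λ, diffForm]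

theorem univForm_comp_inl {n : ℕ} (w : Fin (K + 1) → E → E [⋀^Fin n]→L[ℝ] F)
    (p : E × (Fin K → ℝ)) : (univForm w p).compContinuousLinearMap
      (ContinuousLinearMap.inl ℝ E (Fin K → ℝ)) = affineForm w p.2 p.1 := by
  ext v
  rfl

/-- The exterior derivative commutes with pull-back along the slice `y ↦ (y, t)`. -/
theorem extDeriv_univForm_comp_inl {n : ℕ} {w : Fin (K + 1) → E → E [⋀^Fin n]→L[ℝ] F}
    {p : E × (Fin K → ℝ)} (hw : ∀ i, ContDiffAt ℝ ∞ (w i) p.1) :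
    (extDeriv (univForm w) p).compContinuousLinearMap (ContinuousLinearMap.inl ℝ E (Fin K → ℝ)) =
      extDeriv (affineForm w p.2) p.1 := by
  have h1 : ∀ y, HasFDerivAt (fun y : E => (y, p.2)) (ContinuousLinearMap.inl ℝ E (Fin K → ℝ)) y :=
    fun y => hasFDerivAt_prodMk_left y p.2
  have h2 : DifferentiableAt ℝ (univForm w) ((fun y : E => (y, p.2)) p.1) :=
    (contDiffAt_univForm (p := (p.1, p.2)) hw).differentiableAt (by simp)
  have h3 : ContDiffAt ℝ ∞ (fun y : E => (y, p.2)) p.1 := by fun_prop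
  have h4 := extDeriv_pullback (f := fun y : E => (y, p.2)) (x := p.1) h2 h3
    (by simpa using (WithTop.coe_le_coe.2 le_top : ((2 : ℕ∞) : WithTop ℕ∞) ≤ (⊤ : ℕ∞)))
  simp only [(h1 _).fderiv, univForm_comp_inl] at h4
  exact h4.symm

variable [FiniteDimensional ℝ E] (L : TwoTermLInfty V₀ V₁)
  {a : Fin (K + 1) → E → E [⋀^Fin 1]→L[ℝ] V₀} {b : Fin (K + 1) → E → E [⋀^Fin 2]→L[ℝ] V₁}
  {p : E × (Fin K → ℝ)}

omit [FiniteDimensional ℝ V₀] in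
theorem locF_univForm_comp_inl (ha : ∀ i, ContDiffAt ℝ ∞ (a i) p.1) :
    (locF L (univForm a) (univForm b) p).compContinuousLinearMap
      (ContinuousLinearMap.inl ℝ E (Fin K → ℝ)) =
      locF L (affineForm a p.2) (affineForm b p.2) p.1 := by
  rw [locF, locF, ← extDeriv_univForm_comp_inl ha, ← univForm_comp_inl a, ← univForm_comp_inl b,
    ← wedge₂_comp]
  rfl

omit [FiniteDimensional ℝ V₀] [FiniteDimensional ℝ V₁] in
theorem locH_univForm_comp_inl (hb : ∀ i, ContDiffAt ℝ ∞ (b i) p.1) :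
    (locH L (univForm a) (univForm b) p).compContinuousLinearMap
      (ContinuousLinearMap.inl ℝ E (Fin K → ℝ)) =
      locH L (affineForm a p.2) (affineForm b p.2) p.1 := by
  rw [locH, locH, ← extDeriv_univForm_comp_inl hb, ← univForm_comp_inl a, ← univForm_comp_inl b,
    ← wedge₂_comp, ← wedge₃_comp]
  rfl

theorem contr_hat_univForm {n : ℕ} (w : Fin (K + 1) → E → E [⋀^Fin (n + 1)]→L[ℝ] F)
    (τ : Fin K → ℝ) : contr ((0, τ) : E × (Fin K → ℝ)) (hat (univForm w p)) = 0 :=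
  contr_hat_comp_eq_zero _ _ rfl

theorem contr_hat_extDeriv_univForm {n : ℕ} {w : Fin (K + 1) → E → E [⋀^Fin n]→L[ℝ] F}
    (hw : ∀ i, ContDiffAt ℝ ∞ (w i) p.1) (τ : Fin K → ℝ) :
    contr ((0, τ) : E × (Fin K → ℝ)) (hat (extDeriv (univForm w) p)) =
      hat ((diffForm w τ p.1).compContinuousLinearMap
        (ContinuousLinearMap.fst ℝ E (Fin K → ℝ))) := by
  rw [contr_hat_extDeriv ((contDiffAt_univForm hw).differentiableAt (by simp)),
    fderiv_univForm_vertical hw]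
  intro y u i hu
  exact (affineForm w y.2 y.1).map_coord_zero i (by simp [hu])

omit [FiniteDimensional ℝ V₀] in
-- The terms without a derivative are horizontal, so only `dA` has a vertical contraction; this is
-- the formula 𝓕_t + ∑ dtᵢ ηⁱ for the curvature.
theorem contr_hat_locF (ha : ∀ i, ContDiffAt ℝ ∞ (a i) p.1) (τ : Fin K → ℝ) :
    contr ((0, τ) : E × (Fin K → ℝ)) (hat (locF L (univForm a) (univForm b) p)) =
      hat ((diffForm a τ p.1).compContinuousLinearMap
        (ContinuousLinearMap.fst ℝ E (Fin K → ℝ))) := by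
  have h1 := contr_hat_univForm (p := p) a τ
  have h2 := contr_hat_univForm (p := p) b τ
  rw [hat_locF, map_sub, map_add, map_smul, contr_ext₂_eq_zero _ _ h1 h1, contr_lTensor, h2,
    contr_hat_extDeriv_univForm ha]
  simp

omit [FiniteDimensional ℝ V₀] [FiniteDimensional ℝ V₁] in
theorem contr_hat_locH (hb : ∀ i, ContDiffAt ℝ ∞ (b i) p.1) (τ : Fin K → ℝ) :
    contr ((0, τ) : E × (Fin K → ℝ)) (hat (locH L (univForm a) (univForm b) p)) =
      hat ((diffForm b τ p.1).compContinuousLinearMap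
        (ContinuousLinearMap.fst ℝ E (Fin K → ℝ))) := by
  have h1 := contr_hat_univForm (p := p) a τ
  have h2 := contr_hat_univForm (p := p) b τ
  rw [hat_locH, map_sub, map_add, map_smul, contr_ext₂_eq_zero _ _ h1 h2,
    contr_hat_extDeriv_univForm hb]
  have h3 : contr ((0, τ) : E × (Fin K → ℝ))
      (eJac L (hat (univForm a p)) (hat (univForm a p)) (hat (univForm a p))) = 0 := by
    exact contr_ext₂_eq_zero _ _ (contr_ext₂_eq_zero _ _ h1 h1) h1
  rw [h3]
  simp

variable {L} {r : ℕ} (P : InvariantForm L r)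

/-- The closed form `⟨𝓕, …, 𝓕; 𝓗⟩` of the universal connection on `E × ℝᴷ`. -/
def univInv (a : Fin (K + 1) → E → E [⋀^Fin 1]→L[ℝ] V₀) (b : Fin (K + 1) → E → E [⋀^Fin 2]→L[ℝ] V₁)
    (p : E × (Fin K → ℝ)) : (E × (Fin K → ℝ)) [⋀^Fin (2 * r + 3)]→L[ℝ] ℝ :=
  wedgePair P.form (fun _ => ⟨2, locF L (univForm a) (univForm b) p⟩)
    (locH L (univForm a) (univForm b) p) (by simp [mul_comm])

theorem contDiffAt_univInv (ha : ∀ i, ContDiffAt ℝ ∞ (a i) p.1)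
    (hb : ∀ i, ContDiffAt ℝ ∞ (b i) p.1) : ContDiffAt ℝ ∞ (univInv P a b) p :=
  contDiffAt_wedgePair P.form (by simp [mul_comm])
    (contDiffAt_locF L (contDiffAt_univForm ha) (contDiffAt_univForm hb))
    (contDiffAt_locH L (contDiffAt_univForm ha) (contDiffAt_univForm hb))

theorem extDeriv_univInv (ha : ∀ i, ContDiffAt ℝ ∞ (a i) p.1)
    (hb : ∀ i, ContDiffAt ℝ ∞ (b i) p.1) : extDeriv (univInv P a b) p = 0 :=
  extDeriv_invariant L P (by simp [mul_comm]) (contDiffAt_univForm ha) (contDiffAt_univForm hb)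

/-- The sequence of `k` vertical vectors `τᵢ` followed by the horizontal vectors `uᵢ`. -/
def vcat (k : ℕ) (τ : ℕ → Fin K → ℝ) (u : ℕ → E) (i : ℕ) : E × (Fin K → ℝ) :=
  if i < k then (0, τ i) else (u (i - k), 0)

/-- Vertical contractions are computed by `contrIter_extP`, and restriction to the slice then
replaces the universal curvatures by the interpolated ones. The vertical vectors are arbitrary
because the edges of the slanted face are differences of basis vectors. -/
theorem csForm_eq_univInv {k : ℕ} (hk : k ≤ r) {n : ℕ} (hn : n + k = 2 * r + 3)
    (ha : ∀ i, ContDiffAt ℝ ∞ (a i) p.1) (hb : ∀ i, ContDiffAt ℝ ∞ (b i) p.1)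
    (τ : ℕ → Fin K → ℝ) (u : ℕ → E) :
    csForm P hk hn (fun j => diffForm a (τ j) p.1) (fun j => diffForm b (τ j) p.1)
      (locF L (affineForm a p.2) (affineForm b p.2) p.1)
      (locH L (affineForm a p.2) (affineForm b p.2) p.1) (fun i => u i) =
      contrSign k * univInv P a b p (fun i => vcat k τ u i) := by
  let R := ContinuousLinearMap.fst ℝ E (Fin K → ℝ)
  have h1 := contrIter_extP P.form P.form_symm (fun j => ((0, τ j) : E × (Fin K → ℝ)))
    (fun j => hat ((diffForm a (τ j) p.1).compContinuousLinearMap R))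
    (fun j => hat ((diffForm b (τ j) p.1).compContinuousLinearMap R))
    (isCentralVec_hat (locF L (univForm a) (univForm b) p))
    (by rw [gradingVec_hat]; simp) (hat (locH L (univForm a) (univForm b) p)) hk
    (fun l _ => gradingVec_hat_one _)
    (fun j _ l _ => contr_hat_comp_eq_zero _ _ rfl)
    (fun j _ l _ => contr_hat_comp_eq_zero _ _ rfl)
    (fun j _ => contr_hat_locF L ha _) (fun j _ => contr_hat_locH L hb _)
  rw [← hat_csForm P hk hn (fun j => (diffForm a (τ j) p.1).compContinuousLinearMap R)
    (fun j => (diffForm b (τ j) p.1).compContinuousLinearMap R) _ _ (fun _ => rfl)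
    (fun _ => rfl)] at h1
  have h2 := evalExt_contrIter (fun j => ((0, τ j) : E × (Fin K → ℝ))) (fun j => (u j, 0)) k n
    (extP (ExtDual (E × (Fin K → ℝ))) P.form
      (fun _ => hat (locF L (univForm a) (univForm b) p)) (hat (locH L (univForm a) (univForm b) p)))
  rw [h1, map_smul, evalExt_hat, show k + n = 2 * r + 3 by omega] at h2
  have h3 : extP (ExtDual (E × (Fin K → ℝ))) P.form
      (fun _ => hat (locF L (univForm a) (univForm b) p))
      (hat (locH L (univForm a) (univForm b) p)) = hat (univInv P a b p) := by
    rw [univInv, hat_wedgePair]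
    rfl
  rw [h3, evalExt_hat] at h2
  have h4 := congrArg (fun ψ : E [⋀^Fin n]→L[ℝ] ℝ => ψ fun i => u i)
    (csForm_comp P hk hn (fun j => (diffForm a (τ j) p.1).compContinuousLinearMap R)
      (fun j => (diffForm b (τ j) p.1).compContinuousLinearMap R)
      (locF L (univForm a) (univForm b) p) (locH L (univForm a) (univForm b) p)
      (ContinuousLinearMap.inl ℝ E (Fin K → ℝ)))
  rw [locF_univForm_comp_inl L ha, locH_univForm_comp_inl L hb] at h4
  have h5 : (univInv P a b p fun i : Fin (2 * r + 3) => vcat k τ u i) = _ := h2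
  rw [h5, smul_eq_mul, ← mul_assoc, contrSign_mul_self, one_mul]
  exact h4.symm

end UniversalConnection

/-! ### Smoothness through components -/

section Components

variable {X T F : Type*} [NormedAddCommGroup X] [NormedSpace ℝ X]
  [NormedAddCommGroup T] [NormedSpace ℝ T] [FiniteDimensional ℝ T]
  [NormedAddCommGroup F] [NormedSpace ℝ F] [FiniteDimensional ℝ F]

/-- The components of an alternating form on the vectors of a basis. -/
def components (T F : Type*) [NormedAddCommGroup T] [NormedSpace ℝ T] [FiniteDimensional ℝ T]
    [NormedAddCommGroup F] [NormedSpace ℝ F] (n : ℕ) :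
    (T [⋀^Fin n]→L[ℝ] F) →ₗ[ℝ] ((Fin n → Fin (Module.finrank ℝ T)) → F) where
  toFun ψ s := ψ fun i => Module.finBasis ℝ T (s i)
  map_add' _ _ := rfl
  map_smul' _ _ := rfl

omit [FiniteDimensional ℝ F] in
theorem components_injective (n : ℕ) : Function.Injective (components T F n) := fun ψ θ h => by
  refine hat_injective ?_
  rw [hat_eq_antiSum, hat_eq_antiSum]
  congr 1
  funext s
  exact congrArg _ (congrFun h s)

/-- A form depends linearly on its finitely many components on a basis. -/
theorem contDiffAt_of_apply {n : ℕ} {w : X → T [⋀^Fin n]→L[ℝ] F} {x : X} {m : WithTop ℕ∞}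
    (h : ∀ u, ContDiffAt ℝ m (fun y => w y u) x) : ContDiffAt ℝ m w x := by
  obtain ⟨g, hg⟩ := (components T F n).exists_leftInverse_of_injective
    (LinearMap.ker_eq_bot.2 (components_injective n))
  have h1 : ContDiffAt ℝ m (fun y => components T F n (w y)) x := contDiffAt_pi.2 fun s => h _
  have h2 := h1.continuousLinearMap_comp (LinearMap.toContinuousLinearMap g)
  have h3 : (fun y => LinearMap.toContinuousLinearMap g (components T F n (w y))) = w := by
    funext y
    exact LinearMap.congr_fun hg (w y)
  exact h3 ▸ h2

omit [FiniteDimensional ℝ T] [FiniteDimensional ℝ F] in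
theorem contDiffAt_apply {n : ℕ} {w : X → T [⋀^Fin n]→L[ℝ] F} {x : X} {m : WithTop ℕ∞}
    (h : ContDiffAt ℝ m w x) (u : Fin n → T) : ContDiffAt ℝ m (fun y => w y u) x :=
  h.continuousLinearMap_comp (ContinuousAlternatingMap.apply ℝ T F u)

end Components

/-! ### The integrand as a component of the universal form -/

section LocalTransgression

variable {E : Type*} [NormedAddCommGroup E] [NormedSpace ℝ E] [FiniteDimensional ℝ E]
  {V₀ V₁ : Type*} [NormedAddCommGroup V₀] [NormedSpace ℝ V₀] [FiniteDimensional ℝ V₀]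
  [NormedAddCommGroup V₁] [NormedSpace ℝ V₁] [FiniteDimensional ℝ V₁]
  {L : TwoTermLInfty V₀ V₁} {r : ℕ} (P : InvariantForm L r)

/-- The integrand of the Chern–Simons form of a family of doublets of forms on a vector space. -/
def csIntegrand {k : ℕ} (hk : k ≤ r) {n : ℕ} (hn : n + k = 2 * r + 3)
    (a : Fin (k + 1) → E → E [⋀^Fin 1]→L[ℝ] V₀) (b : Fin (k + 1) → E → E [⋀^Fin 2]→L[ℝ] V₁)
    (t : Fin k → ℝ) (y : E) : E [⋀^Fin n]→L[ℝ] ℝ :=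
  csForm P hk hn (fun j => a j.succ y - a 0 y) (fun j => b j.succ y - b 0 y)
    (locF L (affineForm a t) (affineForm b t) y) (locH L (affineForm a t) (affineForm b t) y)

/-- The sequence of standard basis vectors. -/
def stdSeq (K : ℕ) (i : ℕ) (l : Fin K) : ℝ := if (l : ℕ) = i then 1 else 0

omit [FiniteDimensional ℝ E] in
theorem diffForm_stdSeq {F : Type*} [NormedAddCommGroup F] [NormedSpace ℝ F] {K n : ℕ}
    (w : Fin (K + 1) → E → E [⋀^Fin n]→L[ℝ] F) (j : Fin K) (y : E) :
    diffForm w (stdSeq K j) y = w j.succ y - w 0 y := by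
  simp [diffForm, stdSeq, Fin.val_inj]

theorem csIntegrand_apply {k : ℕ} (hk : k ≤ r) {n : ℕ} (hn : n + k = 2 * r + 3)
    {a : Fin (k + 1) → E → E [⋀^Fin 1]→L[ℝ] V₀} {b : Fin (k + 1) → E → E [⋀^Fin 2]→L[ℝ] V₁}
    {t : Fin k → ℝ} {y : E} (ha : ∀ i, ContDiffAt ℝ ∞ (a i) y) (hb : ∀ i, ContDiffAt ℝ ∞ (b i) y)
    (u : ℕ → E) : csIntegrand P hk hn a b t y (fun i => u i) =
      contrSign k * univInv P a b (y, t) fun i => vcat k (stdSeq k) u i := by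
  rw [← csForm_eq_univInv P hk hn (p := (y, t)) ha hb]
  simp only [diffForm_stdSeq]
  rfl

omit [NormedSpace ℝ E] [FiniteDimensional ℝ E] in
theorem exists_extend {n : ℕ} (u : Fin n → E) : ∃ u' : ℕ → E, (fun i : Fin n => u' i) = u :=
  ⟨fun i => if h : i < n then u ⟨i, h⟩ else 0, by simp⟩

variable {k : ℕ} {n : ℕ} {a : Fin (k + 1) → E → E [⋀^Fin 1]→L[ℝ] V₀}
  {b : Fin (k + 1) → E → E [⋀^Fin 2]→L[ℝ] V₁} {U : Set E}

/-- Joint smoothness in the point and the parameters is inherited from the universal form. -/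
theorem contDiffAt_csIntegrand (hk : k ≤ r) (hn : n + k = 2 * r + 3) (hU : IsOpen U)
    (ha : ∀ i, ContDiffOn ℝ ∞ (a i) U) (hb : ∀ i, ContDiffOn ℝ ∞ (b i) U) {y : E} (hy : y ∈ U)
    (t : Fin k → ℝ) :
    ContDiffAt ℝ ∞ (fun q : E × (Fin k → ℝ) => csIntegrand P hk hn a b q.2 q.1) (y, t) := by
  have ha' : ∀ z ∈ U, ∀ i, ContDiffAt ℝ ∞ (a i) z := fun z hz i =>
    (ha i).contDiffAt (hU.mem_nhds hz)
  have hb' : ∀ z ∈ U, ∀ i, ContDiffAt ℝ ∞ (b i) z := fun z hz i =>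
    (hb i).contDiffAt (hU.mem_nhds hz)
  refine contDiffAt_of_apply fun u => ?_
  obtain ⟨u, rfl⟩ := exists_extend u
  have h1 := contDiffAt_apply (contDiffAt_univInv P (p := (y, t)) (ha' y hy) (hb' y hy))
    fun i => vcat k (stdSeq k) u i
  refine (contDiffAt_const.mul h1 : ContDiffAt ℝ ∞ (fun q => contrSign k * _) _).congr_of_eventuallyEq
    ?_
  filter_upwards [(hU.prod isOpen_univ).mem_nhds ⟨hy, Set.mem_univ t⟩] with q hq
  exact csIntegrand_apply P hk hn (ha' _ hq.1) (hb' _ hq.1) u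

end LocalTransgression

/-! ### Closedness split into vertical and horizontal derivatives -/

section Descent

variable {E : Type*} [NormedAddCommGroup E] [NormedSpace ℝ E] [FiniteDimensional ℝ E]
  {V₀ V₁ : Type*} [NormedAddCommGroup V₀] [NormedSpace ℝ V₀] [FiniteDimensional ℝ V₀]
  [NormedAddCommGroup V₁] [NormedSpace ℝ V₁] [FiniteDimensional ℝ V₁]
  {L : TwoTermLInfty V₀ V₁} {r : ℕ} (P : InvariantForm L r)
  {k : ℕ} {n : ℕ} {a : Fin (k + 1 + 1) → E → E [⋀^Fin 1]→L[ℝ] V₀}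
  {b : Fin (k + 1 + 1) → E → E [⋀^Fin 2]→L[ℝ] V₁} {U : Set E}

omit [NormedSpace ℝ E] [FiniteDimensional ℝ E] in
theorem skip_vcat_of_lt {K : ℕ} (τ : ℕ → Fin K → ℝ) (u : ℕ → E) {k i : ℕ} (hi : i < k + 1) :
    skip i (vcat (k + 1) τ u) = vcat k (skip i τ) u := by
  funext l
  by_cases h1 : l < i
  · simp [skip, vcat, h1, show l < k + 1 by omega, show l < k by omega]
  · by_cases h2 : l < k
    · simp [skip, vcat, h1, h2]
    · simp [skip, vcat, h1, h2]

omit [NormedSpace ℝ E] [FiniteDimensional ℝ E] in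
theorem skip_vcat_add {K : ℕ} (τ : ℕ → Fin K → ℝ) (u : ℕ → E) (k j : ℕ) :
    skip (k + j) (vcat k τ u) = vcat k τ (skip j u) := by
  funext l
  by_cases h1 : l < k
  · simp [skip, vcat, h1, show l < k + j by omega]
  · by_cases h2 : l < k + j
    · simp [skip, vcat, h1, h2, show l - k < j by omega]
    · simp [skip, vcat, h1, h2, show ¬l + 1 < k by omega, show ¬l - k < j by omega,
        show l + 1 - k = l - k + 1 by omega]

theorem removeNth_eq_skip {X : Type*} {N : ℕ} (f : ℕ → X) (i : Fin (N + 1)) :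
    i.removeNth (fun l : Fin (N + 1) => f l) = fun l : Fin N => skip i f l := by
  funext l
  simp only [Fin.removeNth, Fin.succAbove, skip, Fin.lt_def, Fin.val_castSucc]
  split_ifs <;> rfl

theorem stdSeq_eq_single {K : ℕ} (j : Fin K) : stdSeq K j = Pi.single j 1 := by
  funext l
  simp [stdSeq, Pi.single_apply, Fin.ext_iff]

/-- This is closedness of the universal form on `k + 1` vertical and `n + 1` horizontal vectors:
horizontal differentiation yields the left-hand side, vertical differentiation the partial
derivatives. -/
theorem extDeriv_csIntegrand (hk : k + 1 ≤ r) (hn : n + (k + 1) = 2 * r + 3) (hU : IsOpen U)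
    (ha : ∀ i, ContDiffOn ℝ ∞ (a i) U) (hb : ∀ i, ContDiffOn ℝ ∞ (b i) U) {y : E} (hy : y ∈ U)
    (t : Fin (k + 1) → ℝ) (u : ℕ → E) :
    extDeriv (csIntegrand P hk hn a b t) y (fun i => u i) =
      ∑ j : Fin (k + 1), (-1 : ℝ) ^ (j : ℕ) * fderiv ℝ (fun s => contrSign k *
        univInv P a b (y, s) fun i => vcat k (skip j (stdSeq (k + 1))) u i) t (Pi.single j 1) := by
  have ha' : ∀ z ∈ U, ∀ i, ContDiffAt ℝ ∞ (a i) z := fun z hz i =>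
    (ha i).contDiffAt (hU.mem_nhds hz)
  have hb' : ∀ z ∈ U, ∀ i, ContDiffAt ℝ ∞ (b i) z := fun z hz i =>
    (hb i).contDiffAt (hU.mem_nhds hz)
  have hΩ : DifferentiableAt ℝ (univInv P a b) (y, t) :=
    (contDiffAt_univInv P (p := (y, t)) (ha' y hy) (hb' y hy)).differentiableAt (by simp)
  have hΩv : ∀ v, DifferentiableAt ℝ (fun q => univInv P a b q v) (y, t) := fun v =>
    (contDiffAt_apply (contDiffAt_univInv P (p := (y, t)) (ha' y hy) (hb' y hy)) v).differentiableAt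
      (by simp)
  have hW : DifferentiableAt ℝ (csIntegrand P hk hn a b t) y := by
    have h1 := (contDiffAt_csIntegrand P hk hn hU ha hb hy t).differentiableAt (by simp)
    exact h1.comp y (f := fun z : E => (z, t)) (by fun_prop)
  let e := stdSeq (k + 1)
  let G : ℕ → ℝ := fun i => (-1 : ℝ) ^ i *
    fderiv ℝ (fun q => univInv P a b q fun l => skip i (vcat (k + 1) e u) l) (y, t)
      (vcat (k + 1) e u i)
  have h1 : ∑ i ∈ Finset.range (k + 1 + (n + 1)), G i = 0 := by
    have h2 := congrArg (fun ψ => ψ fun i => vcat (k + 1) e u i)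
      (extDeriv_univInv P (p := (y, t)) (ha' y hy) (hb' y hy))
    rw [show k + 1 + (n + 1) = 2 * r + 3 + 1 by omega, ← Fin.sum_univ_eq_sum_range]
    rw [extDeriv_apply hΩ] at h2
    refine Eq.trans (Finset.sum_congr rfl fun i _ => ?_) h2
    rw [removeNth_eq_skip, zsmul_eq_mul]
    push_cast
    rfl
  have h3 : ∀ v : Fin (2 * r + 3) → E × (Fin (k + 1) → ℝ), ∀ τ,
      fderiv ℝ (fun q => univInv P a b q v) (y, t) (0, τ) =
        fderiv ℝ (fun s => univInv P a b (y, s) v) t τ := fun v τ => by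
    have h4 : HasFDerivAt (fun s : Fin (k + 1) → ℝ => (y, s))
      (ContinuousLinearMap.inr ℝ E (Fin (k + 1) → ℝ)) t := hasFDerivAt_prodMk_right y t
    exact (congrArg (fun g => g τ) ((hΩv v).hasFDerivAt.comp t h4).fderiv).symm
  have h5 : ∀ v : Fin (2 * r + 3) → E × (Fin (k + 1) → ℝ), ∀ x,
      fderiv ℝ (fun q => univInv P a b q v) (y, t) (x, 0) =
        fderiv ℝ (fun z => univInv P a b (z, t) v) y x := fun v x => by
    have h4 : HasFDerivAt (fun z : E => (z, t))
      (ContinuousLinearMap.inl ℝ E (Fin (k + 1) → ℝ)) y := hasFDerivAt_prodMk_left y t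
    exact (congrArg (fun g => g x) ((hΩv v).hasFDerivAt.comp y h4).fderiv).symm
  rw [Finset.sum_range_add] at h1
  have h6 : ∀ i ∈ Finset.range (k + 1), G i = (-1 : ℝ) ^ i *
      fderiv ℝ (fun s => univInv P a b (y, s) fun l => vcat k (skip i e) u l) t (e i) :=
    fun i hi => by
      have hi := Finset.mem_range.1 hi
      simp only [G]
      rw [skip_vcat_of_lt _ _ hi, ← h3, vcat, if_pos hi]
  -- A horizontal vector sits behind the `k + 1` vertical ones, which gives the sign `(-1)^(k + 1)`;
  -- omitting it leaves all vertical vectors, hence again the integrand.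
  have h7 : ∀ j ∈ Finset.range (n + 1), G (k + 1 + j) = contrSign (k + 1) * ((-1 : ℝ) ^ (k + 1) *
      ((-1 : ℝ) ^ j *
        fderiv ℝ (fun z => csIntegrand P hk hn a b t z fun l => skip j u l) y (u j))) :=
    fun j _ => by
      simp only [G]
      rw [skip_vcat_add, vcat, if_neg (by omega), h5]
      have h8 : (fun z => csIntegrand P hk hn a b t z fun l => skip j u l) =ᶠ[nhds y]
          fun z => contrSign (k + 1) *
            univInv P a b (z, t) (fun i => vcat (k + 1) e (skip j u) i) := by
        filter_upwards [hU.mem_nhds hy] with z hz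
        exact csIntegrand_apply P hk hn (ha' _ hz) (hb' _ hz) _
      have h9 : DifferentiableAt ℝ
          (fun z => univInv P a b (z, t) (fun i => vcat (k + 1) e (skip j u) i)) y :=
        (hΩv _).comp y (f := fun z : E => (z, t)) (by fun_prop)
      rw [h8.fderiv_eq, fderiv_const_mul h9, Nat.add_sub_cancel_left]
      simp only [smul_apply, smul_eq_mul]
      generalize fderiv ℝ (fun z => univInv P a b (z, t)
        (fun i => vcat (k + 1) e (skip j u) i)) y (u j) = D
      rw [pow_add]
      linear_combination (-(-1) ^ (k + 1) * (-1) ^ j * D) * contrSign_mul_self (k + 1)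
  rw [Finset.sum_congr rfl h6, Finset.sum_congr rfl h7, ← Finset.mul_sum, ← Finset.mul_sum] at h1
  have h8 : extDeriv (csIntegrand P hk hn a b t) y (fun i => u i) =
      ∑ j ∈ Finset.range (n + 1), (-1 : ℝ) ^ j *
        fderiv ℝ (fun z => csIntegrand P hk hn a b t z fun l => skip j u l) y (u j) := by
    rw [extDeriv_apply hW, Finset.sum_range]
    refine Finset.sum_congr rfl fun i _ => ?_
    rw [removeNth_eq_skip, zsmul_eq_mul]
    push_cast
    rfl
  rw [← h8, Finset.sum_range] at h1
  have h9 : ∀ j : Fin (k + 1), (-1 : ℝ) ^ (j : ℕ) * fderiv ℝ (fun s => contrSign k *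
      univInv P a b (y, s) fun i => vcat k (skip j e) u i) t (Pi.single j 1) =
      contrSign k * ((-1 : ℝ) ^ (j : ℕ) *
        fderiv ℝ (fun s => univInv P a b (y, s) fun i => vcat k (skip j e) u i) t (e j)) :=
    fun j => by
      have h9 : DifferentiableAt ℝ
          (fun s => univInv P a b (y, s) (fun i => vcat k (skip j e) u i)) t :=
        (hΩv _).comp t (f := fun s => (y, s)) (by fun_prop)
      rw [fderiv_const_mul h9, ← stdSeq_eq_single]
      simp only [smul_apply, smul_eq_mul]
      ring
  rw [Finset.sum_congr rfl fun j _ => h9 j, ← Finset.mul_sum]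
  generalize ∑ j : Fin (k + 1), (-1 : ℝ) ^ (j : ℕ) *
    fderiv ℝ (fun s => univInv P a b (y, s) fun i => vcat k (skip j e) u i) t (e j) = S at h1 ⊢
  generalize extDeriv (csIntegrand P hk hn a b t) y (fun i => u i) = D at h1 ⊢
  -- The step from `contrSign k` to `contrSign (k + 1)` contributes `(-1)^k`; together with `(-1)^(k
  -- + 1)` it gives the minus sign that moves the vertical terms to the other side.
  have h10 : (-1 : ℝ) ^ k * (-1) ^ (k + 1) = -1 := by
    rw [← pow_add, show k + (k + 1) = 2 * k + 1 by ring, pow_succ, pow_mul]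
    simp
  rw [contrSign] at h1
  linear_combination (contrSign k * contrSign k * D) * h10 - contrSign k * h1 -
    D * contrSign_mul_self k

end Descent

/-! ### Differentiation under the integral over a compact set -/

section ParametricIntegral

universe u

variable {E G : Type u} [NormedAddCommGroup E] [NormedSpace ℝ E] [FiniteDimensional ℝ E]
  [NormedAddCommGroup G] [NormedSpace ℝ G] [CompleteSpace G]
  {k : ℕ} {S : Set (Fin k → ℝ)} {U : Set E}

omit [FiniteDimensional ℝ E] [CompleteSpace G] in
theorem hasFDerivAt_partial {g : E × (Fin k → ℝ) → G} (hU : IsOpen U)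
    (hg : ContDiffOn ℝ ∞ g (U ×ˢ Set.univ)) {y : E} (hy : y ∈ U) (t : Fin k → ℝ) :
    HasFDerivAt (fun z => g (z, t)) (fderiv ℝ g (y, t) ∘L ContinuousLinearMap.inl ℝ E (Fin k → ℝ))
      y := by
  have h1 : ContDiffAt ℝ ∞ g (y, t) :=
    hg.contDiffAt ((hU.prod isOpen_univ).mem_nhds ⟨hy, Set.mem_univ t⟩)
  exact (h1.differentiableAt (by simp)).hasFDerivAt.comp y (hasFDerivAt_prodMk_left y t)

omit [CompleteSpace G] in
-- The partial derivative is continuous, hence bounded on a closed ball times the compact set; that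
-- constant is the dominating function.
theorem hasFDerivAt_setIntegral {g : E × (Fin k → ℝ) → G} (hS : IsCompact S) (hU : IsOpen U)
    (hg : ContDiffOn ℝ ∞ g (U ×ˢ Set.univ)) {y : E} (hy : y ∈ U) :
    HasFDerivAt (fun z => ∫ t in S, g (z, t))
      (∫ t in S, fderiv ℝ g (y, t) ∘L ContinuousLinearMap.inl ℝ E (Fin k → ℝ)) y := by
  have hUo := hU.prod (isOpen_univ (X := Fin k → ℝ))
  obtain ⟨ε, hε, hεU⟩ := Metric.nhds_basis_closedBall.mem_iff.1 (hU.mem_nhds hy)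
  have hc : ContinuousOn
      (fun p : E × (Fin k → ℝ) => fderiv ℝ g p ∘L ContinuousLinearMap.inl ℝ E (Fin k → ℝ))
      (U ×ˢ Set.univ) :=
    (hg.continuousOn_fderiv_of_isOpen hUo (by simp)).clm_comp continuousOn_const
  obtain ⟨C, hC⟩ := ((isCompact_closedBall y ε).prod hS).exists_bound_of_continuousOn
    (hc.mono (Set.prod_mono hεU (Set.subset_univ S)))
  have hslice : ∀ z ∈ U, Continuous fun t => g (z, t) := fun z hz =>
    hg.continuousOn.comp_continuous (by fun_prop) fun t => ⟨hz, Set.mem_univ t⟩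
  refine hasFDerivAt_integral_of_dominated_of_fderiv_le (bound := fun _ => C)
    (F' := fun z t => fderiv ℝ g (z, t) ∘L ContinuousLinearMap.inl ℝ E (Fin k → ℝ))
    (Metric.closedBall_mem_nhds y hε) ?_ ?_ ?_ ?_ ?_ ?_
  · filter_upwards [hU.mem_nhds hy] with z hz
    exact (hslice z hz).aestronglyMeasurable
  · exact (hslice y hy).continuousOn.integrableOn_compact hS
  · exact (hc.comp_continuous (f := fun t => (y, t)) (by fun_prop)
      fun t => ⟨hy, Set.mem_univ t⟩).aestronglyMeasurable
  · filter_upwards [ae_restrict_mem hS.measurableSet] with t ht z hz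
    exact hC (z, t) ⟨hz, ht⟩
  · exact continuousOn_const.integrableOn_compact hS
  · filter_upwards with t z hz
    exact hasFDerivAt_partial hU hg (hεU hz) t

theorem contDiffOn_setIntegral (hS : IsCompact S) (hU : IsOpen U) {g : E × (Fin k → ℝ) → G}
    (hg : ContDiffOn ℝ ∞ g (U ×ˢ Set.univ)) :
    ContDiffOn ℝ ∞ (fun y => ∫ t in S, g (y, t)) U := by
  rw [contDiffOn_infty]
  intro n
  induction n generalizing G with
  | zero =>
    exact contDiffOn_zero.2 fun y hy =>
      (hasFDerivAt_setIntegral hS hU hg hy).continuousAt.continuousWithinAt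
  | succ n ih =>
    push_cast
    rw [contDiffOn_succ_iff_fderiv_of_isOpen hU]
    refine ⟨fun y hy => (hasFDerivAt_setIntegral hS hU hg hy).differentiableAt.differentiableWithinAt,
      by simp, ?_⟩
    -- The target of the integrand changes in the induction, which is why `E` and `G` share a
    -- universe.
    have h1 := ih (G := E →L[ℝ] G)
      (g := fun p => fderiv ℝ g p ∘L ContinuousLinearMap.inl ℝ E (Fin k → ℝ))
      ((hg.fderiv_of_isOpen (hU.prod isOpen_univ) (by simp)).clm_comp contDiffOn_const)
    exact h1.congr fun y hy => (hasFDerivAt_setIntegral hS hU hg hy).fderiv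

/-- The functional is arbitrary so that alternation of the derivative followed by evaluation on
vectors is an instance. -/
theorem map_fderiv_setIntegral {g : E × (Fin k → ℝ) → G} (hS : IsCompact S) (hU : IsOpen U)
    (hg : ContDiffOn ℝ ∞ g (U ×ˢ Set.univ)) {y : E} (hy : y ∈ U) (ℓ : (E →L[ℝ] G) →L[ℝ] ℝ) :
    ℓ (fderiv ℝ (fun z => ∫ t in S, g (z, t)) y) =
      ∫ t in S, ℓ (fderiv ℝ (fun z => g (z, t)) y) := by
  have hc : ContinuousOn
      (fun p : E × (Fin k → ℝ) => fderiv ℝ g p ∘L ContinuousLinearMap.inl ℝ E (Fin k → ℝ))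
      (U ×ˢ Set.univ) :=
    (hg.continuousOn_fderiv_of_isOpen (hU.prod isOpen_univ) (by simp)).clm_comp continuousOn_const
  have hc' := (hc.comp_continuous (f := fun t => (y, t)) (by fun_prop)
    fun t => ⟨hy, Set.mem_univ t⟩).continuousOn.integrableOn_compact (μ := volume) hS
  rw [(hasFDerivAt_setIntegral hS hU hg hy).fderiv]
  refine (ℓ.integral_comp_comm hc').symm.trans ?_
  refine integral_congr_ae (Filter.Eventually.of_forall fun t => ?_)
  exact congrArg ℓ (hasFDerivAt_partial hU hg hy t).fderiv.symm

end ParametricIntegral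

/-! ### Fubini, Stokes and the slanted face of the simplex -/

section Simplex

variable {k : ℕ}

theorem isCompact_simplex (k : ℕ) : IsCompact (simplex k) := by
  have h : simplex k = (Set.Icc 0 1) ∩ {t | ∑ i, t i ≤ 1} := by
    ext t
    simp only [simplex, Set.mem_ofPred_eq, Set.mem_inter_iff, Set.mem_Icc, Pi.le_def, Pi.zero_apply,
      Pi.one_apply, forall_and]
  rw [h]
  exact isCompact_Icc.inter_right (isClosed_le (by fun_prop) continuous_const)

/-- The bound `x ≤ 1` is implied because the other coordinates have nonnegative sum. -/
theorem insertNth_mem_simplex (i : Fin (k + 1)) (x : ℝ) (s : Fin k → ℝ) :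
    (Fin.insertNth i x s : Fin (k + 1) → ℝ) ∈ simplex (k + 1) ↔
      s ∈ simplex k ∧ x ∈ Set.Icc 0 (1 - ∑ j, s j) := by
  simp only [simplex, Set.mem_ofPred_eq, Set.mem_Icc, Fin.forall_iff_succAbove i,
    Fin.insertNth_apply_same, Fin.insertNth_apply_succAbove, Fin.sum_univ_succAbove _ i]
  constructor
  · rintro ⟨⟨h1, h2⟩, h3⟩
    exact ⟨⟨h2, by linarith⟩, h1.1, by linarith⟩
  · rintro ⟨⟨h1, h2⟩, h3, h4⟩
    have h5 : 0 ≤ ∑ j, s j := Finset.sum_nonneg fun j _ => (h1 j).1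
    exact ⟨⟨⟨h3, by linarith⟩, h1⟩, by linarith⟩

theorem continuous_insertNth (i : Fin (k + 1)) :
    Continuous fun p : ℝ × (Fin k → ℝ) => (Fin.insertNth i p.1 p.2 : Fin (k + 1) → ℝ) :=
  Continuous.finInsertNth i continuous_fst continuous_snd

/-- Integration over a simplex in one of the coordinates first. -/
theorem setIntegral_simplex_succ (i : Fin (k + 1)) {f : (Fin (k + 1) → ℝ) → ℝ}
    (hf : Continuous f) : ∫ t in simplex (k + 1), f t =
      ∫ s in simplex k, ∫ x in (0 : ℝ)..(1 - ∑ j, s j), f (Fin.insertNth i x s) := by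
  let e := MeasurableEquiv.piFinSuccAbove (fun _ : Fin (k + 1) => ℝ) i
  have he : MeasurePreserving e.symm volume volume :=
    (volume_preserving_piFinSuccAbove (fun _ : Fin (k + 1) => ℝ) i).symm _
  have h1 := he.setIntegral_preimage_emb e.symm.measurableEmbedding f (simplex (k + 1))
  have h2 : ∀ p, e.symm p = (Fin.insertNth i p.1 p.2 : Fin (k + 1) → ℝ) := fun _ => rfl
  have hc : Continuous fun p => f (e.symm p) := hf.comp (continuous_insertNth i)
  have hm : MeasurableSet (e.symm ⁻¹' simplex (k + 1)) :=
    e.symm.measurable (isCompact_simplex (k + 1)).measurableSet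
  -- A closed subset of `[0, 1]` times the smaller simplex; this gives the integrability that
  -- Fubini's theorem needs.
  have hcomp : IsCompact (e.symm ⁻¹' simplex (k + 1)) := by
    refine ((isCompact_Icc (a := (0 : ℝ)) (b := 1)).prod (isCompact_simplex k)).of_isClosed_subset
      ((isCompact_simplex (k + 1)).isClosed.preimage (continuous_insertNth i)) fun p hp => ?_
    have h3 := (insertNth_mem_simplex i p.1 p.2).1 hp
    have h4 : 0 ≤ ∑ j, p.2 j := Finset.sum_nonneg fun j _ => (h3.1.1 j).1
    exact ⟨⟨h3.2.1, by linarith [h3.2.2]⟩, h3.1⟩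
  have hint : Integrable ((e.symm ⁻¹' simplex (k + 1)).indicator fun p => f (e.symm p))
      (volume.prod volume) :=
    (integrable_indicator_iff hm).2 (hc.continuousOn.integrableOn_compact hcomp)
  rw [← h1, ← integral_indicator hm, Measure.volume_eq_prod, integral_prod_symm _ hint,
    ← integral_indicator (isCompact_simplex k).measurableSet]
  refine integral_congr_ae (Filter.Eventually.of_forall fun s => ?_)
  by_cases hs : s ∈ simplex k
  · rw [Set.indicator_of_mem hs, intervalIntegral.integral_of_le (by linarith [hs.2]),
      ← integral_Icc_eq_integral_Ioc, ← integral_indicator measurableSet_Icc]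
    refine integral_congr_ae (Filter.Eventually.of_forall fun x => ?_)
    by_cases hx : x ∈ Set.Icc 0 (1 - ∑ j, s j)
    · rw [Set.indicator_of_mem hx]
      exact Set.indicator_of_mem (s := e.symm ⁻¹' simplex (k + 1)) (a := (x, s))
        ((insertNth_mem_simplex i x s).2 ⟨hs, hx⟩) _
    · rw [Set.indicator_of_notMem hx]
      exact Set.indicator_of_notMem (s := e.symm ⁻¹' simplex (k + 1)) (a := (x, s))
        (fun h => hx ((insertNth_mem_simplex i x s).1 h).2) _
  · rw [Set.indicator_of_notMem hs]
    refine integral_eq_zero_of_ae (Filter.Eventually.of_forall fun x => ?_)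
    exact Set.indicator_of_notMem (fun h => hs ((insertNth_mem_simplex i x s).1 h).1) _

/-- Stokes' theorem for the simplex. -/
theorem setIntegral_simplex_fderiv (i : Fin (k + 1)) {f : (Fin (k + 1) → ℝ) → ℝ}
    (hf : ContDiff ℝ ∞ f) : ∫ t in simplex (k + 1), fderiv ℝ f t (Pi.single i 1) =
      ∫ s in simplex k, (f (Fin.insertNth i (1 - ∑ j, s j) s) - f (Fin.insertNth i 0 s)) := by
  have hc : Continuous fun t => fderiv ℝ f t (Pi.single i 1) :=
    (hf.continuous_fderiv (by simp)).clm_apply continuous_const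
  rw [setIntegral_simplex_succ i hc]
  refine integral_congr_ae (Filter.Eventually.of_forall fun s => ?_)
  refine intervalIntegral.integral_eq_sub_of_hasDerivAt
    (f := fun x => f (Fin.insertNth i x s)) (fun x _ => ?_) ?_
  · have h1 : HasDerivAt (fun x : ℝ => (Fin.insertNth i x s : Fin (k + 1) → ℝ)) (Pi.single i 1) x := by
      rw [hasDerivAt_pi]
      refine (Fin.forall_iff_succAbove i).2 ⟨?_, fun j => ?_⟩
      · simpa using hasDerivAt_id' x
      · simpa using hasDerivAt_const x (s j)
    exact ((hf.differentiable (by simp)) _).hasFDerivAt.comp_hasDerivAt x h1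
  · exact (hc.comp ((continuous_insertNth i).comp (by fun_prop : Continuous fun x : ℝ => (x, s)))
      ).intervalIntegrable _ _

/-- The face `t₀ + ⋯ + t_k = 1` of the simplex may be parametrised by any `k` of the coordinates. -/
theorem setIntegral_simplex_face (i : Fin (k + 1)) {g : (Fin (k + 1) → ℝ) → ℝ}
    (hg : Continuous g) : ∫ s in simplex k, g (Fin.insertNth i (1 - ∑ j, s j) s) =
      ∫ s in simplex k, g (Fin.insertNth 0 (1 - ∑ j, s j) s) := by
  refine Fin.cases rfl (fun i => ?_) i
  rcases k with _ | k
  · exact i.elim0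
  have hc : ∀ j : Fin (k + 2), Continuous fun s : Fin (k + 1) → ℝ =>
      g (Fin.insertNth j (1 - ∑ l, s l) s) := fun j =>
    hg.comp ((continuous_insertNth j).comp (by fun_prop : Continuous fun s : Fin (k + 1) → ℝ =>
      (1 - ∑ l, s l, s)))
  rw [setIntegral_simplex_succ 0 (hc _), setIntegral_simplex_succ i (hc _)]
  refine integral_congr_ae (Filter.Eventually.of_forall fun s => ?_)
  -- With the other coordinates fixed, coordinates `0` and `i.succ` have constant sum on this face.
  -- The two parametrizations of the segment differ by the reflection `x ↦ (1 - ∑ s) - x`.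
  have h1 := intervalIntegral.integral_comp_sub_left (a := 0) (b := 1 - ∑ j, s j)
    (fun x => g (Fin.insertNth 0 (1 - ∑ l, (Fin.insertNth i x s : Fin (k + 1) → ℝ) l)
      (Fin.insertNth i x s : Fin (k + 1) → ℝ))) (1 - ∑ j, s j)
  rw [sub_self, sub_zero] at h1
  refine Eq.trans ?_ h1
  refine intervalIntegral.integral_congr fun x _ => ?_
  congr 1
  have h2 : ∀ x, ∑ l, (Fin.insertNth i x s : Fin (k + 1) → ℝ) l = x + ∑ j, s j := fun x => by
    rw [Fin.sum_univ_succAbove _ i]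
    simp
  have h3 : ∀ x, ∑ l, (Fin.insertNth 0 x s : Fin (k + 1) → ℝ) l = x + ∑ j, s j := fun x => by
    rw [Fin.sum_univ_succ]
    simp
  rw [h2, h3]
  funext l
  refine Fin.cases ?_ (fun l => ?_) l
  · have : (0 : Fin (k + 2)) = i.succ.succAbove 0 := by simp
    rw [this, Fin.insertNth_apply_succAbove, ← this]
    simp only [Fin.insertNth_apply_same]
    ring
  · rcases Fin.eq_self_or_eq_succAbove i l with rfl | ⟨l, rfl⟩
    · simp
      ring
    · rw [← Fin.succ_succAbove_succ, Fin.insertNth_apply_succAbove]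
      simp

end Simplex

/-! ### Contraction with differences of vectors -/

section IteratedContraction

variable {T : Type*} [NormedAddCommGroup T] [NormedSpace ℝ T]
  {F : Type*} [AddCommGroup F] [Module ℝ F]

theorem contr_contr_swap (v w : T) (x : ExtDual T ⊗[ℝ] F) :
    contr v (contr w x) = -contr w (contr v x) := by
  induction x with
  | zero => simp
  | add x y hx hy => simp only [map_add, hx, hy]; abel
  | tmul a x =>
    have h : ∀ (v : T) (a : ExtDual T), contr v (a ⊗ₜ[ℝ] x) = icontr v a ⊗ₜ x := fun _ _ => rfl
    rw [h, h, h, h, ← TensorProduct.neg_tmul]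
    congr 1
    exact CliffordAlgebra.contractLeft_comm _ _ _

theorem contr_contr_self (v : T) (x : ExtDual T ⊗[ℝ] F) : contr v (contr v x) = 0 := by
  induction x with
  | zero => simp
  | add x y hx hy => simp only [map_add, hx, hy, add_zero]
  | tmul a x =>
    have h : ∀ (v : T) (a : ExtDual T), contr v (a ⊗ₜ[ℝ] x) = icontr v a ⊗ₜ x := fun _ _ => rfl
    rw [h, h]
    have h2 : icontr v (icontr v a) = 0 := CliffordAlgebra.contractLeft_contractLeft _ _
    rw [h2, TensorProduct.zero_tmul]

theorem contr_contrIter_shift (v : ℕ → T) (k : ℕ) (x : ExtDual T ⊗[ℝ] F) :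
    contr (v 0) (contrIter (fun i => v (i + 1)) k x) = (-1 : ℝ) ^ k • contrIter v (k + 1) x := by
  induction k with
  | zero => simp [contrIter]
  | succ k ih =>
    have h : contrIter v (k + 1 + 1) x = contr (v (k + 1)) (contrIter v (k + 1) x) := rfl
    rw [contrIter, LinearMap.comp_apply, contr_contr_swap, ih, map_smul, h, pow_succ]
    module

theorem contr_contrIter_self (v : ℕ → T) (k : ℕ) (x : ExtDual T ⊗[ℝ] F) :
    contr (v 0) (contrIter v (k + 1) x) = 0 := by
  induction k with
  | zero => exact contr_contr_self _ _
  | succ k ih =>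
    rw [contrIter, LinearMap.comp_apply, contr_contr_swap, ih, map_zero, neg_zero]

theorem contrIter_congr {v w : ℕ → T} {k : ℕ} (h : ∀ i < k, v i = w i) :
    (contrIter v k : ExtDual T ⊗[ℝ] F →ₗ[ℝ] ExtDual T ⊗[ℝ] F) = contrIter w k := by
  induction k with
  | zero => rfl
  | succ k ih => rw [contrIter, contrIter, ih fun i hi => h i (by omega), h k (by omega)]

/-- Contractions anticommute and square to zero, so `v 0` survives at most once when the differences
are expanded. This is (v₁ - v₀) ∧ ⋯ ∧ (v_k - v₀) written as the alternating sum over the omitted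
vector. -/
theorem contrIter_sub (v : ℕ → T) (k : ℕ) (x : ExtDual T ⊗[ℝ] F) :
    contrIter (fun i => v (i + 1) - v 0) k x =
      ∑ j ∈ Finset.range (k + 1), (-1 : ℝ) ^ j • contrIter (skip j v) k x := by
  have hsub : ∀ (v w : T) (x : ExtDual T ⊗[ℝ] F), contr (v - w) x = contr v x - contr w x := by
    intro v w x
    induction x with
    | zero => simp
    | add x y hx hy => simp only [map_add, hx, hy]; abel
    | tmul a x =>
      have h : ∀ (v : T) (a : ExtDual T), contr v (a ⊗ₜ[ℝ] x) = icontr v a ⊗ₜ x := fun _ _ => rfl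
      rw [h, h, h, ← TensorProduct.sub_tmul]
      congr 1
      simp [icontr]
  induction k with
  | zero => simp [contrIter]
  | succ k ih =>
    have h1 : ∀ j ∈ Finset.range (k + 1), contrIter (skip j v) (k + 1) x =
        contr (v (k + 1)) (contrIter (skip j v) k x) := fun j hj => by
      have hj := Finset.mem_range.1 hj
      rw [contrIter, LinearMap.comp_apply, skip, if_neg (by omega)]
    -- If the omitted index is not `0`, the contraction with `v 0` already occurs and the term
    -- vanishes.
    have h2 : ∑ j ∈ Finset.range (k + 1), (-1 : ℝ) ^ j • contr (v 0) (contrIter (skip j v) k x) =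
        (-1 : ℝ) ^ k • contrIter v (k + 1) x := by
      rw [Finset.sum_range_succ', Finset.sum_eq_zero, zero_add, ← contr_contrIter_shift]
      · rw [pow_zero, one_smul]
        rfl
      · intro j hj
        have hj := Finset.mem_range.1 hj
        obtain ⟨k, rfl⟩ : ∃ k', k = k' + 1 := ⟨k - 1, by omega⟩
        have h3 := contr_contrIter_self (skip (j + 1) v) k x
        rw [skip, if_pos (by omega)] at h3
        rw [h3, smul_zero]
    have h4 : (contrIter (skip (k + 1) v) (k + 1) : ExtDual T ⊗[ℝ] F →ₗ[ℝ] _) =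
        contrIter v (k + 1) :=
      contrIter_congr fun i hi => by rw [skip, if_pos hi]
    rw [contrIter, LinearMap.comp_apply, ih, hsub, map_sum, map_sum, Finset.sum_range_succ _ (k + 1),
      h4, Finset.sum_congr rfl fun j hj => congrArg ((-1 : ℝ) ^ j • ·) (h1 j hj)]
    simp only [map_smul]
    rw [h2, pow_succ]
    module

end IteratedContraction

/-! ### The descent equations on an open subset of a vector space -/

section LocalDescent

universe u

variable {E : Type u} [NormedAddCommGroup E] [NormedSpace ℝ E] [FiniteDimensional ℝ E]
  {V₀ V₁ : Type*} [NormedAddCommGroup V₀] [NormedSpace ℝ V₀] [FiniteDimensional ℝ V₀]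
  [NormedAddCommGroup V₁] [NormedSpace ℝ V₁] [FiniteDimensional ℝ V₁]
  {L : TwoTermLInfty V₀ V₁} {r : ℕ} (P : InvariantForm L r)

omit [FiniteDimensional ℝ V₀] in
theorem univInv_vcat_sub {K : ℕ} {a : Fin (K + 1) → E → E [⋀^Fin 1]→L[ℝ] V₀}
    {b : Fin (K + 1) → E → E [⋀^Fin 2]→L[ℝ] V₁} (p : E × (Fin K → ℝ)) {k n : ℕ}
    (hn : n + k = 2 * r + 3) (τ : ℕ → Fin K → ℝ) (u : ℕ → E) :
    univInv P a b p (fun i => vcat k (fun j => τ (j + 1) - τ 0) u i) =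
      ∑ j ∈ Finset.range (k + 1), (-1 : ℝ) ^ j *
        univInv P a b p (fun i => vcat k (skip j τ) u i) := by
  have h1 : ∀ τ : ℕ → Fin K → ℝ, univInv P a b p (fun i => vcat k τ u i) =
      evalExt n (fun j => ((u j, 0) : E × (Fin K → ℝ)))
        (contrIter (fun j => ((0, τ j) : E × (Fin K → ℝ))) k (hat (univInv P a b p))) := fun τ => by
    have h2 := evalExt_contrIter (fun j => ((0, τ j) : E × (Fin K → ℝ))) (fun j => (u j, 0)) k n
      (hat (univInv P a b p))
    rw [show k + n = 2 * r + 3 by omega, evalExt_hat] at h2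
    exact h2
  simp only [h1]
  have h3 := contrIter_sub (fun j => ((0, τ j) : E × (Fin K → ℝ))) k (hat (univInv P a b p))
  simp only [Prod.mk_sub_mk, sub_zero] at h3
  rw [h3, map_sum]
  refine Finset.sum_congr rfl fun j _ => ?_
  rw [map_smul, smul_eq_mul]
  congr 4
  funext i
  unfold skip
  split_ifs <;> rfl

/-- A subfamily spans a face of the large simplex. Its integrand is a component of the universal
form of the large family at the same interpolated doublet, contracted along the edges of that face.
-/
theorem csIntegrand_eq_univInv {K k : ℕ} (hk : k ≤ r) {n : ℕ} (hn : n + k = 2 * r + 3)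
    {a : Fin (K + 1) → E → E [⋀^Fin 1]→L[ℝ] V₀} {b : Fin (K + 1) → E → E [⋀^Fin 2]→L[ℝ] V₁}
    {a' : Fin (k + 1) → E → E [⋀^Fin 1]→L[ℝ] V₀} {b' : Fin (k + 1) → E → E [⋀^Fin 2]→L[ℝ] V₁}
    {y : E} (ha : ∀ i, ContDiffAt ℝ ∞ (a i) y) (hb : ∀ i, ContDiffAt ℝ ∞ (b i) y)
    {t : Fin K → ℝ} {s : Fin k → ℝ} (hat : affineForm a' s = affineForm a t)
    (hbt : affineForm b' s = affineForm b t) (τ : ℕ → Fin K → ℝ)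
    (haτ : ∀ j : Fin k, a' j.succ y - a' 0 y = diffForm a (τ j) y)
    (hbτ : ∀ j : Fin k, b' j.succ y - b' 0 y = diffForm b (τ j) y) (u : ℕ → E) :
    csIntegrand P hk hn a' b' s y (fun i => u i) =
      contrSign k * univInv P a b (y, t) (fun i => vcat k τ u i) := by
  rw [← csForm_eq_univInv P hk hn (p := (y, t)) ha hb, csIntegrand, hat, hbt]
  simp only [haτ, hbτ]

section AffineForm

variable {F : Type*} [NormedAddCommGroup F] [NormedSpace ℝ F] {k n : ℕ}
  (w : Fin (k + 1 + 1) → E → E [⋀^Fin n]→L[ℝ] F)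

omit [FiniteDimensional ℝ E]

theorem affineForm_insertNth_zero (j : Fin (k + 1)) (s : Fin k → ℝ) :
    affineForm (fun i => w (j.succ.succAbove i)) s = affineForm w (Fin.insertNth j 0 s) := by
  funext y
  simp [affineForm, Fin.sum_univ_succAbove _ j]

/-- Without the connection number 0, the connection number 1 is the base point, and its barycentric
weight is what the other weights leave. -/
theorem affineForm_insertNth_one_sub (s : Fin k → ℝ) :
    affineForm (fun i => w (Fin.succAbove 0 i)) s =
      affineForm w (Fin.insertNth 0 (1 - ∑ j, s j) s) := by
  funext y
  simp only [affineForm, Fin.sum_univ_succ, Fin.insertNth_zero', Fin.cons_zero, Fin.cons_succ,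
    Fin.zero_succAbove, sub_smul, Finset.sum_smul, one_smul, smul_sub, Finset.sum_sub_distrib]
  abel

theorem sub_eq_diffForm_skip (j : Fin (k + 1)) (i : Fin k) (y : E) :
    w (j.succ.succAbove i.succ) y - w (j.succ.succAbove 0) y =
      diffForm w (skip j (stdSeq (k + 1)) i) y := by
  have h : skip j (stdSeq (k + 1)) i = stdSeq (k + 1) (j.succAbove i) := by
    simp only [Fin.succAbove, skip, Fin.lt_def, Fin.val_castSucc]
    split_ifs <;> rfl
  rw [h, diffForm_stdSeq]
  simp [Fin.succ_succAbove_succ]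

theorem sub_eq_diffForm_sub (i : Fin k) (y : E) :
    w (Fin.succAbove 0 i.succ) y - w (Fin.succAbove 0 0) y =
      diffForm w (stdSeq (k + 1) (i + 1) - stdSeq (k + 1) 0) y := by
  have h1 := diffForm_stdSeq w i.succ y
  have h2 := diffForm_stdSeq w (0 : Fin (k + 1)) y
  have h3 : diffForm w (stdSeq (k + 1) (i + 1) - stdSeq (k + 1) 0) y =
      diffForm w (stdSeq (k + 1) (i + 1)) y - diffForm w (stdSeq (k + 1) 0) y := by
    simp [diffForm, sub_smul]
  rw [h3]
  erw [h1, h2]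
  simp

end AffineForm

/-- The Chern–Simons form of a family of doublets of forms on a vector space. -/
def csLocal {k : ℕ} (hk : k ≤ r) {n : ℕ} (hn : n + k = 2 * r + 3)
    (a : Fin (k + 1) → E → E [⋀^Fin 1]→L[ℝ] V₀) (b : Fin (k + 1) → E → E [⋀^Fin 2]→L[ℝ] V₁)
    (y : E) : E [⋀^Fin n]→L[ℝ] ℝ :=
  ∫ t in simplex k, csIntegrand P hk hn a b t y

section Integral

variable {k : ℕ} {n : ℕ} {a : Fin (k + 1) → E → E [⋀^Fin 1]→L[ℝ] V₀}
  {b : Fin (k + 1) → E → E [⋀^Fin 2]→L[ℝ] V₁} {U : Set E}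

theorem contDiffOn_csIntegrand (hk : k ≤ r) (hn : n + k = 2 * r + 3) (hU : IsOpen U)
    (ha : ∀ i, ContDiffOn ℝ ∞ (a i) U) (hb : ∀ i, ContDiffOn ℝ ∞ (b i) U) :
    ContDiffOn ℝ ∞ (fun q : E × (Fin k → ℝ) => csIntegrand P hk hn a b q.2 q.1)
      (U ×ˢ Set.univ) := fun q hq =>
  (contDiffAt_csIntegrand P hk hn hU ha hb hq.1 q.2).contDiffWithinAt

theorem contDiffOn_csLocal (hk : k ≤ r) (hn : n + k = 2 * r + 3) (hU : IsOpen U)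
    (ha : ∀ i, ContDiffOn ℝ ∞ (a i) U) (hb : ∀ i, ContDiffOn ℝ ∞ (b i) U) :
    ContDiffOn ℝ ∞ (csLocal P hk hn a b) U :=
  contDiffOn_setIntegral (isCompact_simplex k) hU (contDiffOn_csIntegrand P hk hn hU ha hb)

theorem csLocal_apply (hk : k ≤ r) (hn : n + k = 2 * r + 3) (hU : IsOpen U)
    (ha : ∀ i, ContDiffOn ℝ ∞ (a i) U) (hb : ∀ i, ContDiffOn ℝ ∞ (b i) U) {y : E} (hy : y ∈ U)
    (u : Fin n → E) :
    csLocal P hk hn a b y u = ∫ t in simplex k, csIntegrand P hk hn a b t y u := by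
  have h1 : Continuous fun t => csIntegrand P hk hn a b t y :=
    (contDiffOn_csIntegrand P hk hn hU ha hb).continuousOn.comp_continuous
      (f := fun t => (y, t)) (by fun_prop) fun t => ⟨hy, Set.mem_univ t⟩
  exact ((ContinuousAlternatingMap.apply ℝ E ℝ u).integral_comp_comm
    (h1.continuousOn.integrableOn_compact (isCompact_simplex k))).symm

theorem extDeriv_csLocal_apply (hk : k ≤ r) (hn : n + k = 2 * r + 3) (hU : IsOpen U)
    (ha : ∀ i, ContDiffOn ℝ ∞ (a i) U) (hb : ∀ i, ContDiffOn ℝ ∞ (b i) U) {y : E} (hy : y ∈ U)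
    (u : Fin (n + 1) → E) : extDeriv (csLocal P hk hn a b) y u =
      ∫ t in simplex k, extDeriv (csIntegrand P hk hn a b t) y u :=
  map_fderiv_setIntegral (isCompact_simplex k) hU (contDiffOn_csIntegrand P hk hn hU ha hb) hy
    ((ContinuousAlternatingMap.apply ℝ E ℝ u) ∘L
      (ContinuousAlternatingMap.alternatizeUncurryFinCLM ℝ E ℝ))

end Integral

/-- Integrating `extDeriv_csIntegrand` leaves boundary terms only. The faces with a vanishing
coordinate give the terms with `i ≥ 1`, and the slanted face gives the term `i = 0`. -/
theorem extDeriv_csLocal {k n : ℕ} {a : Fin (k + 1 + 1) → E → E [⋀^Fin 1]→L[ℝ] V₀}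
    {b : Fin (k + 1 + 1) → E → E [⋀^Fin 2]→L[ℝ] V₁} {U : Set E} (hk : k + 1 ≤ r)
    (hn : n + (k + 1) = 2 * r + 3) (hU : IsOpen U) (ha : ∀ i, ContDiffOn ℝ ∞ (a i) U)
    (hb : ∀ i, ContDiffOn ℝ ∞ (b i) U) {y : E} (hy : y ∈ U) :
    extDeriv (csLocal P hk hn a b) y = ∑ i : Fin (k + 1 + 1), (-1 : ℝ) ^ (i : ℕ) •
      csLocal P (show k ≤ r by omega) (show n + 1 + k = 2 * r + 3 by omega)
        (fun j => a (i.succAbove j)) (fun j => b (i.succAbove j)) y := by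
  have hk' : k ≤ r := by omega
  have hn' : n + 1 + k = 2 * r + 3 := by omega
  have ha' : ∀ i, ContDiffAt ℝ ∞ (a i) y := fun i => (ha i).contDiffAt (hU.mem_nhds hy)
  have hb' : ∀ i, ContDiffAt ℝ ∞ (b i) y := fun i => (hb i).contDiffAt (hU.mem_nhds hy)
  ext u
  obtain ⟨u, rfl⟩ := exists_extend u
  let f : ℕ → (Fin (k + 1) → ℝ) → ℝ := fun j s => contrSign k *
    univInv P a b (y, s) fun i => vcat k (skip j (stdSeq (k + 1))) u i
  have hf : ∀ j, ContDiff ℝ ∞ (f j) := fun j => contDiff_iff_contDiffAt.2 fun s =>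
    contDiffAt_const.mul ((contDiffAt_apply (contDiffAt_univInv P (p := (y, s)) ha' hb') _).comp s
      (f := fun s => (y, s)) (by fun_prop))
  have hg1 : ∀ j : Fin (k + 1), Continuous fun s : Fin k → ℝ =>
      f j (Fin.insertNth j (1 - ∑ l, s l) s) := fun j =>
    (hf j).continuous.comp ((continuous_insertNth j).comp
      (by fun_prop : Continuous fun s : Fin k → ℝ => (1 - ∑ l, s l, s)))
  have hg2 : ∀ j : Fin (k + 1), Continuous fun s : Fin k → ℝ => f j (Fin.insertNth j 0 s) :=
    fun j => (hf j).continuous.comp ((continuous_insertNth j).comp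
      (by fun_prop : Continuous fun s : Fin k → ℝ => ((0 : ℝ), s)))
  have hg3 : ∀ j : Fin (k + 1), Continuous fun s : Fin k → ℝ =>
      f j (Fin.insertNth 0 (1 - ∑ l, s l) s) := fun j =>
    (hf j).continuous.comp ((continuous_insertNth 0).comp
      (by fun_prop : Continuous fun s : Fin k → ℝ => (1 - ∑ l, s l, s)))
  have hint : ∀ {g : (Fin k → ℝ) → ℝ}, Continuous g → IntegrableOn g (simplex k) := fun hg =>
    hg.continuousOn.integrableOn_compact (isCompact_simplex k)
  have h1 : extDeriv (csLocal P hk hn a b) y (fun i => u i) = ∑ j : Fin (k + 1),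
      (-1 : ℝ) ^ (j : ℕ) * ((∫ s in simplex k, f j (Fin.insertNth 0 (1 - ∑ l, s l) s)) -
        ∫ s in simplex k, f j (Fin.insertNth j 0 s)) := by
    rw [extDeriv_csLocal_apply P hk hn hU ha hb hy]
    simp only [extDeriv_csIntegrand P hk hn hU ha hb hy]
    rw [integral_finsetSum]
    · refine Finset.sum_congr rfl fun j _ => ?_
      rw [integral_const_mul]
      congr 1
      -- Each coordinate parametrizes the slanted face differently; all are brought to the
      -- parametrization by the coordinates other than the first, so that the contributions can be
      -- added.
      rw [← setIntegral_simplex_face j (hf j).continuous,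
        ← integral_sub (hint (hg1 j)) (hint (hg2 j))]
      exact setIntegral_simplex_fderiv j (hf j)
    · intro j _
      refine Integrable.const_mul ?_ _
      exact (((hf j).continuous_fderiv (by simp)).clm_apply
        continuous_const).continuousOn.integrableOn_compact (isCompact_simplex (k + 1))
  have h2 : csLocal P hk' hn' (fun j => a (Fin.succAbove 0 j)) (fun j => b (Fin.succAbove 0 j)) y
      (fun i => u i) = ∑ j : Fin (k + 1), (-1 : ℝ) ^ (j : ℕ) *
        ∫ s in simplex k, f j (Fin.insertNth 0 (1 - ∑ l, s l) s) := by
    rw [csLocal_apply P hk' hn' hU (fun i => ha _) (fun i => hb _) hy]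
    have h3 : ∀ s : Fin k → ℝ, csIntegrand P hk' hn' (fun j => a (Fin.succAbove 0 j))
        (fun j => b (Fin.succAbove 0 j)) s y (fun i => u i) = ∑ j : Fin (k + 1),
          (-1 : ℝ) ^ (j : ℕ) * f j (Fin.insertNth 0 (1 - ∑ l, s l) s) := fun s => by
      -- The edges of the slanted face are differences of basis vectors; expanding them produces
      -- exactly the alternating sum over the coordinates.
      rw [csIntegrand_eq_univInv P hk' hn' ha' hb' (affineForm_insertNth_one_sub a s)
        (affineForm_insertNth_one_sub b s)
        (fun j => stdSeq (k + 1) (j + 1) - stdSeq (k + 1) 0) (fun j => sub_eq_diffForm_sub a j y)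
        (fun j => sub_eq_diffForm_sub b j y), univInv_vcat_sub P _ hn', Finset.sum_range,
        Finset.mul_sum]
      exact Finset.sum_congr rfl fun j _ => mul_left_comm _ _ _
    simp only [h3]
    rw [integral_finsetSum _ fun j _ => (hint (hg3 j)).const_mul _]
    exact Finset.sum_congr rfl fun j _ => integral_const_mul _ _
  have h4 : ∀ j : Fin (k + 1), csLocal P hk' hn' (fun i => a (j.succ.succAbove i))
      (fun i => b (j.succ.succAbove i)) y (fun i => u i) =
        ∫ s in simplex k, f j (Fin.insertNth j 0 s) := fun j => by
    rw [csLocal_apply P hk' hn' hU (fun i => ha _) (fun i => hb _) hy]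
    refine integral_congr_ae (Filter.Eventually.of_forall fun s => ?_)
    exact csIntegrand_eq_univInv P hk' hn' ha' hb' (affineForm_insertNth_zero a j s)
      (affineForm_insertNth_zero b j s) (skip j (stdSeq (k + 1)))
      (fun i => sub_eq_diffForm_skip a j i y) (fun i => sub_eq_diffForm_skip b j i y) u
  rw [h1, ContinuousAlternatingMap.sum_apply]
  conv_rhs => rw [Fin.sum_univ_succ]
  simp only [ContinuousAlternatingMap.smul_apply, smul_eq_mul, h4]
  rw [h2]
  -- Coordinate `j` belongs to the connection number `j + 1`; this shift supplies the minus sign of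
  -- the lower endpoints.
  simp only [Fin.val_zero, pow_zero, one_mul, Fin.val_succ, mul_sub, Finset.sum_sub_distrib,
    pow_succ]
  rw [sub_eq_add_neg, ← Finset.sum_neg_distrib]
  congr 1
  exact Finset.sum_congr rfl fun j _ => by ring

end LocalDescent

/-! ### Dependence of the integrands on the simplex parameters -/

section ParameterDependence

variable {X : Type*} [NormedAddCommGroup X] [NormedSpace ℝ X]
  {T : Type*} [NormedAddCommGroup T] [NormedSpace ℝ T] [FiniteDimensional ℝ T]
  {F G : Type*} [NormedAddCommGroup F] [NormedSpace ℝ F] [FiniteDimensional ℝ F]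
  [NormedAddCommGroup G] [NormedSpace ℝ G] [FiniteDimensional ℝ G]

/-- The slots live in spaces of forms of different degrees, so the product is expanded into its sum
over permutations, where each term is multilinear in vectors of one fixed space. -/
theorem contDiffAt_wedgePair_of_degrees {r : ℕ}
    (P : MultilinearMap ℝ (fun _ : Fin r => F) (G →ₗ[ℝ] ℝ)) {d : Fin r → ℕ}
    {ψ : ∀ i, X → T [⋀^Fin (d i)]→L[ℝ] F} {q : ℕ} {θ : X → T [⋀^Fin q]→L[ℝ] G} {n : ℕ}
    (h : ∑ i, d i + q = n) {x : X} {m : WithTop ℕ∞} (hψ : ∀ i, ContDiffAt ℝ m (ψ i) x)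
    (hθ : ContDiffAt ℝ m θ x) :
    ContDiffAt ℝ m (fun y => wedgePair P (fun i => ⟨d i, ψ i y⟩) (θ y) h) x := by
  refine contDiffAt_of_apply fun u => ?_
  let e : ((Σ i : Fin r, Fin (d i)) ⊕ Fin q) ≃ Fin n :=
    ((finSigmaFinEquiv.sumCongr (Equiv.refl _)).trans finSumFinEquiv).trans (finCongr h)
  have h1 : (fun y => wedgePair P (fun i => ⟨d i, ψ i y⟩) (θ y) h u) = fun y =>
      ((((∏ i, (d i).factorial) * q.factorial : ℕ) : ℝ))⁻¹ • ∑ σ : Equiv.Perm (Fin n),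
        Equiv.Perm.sign σ • P (fun i => ψ i y fun l => u (σ (e (Sum.inl ⟨i, l⟩))))
          (θ y fun l => u (σ (e (Sum.inr l)))) := by
    funext y
    simp only [wedgePair, alternate, ContinuousAlternatingMap.smul_apply,
      ContinuousMultilinearMap.alternatization_apply_apply]
    rfl
  rw [h1]
  exact ContDiffAt.const_smul _ (ContDiffAt.sum fun σ _ => ContDiffAt.const_smul _
    (contDiffAt_multilinear_apply P (fun i => contDiffAt_apply (hψ i) _) (contDiffAt_apply hθ _)))

theorem contDiffAt_wedgePair_slots {r : ℕ}
    (P : MultilinearMap ℝ (fun _ : Fin r => F) (G →ₗ[ℝ] ℝ)) {k : ℕ}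
    (a : Fin k → T [⋀^Fin 1]→L[ℝ] F) {f : X → T [⋀^Fin 2]→L[ℝ] F} {q : ℕ}
    {θ : X → T [⋀^Fin q]→L[ℝ] G} {n : ℕ} (h : ∀ y, ∑ i, (slots r a (f y) i).1 + q = n) {x : X}
    {m : WithTop ℕ∞} (hf : ContDiffAt ℝ m f x) (hθ : ContDiffAt ℝ m θ x) :
    ContDiffAt ℝ m (fun y => wedgePair P (slots r a (f y)) (θ y) (h y)) x := by
  have h1 : ∀ i : Fin r, ∃ (d : ℕ) (ψ : X → T [⋀^Fin d]→L[ℝ] F),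
      (∀ y, slots r a (f y) i = ⟨d, ψ y⟩) ∧ ContDiffAt ℝ m ψ x := fun i => by
    by_cases hi : (i : ℕ) < k
    · exact ⟨1, fun _ => a ⟨i, hi⟩, fun y => slots_of_lt _ _ hi, contDiffAt_const⟩
    · exact ⟨2, f, fun y => slots_of_not_lt _ _ hi, hf⟩
  choose d ψ h2 h3 using h1
  have h4 : ∀ y, slots r a (f y) = fun i => ⟨d i, ψ i y⟩ := fun y => funext fun i => h2 i y
  have h5 : ∑ i, d i + q = n := by rw [← h x, h4]
  have h6 : (fun y => wedgePair P (slots r a (f y)) (θ y) (h y)) =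
      fun y => wedgePair P (fun i => ⟨d i, ψ i y⟩) (θ y) h5 :=
    funext fun y => wedgePair_congr P (h4 y) rfl _ _
  rw [h6]
  exact contDiffAt_wedgePair_of_degrees P h5 h3 hθ

omit [FiniteDimensional ℝ T] [FiniteDimensional ℝ F] in
theorem contDiff_affineForm {K n : ℕ} (w : Fin (K + 1) → T → T [⋀^Fin n]→L[ℝ] F) (y : T) :
    ContDiff ℝ ∞ fun t => affineForm w t y := by
  unfold affineForm
  fun_prop

omit [FiniteDimensional ℝ T] [FiniteDimensional ℝ F] in
theorem contDiffOn_affineForm {K n : ℕ} {w : Fin (K + 1) → T → T [⋀^Fin n]→L[ℝ] F} {U : Set T}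
    (hw : ∀ i, ContDiffOn ℝ ∞ (w i) U) (t : Fin K → ℝ) : ContDiffOn ℝ ∞ (affineForm w t) U :=
  (hw 0).add (ContDiffOn.sum fun i _ => ((hw i.succ).sub (hw 0)).const_smul (t i))

omit [FiniteDimensional ℝ T] [FiniteDimensional ℝ F] in
-- The parameters pass through `d`, so the curvatures at a fixed point are explicit expressions in
-- the parameters.
theorem extDeriv_affineForm {K n : ℕ} {w : Fin (K + 1) → T → T [⋀^Fin n]→L[ℝ] F} {y : T}
    (hw : ∀ i, DifferentiableAt ℝ (w i) y) (t : Fin K → ℝ) :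
    extDeriv (affineForm w t) y = affineForm (fun i => extDeriv (w i)) t y := by
  have h1 : HasFDerivAt (affineForm w t)
      (fderiv ℝ (w 0) y + ∑ i, t i • (fderiv ℝ (w i.succ) y - fderiv ℝ (w 0) y)) y :=
    (hw 0).hasFDerivAt.add (HasFDerivAt.fun_sum fun i _ =>
      ((hw i.succ).hasFDerivAt.sub (hw 0).hasFDerivAt).const_smul (t i))
  have h2 := map_add (ContinuousAlternatingMap.alternatizeUncurryFinCLM ℝ T F (n := n))
    (fderiv ℝ (w 0) y) (∑ i, t i • (fderiv ℝ (w i.succ) y - fderiv ℝ (w 0) y))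
  simp only [map_sum, map_smul, map_sub] at h2
  rw [extDeriv, h1.fderiv]
  exact h2

end ParameterDependence

/-! ### Local expressions and coordinate changes -/

section Charts

variable {m : ℕ} {M : Type*} [TopologicalSpace M] [ChartedSpace (EuclideanSpace ℝ (Fin m)) M]
  [IsManifold (𝓡 m) ∞ M] {V : Type*} [NormedAddCommGroup V] [NormedSpace ℝ V]

theorem mdifferentiableAt_extChartAt_symm {x₀ : M} {y : EuclideanSpace ℝ (Fin m)}
    (hy : y ∈ (extChartAt (𝓡 m) x₀).target) :
    MDifferentiableAt 𝓘(ℝ, EuclideanSpace ℝ (Fin m)) (𝓡 m) (extChartAt (𝓡 m) x₀).symm y := by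
  have : IsManifold (𝓡 m) 1 M := IsManifold.of_le (n := ∞) (by simp)
  have h := mdifferentiableWithinAt_extChartAt_symm hy
  rwa [ModelWithCorners.range_eq_univ, mdifferentiableWithinAt_univ] at h

theorem chartDeriv_comp_chartSymmDeriv {x₀ x : M} {y : EuclideanSpace ℝ (Fin m)}
    (hy : y ∈ (extChartAt (𝓡 m) x₀).target)
    (hx : (extChartAt (𝓡 m) x₀).symm y ∈ (extChartAt (𝓡 m) x).source) :
    chartDeriv x ((extChartAt (𝓡 m) x₀).symm y) ∘L chartSymmDeriv x₀ y =
      fderiv ℝ (extChartAt (𝓡 m) x ∘ (extChartAt (𝓡 m) x₀).symm) y := by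
  have : IsManifold (𝓡 m) 1 M := IsManifold.of_le (n := ∞) (by simp)
  have h := mfderiv_comp y (mdifferentiableAt_extChartAt (I := 𝓡 m) (x := x)
    (y := (extChartAt (𝓡 m) x₀).symm y) (by rwa [extChartAt_source] at hx))
    (mdifferentiableAt_extChartAt_symm hy)
  rw [mfderiv_eq_fderiv] at h
  exact h.symm

theorem chartSymmDeriv_comp_chartDeriv {x p : M} (hp : p ∈ (extChartAt (𝓡 m) x).source) :
    chartSymmDeriv x (extChartAt (𝓡 m) x p) ∘L chartDeriv x p = ContinuousLinearMap.id ℝ _ := by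
  have : IsManifold (𝓡 m) 1 M := IsManifold.of_le (n := ∞) (by simp)
  have h := mfderivWithin_extChartAt_symm_comp_mfderiv_extChartAt' (I := 𝓡 m) hp
  rw [ModelWithCorners.range_eq_univ, mfderivWithin_univ] at h
  exact h

theorem DForm.eq_local_comp {n : ℕ} (ψ : DForm m M V n) {x p : M}
    (hp : p ∈ (extChartAt (𝓡 m) x).source) :
    ψ p = (ψ.local x (extChartAt (𝓡 m) x p)).compContinuousLinearMap (chartDeriv x p) := by
  ext v
  have h : ∀ w, chartSymmDeriv x (extChartAt (𝓡 m) x p) (chartDeriv x p w) = w := fun w =>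
    congrArg (fun f => f w) (chartSymmDeriv_comp_chartDeriv hp)
  simp only [DForm.local, ContinuousAlternatingMap.compContinuousLinearMap_apply,
    (extChartAt (𝓡 m) x).left_inv hp]
  congr 1
  funext i
  exact (h (v i)).symm

/-- The expressions of a form in two charts are related by the coordinate change. -/
theorem DForm.local_eq_pullback {n : ℕ} (ψ : DForm m M V n) {x₀ x : M}
    {y : EuclideanSpace ℝ (Fin m)} (hy : y ∈ (extChartAt (𝓡 m) x₀).target)
    (hx : (extChartAt (𝓡 m) x₀).symm y ∈ (extChartAt (𝓡 m) x).source) :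
    ψ.local x₀ y = (ψ.local x ((extChartAt (𝓡 m) x ∘ (extChartAt (𝓡 m) x₀).symm) y)
      ).compContinuousLinearMap
        (fderiv ℝ (extChartAt (𝓡 m) x ∘ (extChartAt (𝓡 m) x₀).symm) y) := by
  rw [← chartDeriv_comp_chartSymmDeriv hy hx, DForm.local, ψ.eq_local_comp hx]
  rfl

/-- The exterior derivative is computed in any chart. -/
theorem DForm.local_d {n : ℕ} {ψ : DForm m M V n} (hψ : ψ.IsSmooth) {x₀ : M}
    {y : EuclideanSpace ℝ (Fin m)} (hy : y ∈ (extChartAt (𝓡 m) x₀).target) :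
    ψ.d.local x₀ y = extDeriv (ψ.local x₀) y := by
  set x := (extChartAt (𝓡 m) x₀).symm y
  have hxs : (extChartAt (𝓡 m) x₀).symm y ∈ (extChartAt (𝓡 m) x).source :=
    mem_extChartAt_source x
  have hs : y ∈ ((extChartAt (𝓡 m) x₀).symm ≫ extChartAt (𝓡 m) x).source := ⟨hy, hxs⟩
  -- At the point over `y`, `d` is defined through the preferred chart there. Near `y` the two local
  -- expressions differ by pull-back along the coordinate change, with which `extDeriv` commutes.
  have h1 : ψ.local x₀ =ᶠ[nhds y] fun z =>
      (ψ.local x ((extChartAt (𝓡 m) x ∘ (extChartAt (𝓡 m) x₀).symm) z)).compContinuousLinearMap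
        (fderiv ℝ (extChartAt (𝓡 m) x ∘ (extChartAt (𝓡 m) x₀).symm) z) := by
    have h2 : (extChartAt (𝓡 m) x₀).symm ⁻¹' (extChartAt (𝓡 m) x).source ∈ nhds y :=
      (continuousAt_extChartAt_symm'' hy).preimage_mem_nhds
        ((isOpen_extChartAt_source x).mem_nhds hxs)
    filter_upwards [(isOpen_extChartAt_target x₀).mem_nhds hy, h2] with z hz hz'
    exact ψ.local_eq_pullback hz hz'
  have h3 : ContDiffAt ℝ ∞ (extChartAt (𝓡 m) x ∘ (extChartAt (𝓡 m) x₀).symm) y := by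
    have h := contDiffWithinAt_ext_coord_change (I := 𝓡 m) (n := ∞) x x₀ hs
    rwa [ModelWithCorners.range_eq_univ, contDiffWithinAt_univ] at h
  have h4 : DifferentiableAt ℝ (ψ.local x)
      ((extChartAt (𝓡 m) x ∘ (extChartAt (𝓡 m) x₀).symm) y) :=
    ((hψ x).contDiffAt ((isOpen_extChartAt_target x).mem_nhds
      (mem_extChartAt_target x))).differentiableAt (by simp)
  rw [h1.extDeriv_eq, extDeriv_pullback h4 h3 (by
    simpa using (WithTop.coe_le_coe.2 le_top : ((2 : ℕ∞) : WithTop ℕ∞) ≤ (⊤ : ℕ∞))),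
    ← chartDeriv_comp_chartSymmDeriv hy hxs]
  rfl

end Charts

/-- The two integrals in the Chern–Simons form become one, so that pull-back to a chart can be
carried out under the integral sign. -/
theorem map_integral_combination {X G G' : Type*} [MeasurableSpace X] {μ : Measure X}
    [NormedAddCommGroup G] [NormedSpace ℝ G] [CompleteSpace G] [NormedAddCommGroup G']
    [NormedSpace ℝ G'] [CompleteSpace G'] (Λ : G →L[ℝ] G') {ι : Type*} [Fintype ι] {u : X → G}
    {v : ι → X → G} (hu : Integrable u μ) (hv : ∀ i, Integrable (v i) μ) (a b : ℝ) (c : ι → ℝ) :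
    Λ (a • ∫ t, u t ∂μ + b • ∫ t, ∑ i, c i • v i t ∂μ) =
      ∫ t, Λ (a • u t + b • ∑ i, c i • v i t) ∂μ := by
  have h1 : Integrable (fun t => a • u t) μ := hu.fun_smul a
  have h2 : Integrable (fun t => b • ∑ i, c i • v i t) μ :=
    (integrable_finsetSum _ fun i _ => (hv i).fun_smul (c i)).fun_smul b
  rw [← integral_smul, ← integral_smul, ← integral_add h1 h2]
  exact (Λ.integral_comp_comm (h1.add h2)).symm

/-! ### Passage to the manifold -/

section ChernSimonsOnManifold

variable {m : ℕ} {M : Type*} [TopologicalSpace M] [ChartedSpace (EuclideanSpace ℝ (Fin m)) M]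
  [IsManifold (𝓡 m) ∞ M]
  {V₀ V₁ : Type*} [NormedAddCommGroup V₀] [NormedSpace ℝ V₀] [FiniteDimensional ℝ V₀]
  [NormedAddCommGroup V₁] [NormedSpace ℝ V₁] [FiniteDimensional ℝ V₁]
  (L : TwoTermLInfty V₀ V₁) {x₀ : M} {y : EuclideanSpace ℝ (Fin m)}

omit [FiniteDimensional ℝ V₀] in
theorem local_curvF {A : DForm m M V₀ 1} {B : DForm m M V₁ 2} (hA : A.IsSmooth)
    (hy : y ∈ (extChartAt (𝓡 m) x₀).target) :
    (curvF L A B).local x₀ y = locF L (A.local x₀) (B.local x₀) y := by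
  rw [locF, ← DForm.local_d hA hy, DForm.local, DForm.local, DForm.local, ← wedge₂_comp]
  rfl

omit [FiniteDimensional ℝ V₀] [FiniteDimensional ℝ V₁] in
theorem local_curvH {A : DForm m M V₀ 1} {B : DForm m M V₁ 2} (hB : B.IsSmooth)
    (hy : y ∈ (extChartAt (𝓡 m) x₀).target) :
    (curvH L A B).local x₀ y = locH L (A.local x₀) (B.local x₀) y := by
  rw [locH, ← DForm.local_d hB hy, DForm.local, DForm.local, DForm.local, DForm.local, ← wedge₂_comp,
    ← wedge₃_comp]
  rfl

variable {k : ℕ} (c : Fin (k + 1) → Connection m M V₀ V₁)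

omit [IsManifold (𝓡 m) ∞ M] [FiniteDimensional ℝ V₀] [FiniteDimensional ℝ V₁] in
theorem local_interpA (t : Fin k → ℝ) :
    (interpA c t).local x₀ = affineForm (fun i => (c i).A.local x₀) t := by
  funext y
  ext v
  simp [DForm.local, interpA, η, affineForm]

omit [IsManifold (𝓡 m) ∞ M] [FiniteDimensional ℝ V₀] [FiniteDimensional ℝ V₁] in
theorem local_interpB (t : Fin k → ℝ) :
    (interpB c t).local x₀ = affineForm (fun i => (c i).B.local x₀) t := by
  funext y
  ext v
  simp [DForm.local, interpB, φ, affineForm]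

omit [FiniteDimensional ℝ V₀] in
theorem local_interpF (t : Fin k → ℝ) (hy : y ∈ (extChartAt (𝓡 m) x₀).target) :
    (interpF c L t).local x₀ y = locF L (affineForm (fun i => (c i).A.local x₀) t)
      (affineForm (fun i => (c i).B.local x₀) t) y := by
  rw [interpF, local_curvF L _ hy, local_interpA, local_interpB]
  exact fun x => by
    rw [local_interpA]
    exact contDiffOn_affineForm (fun i => (c i).smooth_A x) t

omit [FiniteDimensional ℝ V₀] [FiniteDimensional ℝ V₁] in
theorem local_interpH (t : Fin k → ℝ) (hy : y ∈ (extChartAt (𝓡 m) x₀).target) :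
    (interpH c L t).local x₀ y = locH L (affineForm (fun i => (c i).A.local x₀) t)
      (affineForm (fun i => (c i).B.local x₀) t) y := by
  rw [interpH, local_curvH L _ hy, local_interpA, local_interpB]
  exact fun x => by
    rw [local_interpB]
    exact contDiffOn_affineForm (fun i => (c i).smooth_B x) t

/-- Needed for integrability over the simplex at a fixed point: in the chart there, the curvature is
built by smooth operations from forms that are affine in the parameters. -/
theorem contDiff_interpF (x : M) : ContDiff ℝ ∞ fun t => interpF c L t x := by
  have h1 : ∀ i, DifferentiableAt ℝ ((c i).A.local x) (extChartAt (𝓡 m) x x) := fun i =>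
    (((c i).smooth_A x).contDiffAt ((isOpen_extChartAt_target x).mem_nhds
      (mem_extChartAt_target x))).differentiableAt (by simp)
  have h2 : (fun t => interpF c L t x) = fun t =>
      ContinuousAlternatingMap.compContinuousLinearMapCLM (chartDeriv x x)
        (locF L (affineForm (fun i => (c i).A.local x) t) (affineForm (fun i => (c i).B.local x) t)
          (extChartAt (𝓡 m) x x)) := funext fun t => by
    rw [← local_interpF L c t (mem_extChartAt_target x)]
    exact (interpF c L t).eq_local_comp (mem_extChartAt_source x)
  rw [h2]
  refine (ContinuousLinearMap.contDiff _).comp (contDiff_iff_contDiffAt.2 fun t => ?_)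
  simp only [locF, extDeriv_affineForm h1]
  have hA := (contDiff_affineForm (fun i => (c i).A.local x) (extChartAt (𝓡 m) x x)).contDiffAt
    (x := t)
  exact ((contDiff_affineForm _ _).contDiffAt.add
    ((contDiffAt_wedge₂ L.br hA hA).const_smul (1 / 2 : ℝ))).sub
    ((contDiff_affineForm _ _).contDiffAt.continuousLinearMap_comp
      (ContinuousLinearMap.compContinuousAlternatingMapCLM ℝ _ V₁ V₀ (Fin 2)
        (LinearMap.toContinuousLinearMap L.α)))

theorem contDiff_interpH (x : M) : ContDiff ℝ ∞ fun t => interpH c L t x := by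
  have h1 : ∀ i, DifferentiableAt ℝ ((c i).B.local x) (extChartAt (𝓡 m) x x) := fun i =>
    (((c i).smooth_B x).contDiffAt ((isOpen_extChartAt_target x).mem_nhds
      (mem_extChartAt_target x))).differentiableAt (by simp)
  have h2 : (fun t => interpH c L t x) = fun t =>
      ContinuousAlternatingMap.compContinuousLinearMapCLM (chartDeriv x x)
        (locH L (affineForm (fun i => (c i).A.local x) t) (affineForm (fun i => (c i).B.local x) t)
          (extChartAt (𝓡 m) x x)) := funext fun t => by
    rw [← local_interpH L c t (mem_extChartAt_target x)]
    exact (interpH c L t).eq_local_comp (mem_extChartAt_source x)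
  rw [h2]
  refine (ContinuousLinearMap.contDiff _).comp (contDiff_iff_contDiffAt.2 fun t => ?_)
  simp only [locH, extDeriv_affineForm h1]
  have hA := (contDiff_affineForm (fun i => (c i).A.local x) (extChartAt (𝓡 m) x x)).contDiffAt
    (x := t)
  have hB := (contDiff_affineForm (fun i => (c i).B.local x) (extChartAt (𝓡 m) x x)).contDiffAt
    (x := t)
  exact ((contDiff_affineForm _ _).contDiffAt.add (contDiffAt_wedge₂ L.act hA hB)).sub
    ((contDiffAt_wedge₃ L.jac hA).const_smul (1 / 6 : ℝ))

variable {L} {r : ℕ} (P : InvariantForm L r)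

section Smoothness

variable (hk : k ≤ r) {n : ℕ} (hn : n + k = 2 * r + 3)

theorem integrableOn_integrandH (x : M) :
    IntegrableOn (fun t => integrandH c P hk hn t x) (simplex k) := by
  refine Continuous.continuousOn (ContDiff.continuous (𝕜 := ℝ) (n := ∞)
    (contDiff_iff_contDiffAt.2 fun t => ?_)) |>.integrableOn_compact (isCompact_simplex k)
  exact contDiffAt_wedgePair_slots P.form _ _ (contDiff_interpF L c x).contDiffAt
    (contDiff_interpH L c x).contDiffAt

theorem integrableOn_integrandφ (x : M) (i : Fin k) :
    IntegrableOn (fun t => integrandφ c P hk hn i t x) (simplex k) := by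
  refine Continuous.continuousOn (ContDiff.continuous (𝕜 := ℝ) (n := ∞)
    (contDiff_iff_contDiffAt.2 fun t => ?_)) |>.integrableOn_compact (isCompact_simplex k)
  exact contDiffAt_wedgePair_slots P.form _ _ (contDiff_interpF L c x).contDiffAt contDiffAt_const

/-- In a chart, the Chern–Simons form is the Chern–Simons form of the local expressions. -/
theorem local_chernSimons (hy : y ∈ (extChartAt (𝓡 m) x₀).target) :
    (chernSimons c P hk hn).local x₀ y =
      csLocal P hk hn (fun i => (c i).A.local x₀) (fun i => (c i).B.local x₀) y := by
  set x := (extChartAt (𝓡 m) x₀).symm y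
  have h1 := map_integral_combination
    (ContinuousAlternatingMap.compContinuousLinearMapCLM (chartSymmDeriv x₀ y))
    (integrableOn_integrandH c P hk hn x) (integrableOn_integrandφ c P hk hn x)
    ((r.factorial : ℝ) / ((r - k).factorial : ℝ))
    ((r.factorial : ℝ) / ((r - k + 1).factorial : ℝ) * (-1) ^ k) fun i => (-1 : ℝ) ^ ((i : ℕ) + 1)
  refine h1.trans (integral_congr_ae (Filter.Eventually.of_forall fun t => ?_))
  have h2 := csForm_comp P hk hn (fun j => η c j x) (fun j => φ c j x) (interpF c L t x)
    (interpH c L t x) (chartSymmDeriv x₀ y)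
  refine h2.trans ?_
  beta_reduce
  rw [csIntegrand, ← local_interpF L c t hy, ← local_interpH L c t hy]
  rfl

theorem isSmooth_chernSimons : (chernSimons c P hk hn).IsSmooth := fun x₀ =>
  (contDiffOn_csLocal P hk hn (isOpen_extChartAt_target x₀) (fun i => (c i).smooth_A x₀)
    fun i => (c i).smooth_B x₀).congr fun _ hy => local_chernSimons c P hk hn hy

end Smoothness

/-- The higher descent equations. -/
theorem d_chernSimons (c : Fin (k + 1 + 1) → Connection m M V₀ V₁) (hk : k + 1 ≤ r) {n : ℕ}
    (hn : n + (k + 1) = 2 * r + 3) :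
    (chernSimons c P hk hn).d = ∑ i : Fin (k + 1 + 1), (-1 : ℝ) ^ (i : ℕ) •
      chernSimons (fun j => c (i.succAbove j)) P (show k ≤ r by omega)
        (show n + 1 + k = 2 * r + 3 by omega) := by
  funext x
  have hy := mem_extChartAt_target (I := 𝓡 m) x
  have hU := isOpen_extChartAt_target (I := 𝓡 m) x
  have h1 : (chernSimons c P hk hn).local x =ᶠ[nhds (extChartAt (𝓡 m) x x)]
      csLocal P hk hn (fun i => (c i).A.local x) fun i => (c i).B.local x :=
    Filter.eventually_of_mem (hU.mem_nhds hy) fun y hy => local_chernSimons c P hk hn hy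
  rw [DForm.d, h1.extDeriv_eq, extDeriv_csLocal P hk hn hU (fun i => (c i).smooth_A x)
    (fun i => (c i).smooth_B x) hy, Finset.sum_apply]
  ext v
  simp only [ContinuousAlternatingMap.compContinuousLinearMap_apply,
    ContinuousAlternatingMap.sum_apply, ContinuousAlternatingMap.smul_apply, Pi.smul_apply]
  refine Finset.sum_congr rfl fun i _ => ?_
  -- The right-hand side is also written in the chart at `x`, where both sides are pull-backs along
  -- the same derivative.
  rw [(chernSimons (fun j => c (i.succAbove j)) P _ _).eq_local_comp (mem_extChartAt_source x),
    local_chernSimons _ P _ _ hy]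
  rfl

end ChernSimonsOnManifold

end HigherCS

end

theorem mainTheorem1 {m : ℕ} {M : Type*} [TopologicalSpace M]
    [ChartedSpace (EuclideanSpace ℝ (Fin m)) M] [IsManifold (𝓡 m) ∞ M]
    {V₀ V₁ : Type*} [NormedAddCommGroup V₀] [NormedSpace ℝ V₀] [FiniteDimensional ℝ V₀]
    [NormedAddCommGroup V₁] [NormedSpace ℝ V₁] [FiniteDimensional ℝ V₁]
    (L : HigherCS.TwoTermLInfty V₀ V₁)
    (balanced : Module.finrank ℝ V₀ = Module.finrank ℝ V₁)
    {r : ℕ} (P : HigherCS.InvariantForm L r)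
    {k : ℕ} (hk : k + 1 ≤ r) {n : ℕ} (hn : n + (k + 1) = 2 * r + 3)
    (c : Fin (k + 1 + 1) → HigherCS.Connection m M V₀ V₁) :
    (HigherCS.chernSimons c P hk hn).IsSmooth ∧
    (HigherCS.chernSimons c P hk hn).d =
      ∑ i : Fin (k + 1 + 1), (-1 : ℝ) ^ (i : ℕ) •
        HigherCS.chernSimons (fun j => c (i.succAbove j)) P
          (show k ≤ r by omega) (show n + 1 + k = 2 * r + 3 by omega) :=
  ⟨HigherCS.isSmooth_chernSimons c P hk hn, HigherCS.d_chernSimons P c hk hn⟩
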